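/- Let $n\ge 0$, let $\lambda=(\lambda_1\ge\dots\ge\lambda_n\ge 0)$ be a partition with largest part $r$, and let $\alpha>0$ be real. For a partition $\lambda$ and real $q,t$ let $P_\lambda(x_1,\dots,x_n;q,t)$ be the Macdonald polynomial: the restriction to $n$ variables of the symmetric function $P_\lambda = m_\lambda+\sum_{\mu<\lambda}c_{\lambda\mu}m_\mu$ (dominance order), with $\langle P_\lambda,P_\mu\rangle=0$ for $\lambda\ne\mu$, where $\langle p_\lambda,p_\mu\rangle=\delta_{\lambda\mu}\,z_\lambda\prod_{i=1}^{\ell(\lambda)}\frac{1-q^{\lambda_i}}{1-t^{\lambda_i}}$ on products of power sums. The Jack polynomial is $P^{(\alpha)}_\lambda(x_1,\dots,x_n)=\lim_{t\to1}P_\lambda(x_1,\dots,x_n;t^\alpha,t)$ (limit of coefficients). Notation. For $0\le k\le r$, $\lambda[k]$ is obtained from $\lambda$ by replacing all parts of size $\le k$ by $0$. For a composition $\mu=(\mu_1,\dots,\mu_n)$ put $x_\mu=\prod_{k:\,\mu_k>0}x_k$ and $\mu'_j=\#\{k:\mu_k\ge j\}$. A permutation $\sigma\in S_n$ acts on compositions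 by $(\sigma\circ\mu)_k=\mu_{\sigma^{-1}(k)}$ and on polynomials by $s_\sigma: x_k\mapsto x_{\sigma(k)}$ (also written $\sigma\circ$). Let $S_\mu\subset S_n$ be any complete system of representatives of the left cosets of the stabilizer of $\mu$, so that each rearrangement of $\mu$ is $\sigma\circ\mu$ for exactly one $\sigma\in S_\mu$. For compositions $\lambda,\mu$ put $a_j(\lambda,\mu)=\#\{k:\lambda_k=0,\ \mu_k=j\}$ and $b_j(\lambda,\mu)=\#\{k: j=\lambda_k>\mu_k\}$. With $r$ fixed, let $C_i(\lambda,\mu;q,t)$ and $C_i^{(\alpha)}(\lambda,\mu)$ be $0$ if $0<\lambda_k<\mu_k$ for some $k$, and otherwise $$C_i(\lambda,\mu;q,t)=\prod_{j=i+1}^{r}\Bigl(q^{(j-i)a_j(\lambda,\mu)}\prod_{k=1}^{b_j(\lambda,\mu)}\frac{1-t^k}{1-q^{j-i}t^{\lambda'_i-\lambda'_j+k}}\Bigr),\qquad C_i^{(\alpha)}(\lambda,\mu)=\prod_{j=i+1}^{r}\prod_{k=1}^{b_j(\lambda,\mu)}\frac{k}{(j-i)\alpha+\lambda'_i-\lambda'_j+k}.$$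 Then: 1. $\lim_{t\to1}C_i(\lambda,\mu;t^\alpha,t)=C_i^{(\alpha)}(\lambda,\mu)$ for all compositions $\lambda,\mu$ and all $i$, $r$. 2. The limit defining the Jack polynomial exists and $$P^{(\alpha)}_\lambda(x_1,\dots,x_n)=\sum_{\sigma\in S_\lambda}s_\sigma\circ x_\lambda\circ\prod_{i=1}^{r-1}\Bigl(\sum_{\sigma\in S_{\lambda[i]}}C_i^{(\alpha)}\bigl(\lambda[i-1],\sigma\circ\lambda[i]\bigr)\,s_\sigma\circ x_{\lambda[i]}\circ\Bigr)1,$$ where $x_\mu$ stands for the operator of multiplication by $x_\mu$ and the factors are composed from left to right. 3. Equivalently, with $\bar r=r-1$ (for $r=0$ only the sum over $\sigma[0]$ is present), $$P^{(\alpha)}_\lambda(x_1,\dots,x_n)=\sum_{\sigma[0]\in S_{\lambda[0]}}\ \sum_{\sigma[1]\in S_{\lambda[1]}}\cdots\sum_{\sigma[\bar r]\in S_{\lambda[\bar r]}}\ \prod_{i=1}^{\bar r}C_i^{(\alpha)}\bigl(\lambda[i-1],\sigma[i]\circ\lambda[i]\bigr)\ \prod_{i=0}^{\bar r}\Bigl\{\sigma[0]\circ\sigma[1]\circ\cdots\circ\sigma[i]\circ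 x_{\lambda[i]}\Bigr\}.$$ -/

import Mathlib

noncomputable section

open MvPolynomial Filter Topology

namespace JackSum

/-! ### Symmetric functions and Macdonald's scalar product -/

/-- The ring of symmetric functions over `ℝ`, presented as the polynomial ring
`ℝ[p₁, p₂, …]` in the power sums: the variable `X k` is the power sum `p_k`. -/
abbrev SymFun : Type := MvPolynomial ℕ+ ℝ

/-- The image of a symmetric function in the polynomial ring in `x_1, …, x_n`
(the power sum `p_k` goes to `x_1 ^ k + ⋯ + x_n ^ k`). -/
def toVars (n : ℕ) : SymFun →ₐ[ℝ] MvPolynomial (Fin n) ℝ :=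
  aeval fun k : ℕ+ => psum (Fin n) ℝ (k : ℕ)

/-- For the product of power sums `p_1 ^ (m 1) * p_2 ^ (m 2) * ⋯`, i.e. for `p_μ` with `μ` the
partition having `m k` parts equal to `k`, this is
`z_μ * ∏_i (1 - q ^ μ_i) / (1 - t ^ μ_i)` where `z_μ = ∏_k k ^ (m k) * (m k)!`. -/
def powerSumNorm (q t : ℝ) (m : ℕ+ →₀ ℕ) : ℝ :=
  ∏ k ∈ m.support,
    ((k : ℕ) : ℝ) ^ m k * ((m k).factorial : ℝ) *
      ((1 - q ^ (k : ℕ)) / (1 - t ^ (k : ℕ))) ^ m k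

/-- Macdonald's scalar product: products of power sums are pairwise orthogonal,
with squared norms given by `powerSumNorm`. -/
def scalarProduct (q t : ℝ) (f g : SymFun) : ℝ :=
  ∑ m ∈ f.support, coeff m f * coeff m g * powerSumNorm q t m

/-! ### The dominance order -/

/-- The sum of the `k` largest parts of a partition. -/
def partialSum {d : ℕ} (mu : d.Partition) (k : ℕ) : ℕ :=
  ((mu.parts.sort (· ≥ ·)).take k).sum

/-- The dominance order, `mu ≤ lam`. -/
def DomLE {d : ℕ} (mu lam : d.Partition) : Prop :=
  ∀ k, partialSum mu k ≤ partialSum lam k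

/-- The strict dominance order, `mu < lam`. -/
def DomLT {d : ℕ} (mu lam : d.Partition) : Prop :=
  DomLE mu lam ∧ ¬ DomLE lam mu

/-! ### Macdonald polynomials -/

/-- `Q = ∑_{mu < lam} c_mu m_mu` with real coefficients `c_mu`: an identity of symmetric functions,
that is, it holds in any number `n` of variables. Here `m_mu` is the monomial
symmetric polynomial. -/
def IsLower {d : ℕ} (lam : d.Partition) (Q : SymFun) : Prop :=
  ∃ c : d.Partition → ℝ, ∀ n : ℕ,
    toVars n Q = ∑ᶠ (mu : d.Partition) (_ : DomLT mu lam), c mu • msymm (Fin n) ℝ mu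

/-- `P = m_lam + ∑_{mu < lam} c_mu m_mu` with real coefficients `c_mu`. -/
def IsMonicTriangular {d : ℕ} (lam : d.Partition) (P : SymFun) : Prop :=
  ∃ c : d.Partition → ℝ, ∀ n : ℕ,
    toVars n P = msymm (Fin n) ℝ lam +
      ∑ᶠ (mu : d.Partition) (_ : DomLT mu lam), c mu • msymm (Fin n) ℝ mu

/-- The characterization of `P_lam` by Gram--Schmidt orthogonalization along the dominance order:
`P_lam` is `m_lam` plus lower terms, and it is orthogonal to all `m_mu` with `mu < lam`
(equivalently, to all `P_mu` with `mu < lam`). Any family `P` of monic triangular symmetric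
functions with `⟨P_lam, P_mu⟩ = 0` for all `lam ≠ mu` is given by this characterization:
see `macdonaldSym_eq_of_orthogonal_family` below. -/
def IsMacdonald (q t : ℝ) {d : ℕ} (lam : d.Partition) (P : SymFun) : Prop :=
  IsMonicTriangular lam P ∧ ∀ Q, IsLower lam Q → scalarProduct q t P Q = 0

open Classical in
/-- The Macdonald symmetric function `P_lam(q, t)`. -/
def macdonaldSym (q t : ℝ) {d : ℕ} (lam : d.Partition) : SymFun :=
  if h : ∃! P, IsMacdonald q t lam P then h.choose else 0

/-- The partition of `lam_1 + ⋯ + lam_n` whose parts are the nonzero `lam_i`. -/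
def toPartition {n : ℕ} (lam : Fin n → ℕ) : (Multiset.map lam Finset.univ.val).sum.Partition :=
  Nat.Partition.ofMultiset (Multiset.map lam Finset.univ.val)

/-- The Macdonald polynomial `P_lam(x_1, …, x_n; q, t)`, for a partition
`lam = (lam_1 ≥ ⋯ ≥ lam_n ≥ 0)`. -/
def macdonaldPoly (q t : ℝ) {n : ℕ} (lam : Fin n → ℕ) : MvPolynomial (Fin n) ℝ :=
  toVars n (macdonaldSym q t (toPartition lam))

/-- `J` is the Jack polynomial `P_lam^{(α)}(x_1, …, x_n)`: the limit, coefficient by coefficient, of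
the Macdonald polynomial `P_lam(x_1, …, x_n; q, t)` with `q = t ^ α` as `t → 1`. -/
def IsJackPoly (α : ℝ) {n : ℕ} (lam : Fin n → ℕ) (J : MvPolynomial (Fin n) ℝ) : Prop :=
  ∀ m : Fin n →₀ ℕ,
    Tendsto (fun t : ℝ => coeff m (macdonaldPoly (t ^ α) t lam)) (𝓝[≠] 1) (𝓝 (coeff m J))

/-! ### The ingredients of the sum formula -/

/-- The largest part `r`. -/
def largestPart {n : ℕ} (lam : Fin n → ℕ) : ℕ := Finset.univ.sup lam

/-- `lam[k]`: all parts of size at most `k` are replaced by `0`. -/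
def trunc {n : ℕ} (lam : Fin n → ℕ) (k : ℕ) : Fin n → ℕ :=
  fun i => if lam i ≤ k then 0 else lam i

/-- The monomial `x_lam`: the product of the variables `x_i` with `lam_i > 0`. -/
def xMon {n : ℕ} (lam : Fin n → ℕ) : MvPolynomial (Fin n) ℝ :=
  ∏ i with 0 < lam i, X i

/-- The `j`-th part of the conjugate partition, `lam'_j = #{k : lam_k ≥ j}`. -/
def conj {n : ℕ} (lam : Fin n → ℕ) (j : ℕ) : ℕ :=
  (Finset.univ.filter fun k => j ≤ lam k).card

/-- `a_j(lam, mu) = #{k : lam_k = 0, mu_k = j}`. -/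
def aFun {n : ℕ} (j : ℕ) (lam mu : Fin n → ℕ) : ℕ :=
  (Finset.univ.filter fun k => lam k = 0 ∧ mu k = j).card

/-- `b_j(lam, mu) = #{k : j = lam_k > mu_k}`. -/
def bFun {n : ℕ} (j : ℕ) (lam mu : Fin n → ℕ) : ℕ :=
  (Finset.univ.filter fun k => lam k = j ∧ mu k < lam k).card

open Classical in
/-- The coefficient `C_i(lam, mu)` of the sum formula for Macdonald polynomials
(`r` is the largest part of the partition under consideration). -/
def macdonaldCoeff (q t : ℝ) (r i : ℕ) {n : ℕ} (lam mu : Fin n → ℕ) : ℝ :=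
  if ∃ k, 0 < lam k ∧ lam k < mu k then 0
  else ∏ j ∈ Finset.Icc (i + 1) r,
    (q ^ ((j - i) * aFun j lam mu) *
      ∏ k ∈ Finset.Icc 1 (bFun j lam mu),
        (1 - t ^ k) / (1 - q ^ (j - i) * t ^ (conj lam i - conj lam j + k)))

open Classical in
/-- The coefficient `C_i(lam, mu)` of the sum formula for Jack polynomials
(`r` is the largest part of the partition under consideration). -/
def jackCoeff (α : ℝ) (r i : ℕ) {n : ℕ} (lam mu : Fin n → ℕ) : ℝ :=
  if ∃ k, 0 < lam k ∧ lam k < mu k then 0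
  else ∏ j ∈ Finset.Icc (i + 1) r, ∏ k ∈ Finset.Icc 1 (bFun j lam mu),
    (k : ℝ) / (((j : ℝ) - (i : ℝ)) * α + (conj lam i : ℝ) - (conj lam j : ℝ) + (k : ℝ))

/-- The action of permutations on compositions: `sigma` moves the part in position `k` to
position `sigma k`. Accordingly `s_sigma = rename sigma` acts on polynomials by
`x_k ↦ x_{sigma k}`. -/
def permComp {n : ℕ} (sigma : Equiv.Perm (Fin n)) (mu : Fin n → ℕ) : Fin n → ℕ :=
  fun k => mu (sigma⁻¹ k)

/-- `S` is the set `S_mu` of all permutations with a distinct action on `mu`: a complete system of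
representatives of the cosets in `S_n` of the stabilizer of `mu`. -/
def IsReps {n : ℕ} (mu : Fin n → ℕ) (S : Finset (Equiv.Perm (Fin n))) : Prop :=
  ∀ tau : Equiv.Perm (Fin n), ∃! sigma, sigma ∈ S ∧ permComp sigma mu = permComp tau mu

/-- The nested expression
`∏_{i' = i+1}^{i+s} (∑_{sigma ∈ S i'} C_{i'}(lam[i'-1], sigma ∘ lam[i']) s_sigma ∘ x_{lam[i']} ∘) 1`,
by recursion on the number `s` of factors. -/
def jackNestedTail (α : ℝ) {n : ℕ} (lam : Fin n → ℕ) (S : ℕ → Finset (Equiv.Perm (Fin n))) :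
    ℕ → ℕ → MvPolynomial (Fin n) ℝ
  | _, 0 => 1
  | i, s + 1 =>
    ∑ sigma ∈ S (i + 1),
      jackCoeff α (largestPart lam) (i + 1) (trunc lam i) (permComp sigma (trunc lam (i + 1))) •
        rename sigma (xMon (trunc lam (i + 1)) * jackNestedTail α lam S (i + 1) s)

/-- The nested form of the sum formula:
`∑_{sigma ∈ S 0} s_sigma ∘ x_lam ∘
  ∏_{i=1}^{r-1} (∑_{sigma ∈ S i} C_i(lam[i-1], sigma ∘ lam[i]) s_sigma ∘ x_{lam[i]} ∘) 1`. -/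
def jackNestedSum (α : ℝ) {n : ℕ} (lam : Fin n → ℕ) (S : ℕ → Finset (Equiv.Perm (Fin n))) :
    MvPolynomial (Fin n) ℝ :=
  ∑ sigma ∈ S 0, rename sigma (xMon lam * jackNestedTail α lam S 0 (largestPart lam - 1))

/-- The multiple sum over `sigma[0] ∈ S 0, …, sigma[r-1] ∈ S (r-1)` of
`∏_{i=1}^{r-1} C_i(lam[i-1], sigma[i] ∘ lam[i])` times the product over `i = 0, …, r-1` of the
monomials `sigma[0] ∘ sigma[1] ∘ ⋯ ∘ sigma[i] ∘ x_{lam[i]}`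
(`Fin.partialProd sigma i.succ` is `sigma 0 * sigma 1 * ⋯ * sigma i`). -/
def jackMultiSum (α : ℝ) {n : ℕ} (lam : Fin n → ℕ) (S : ℕ → Finset (Equiv.Perm (Fin n))) :
    MvPolynomial (Fin n) ℝ :=
  ∑ sigma ∈ Fintype.piFinset fun i : Fin (largestPart lam - 1 + 1) => S i,
    (∏ i : Fin (largestPart lam - 1),
      jackCoeff α (largestPart lam) (i + 1) (trunc lam i)
        (permComp (sigma i.succ) (trunc lam (i + 1)))) •
    ∏ i : Fin (largestPart lam - 1 + 1),
      rename (Fin.partialProd sigma i.succ : Equiv.Perm (Fin n)) (xMon (trunc lam i))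

/-! ### Agreement with the definition through a full orthogonal family

A family `P` indexed by all partitions of `d` which is monic triangular for the dominance order and
satisfies `⟨P_lam, P_mu⟩ = 0` whenever `lam ≠ mu` consists of the functions `macdonaldSym`. -/

theorem domLT_wf {d : ℕ} : WellFounded (DomLT (d := d)) := by
  have : IsTrans d.Partition DomLT :=
    ⟨fun a b c h1 h2 => ⟨fun k => (h1.1 k).trans (h2.1 k),
      fun h => h1.2 fun k => (h2.1 k).trans (h k)⟩⟩
  have : Std.Irrefl (DomLT (d := d)) := ⟨fun a h => h.2 h.1⟩
  exact Finite.wellFounded_of_trans_of_irrefl _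

theorem scalarProduct_eq (q t : ℝ) (f g : SymFun) (s : Finset (ℕ+ →₀ ℕ)) (h : f.support ⊆ s) :
    scalarProduct q t f g = ∑ m ∈ s, coeff m f * coeff m g * powerSumNorm q t m := by
  refine Finset.sum_subset h fun m _ hm => ?_
  rw [notMem_support_iff.1 hm]
  simp

theorem scalarProduct_sub_left (q t : ℝ) (f f' g : SymFun) :
    scalarProduct q t (f - f') g = scalarProduct q t f g - scalarProduct q t f' g := by
  classical
  rw [scalarProduct_eq q t (f - f') g (f.support ∪ f'.support) (support_sub _ _ _),
    scalarProduct_eq q t f g _ Finset.subset_union_left,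
    scalarProduct_eq q t f' g _ Finset.subset_union_right, ← Finset.sum_sub_distrib]
  refine Finset.sum_congr rfl fun m _ => ?_
  rw [coeff_sub]
  ring

theorem eq_zero_of_scalarProduct_self {q t : ℝ}
    (hpos : ∀ k : ℕ+, 0 < (1 - q ^ (k : ℕ)) / (1 - t ^ (k : ℕ))) {f : SymFun}
    (h : scalarProduct q t f f = 0) : f = 0 := by
  have hn : ∀ m, 0 < powerSumNorm q t m := fun m => by
    refine Finset.prod_pos fun k _ => ?_
    have := hpos k
    have := k.pos
    positivity
  rw [scalarProduct, Finset.sum_eq_zero_iff_of_nonneg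
    (fun m _ => mul_nonneg (mul_self_nonneg _) (hn m).le)] at h
  by_contra hf
  obtain ⟨m, hm⟩ := Finset.nonempty_iff_ne_empty.2 (support_eq_empty.not.2 hf)
  have := h m hm
  have h2 := mem_support_iff.1 hm
  simp [h2, (hn m).ne'] at this

/-- A symmetric function is determined by its values in finitely many variables. -/
theorem eq_zero_of_toVars {f : SymFun} (h : ∀ n, toVars n f = 0) : f = 0 := by
  obtain ⟨D, hD⟩ : ∃ D : ℕ, ∀ k ∈ f.vars, (k : ℕ) ≤ D :=
    ⟨f.vars.sup fun k => (k : ℕ), fun k hk => Finset.le_sup (f := fun k : ℕ+ => (k : ℕ)) hk⟩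
  -- `p_k` becomes `∑ j, c_j * (j + 1) ^ k`
  let G : SymFun →ₐ[ℝ] MvPolynomial (Fin D) ℝ :=
    aeval fun k : ℕ+ => ∑ j : Fin D, X j * C (((j : ℕ) + 1 : ℝ) ^ (k : ℕ))
  have hG : G f = 0 := by
    refine funext_set (fun _ => Set.range fun c : ℕ => (c : ℝ))
      (fun _ => Set.infinite_range_of_injective Nat.cast_injective) fun x hx => ?_
    choose c hc using fun j => hx j (Set.mem_univ j)
    let e := Fintype.equivFin (Σ j : Fin D, Fin (c j))
    let y : Fin (Fintype.card (Σ j : Fin D, Fin (c j))) → ℝ := fun i => ((e.symm i).1 : ℕ) + 1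
    have h0 := congrArg (aeval (R := ℝ) y) (h (Fintype.card (Σ j : Fin D, Fin (c j))))
    have hcomp : ((aeval (R := ℝ) x).comp G) = (aeval (R := ℝ) y).comp (toVars _) := by
      ext k
      simp only [AlgHom.comp_apply, G, toVars, aeval_X, psum, map_sum, map_mul, map_pow,
        aeval_C, Algebra.algebraMap_self, RingHom.id_apply]
      rw [← e.sum_comp, Fintype.sum_sigma]
      refine Finset.sum_congr rfl fun j _ => ?_
      simp [y, ← hc j]
    have h1 := AlgHom.congr_fun hcomp f
    simp only [AlgHom.comp_apply] at h1
    rw [h0, map_zero] at h1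
    simpa [aeval_eq_eval] using h1
  refine MvPolynomial.funext fun v => ?_
  let V : Matrix (Fin D) (Fin D) ℝ := (Matrix.vandermonde fun j : Fin D => ((j : ℕ) + 1 : ℝ)).transpose
  have hV : IsUnit V.det := by
    rw [isUnit_iff_ne_zero, Matrix.det_transpose, Matrix.det_vandermonde_ne_zero_iff]
    intro a b hab
    exact Fin.ext (by exact_mod_cast add_right_cancel hab)
  obtain ⟨c, hc⟩ := (Matrix.mulVec_surjective_iff_isUnit.2 ((Matrix.isUnit_iff_isUnit_det _).2 hV))
    (fun i : Fin D => v ⟨i + 1, Nat.succ_pos _⟩)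
  have h1 := congrArg (eval fun j : Fin D => c j / ((j : ℕ) + 1 : ℝ)) hG
  rw [map_zero] at h1 ⊢
  rw [← h1]
  change eval v f = ((eval fun j : Fin D => c j / ((j : ℕ) + 1 : ℝ)).comp G.toRingHom) f
  refine hom_congr_vars (by ext; simp) (fun k hk _ => ?_) rfl
  obtain ⟨i, hi⟩ : ∃ i, (k : ℕ) = i + 1 := ⟨k - 1, by have := k.pos; omega⟩
  have hiD : i < D := by have := hD k hk; omega
  have h2 := congrFun hc ⟨i, hiD⟩
  have hk' : (⟨i + 1, Nat.succ_pos _⟩ : ℕ+) = k := PNat.eq hi.symm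
  simp only [hk'] at h2
  simp only [eval_X, RingHom.comp_apply, AlgHom.toRingHom_eq_coe, RingHom.coe_coe, G, aeval_X,
    map_sum, map_mul, eval_C]
  rw [← h2, Matrix.mulVec, dotProduct]
  refine Finset.sum_congr rfl fun j _ => ?_
  have : ((j : ℕ) + 1 : ℝ) ≠ 0 := by positivity
  simp only [V, Matrix.transpose_apply, Matrix.vandermonde_apply, hi]
  field_simp
  ring

theorem isMacdonald_unique {q t : ℝ}
    (hpos : ∀ k : ℕ+, 0 < (1 - q ^ (k : ℕ)) / (1 - t ^ (k : ℕ))) {d : ℕ} {lam : d.Partition}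
    {P P' : SymFun} (h : IsMacdonald q t lam P) (h' : IsMacdonald q t lam P') : P = P' := by
  have hlow : IsLower lam (P - P') := by
    obtain ⟨c, hc⟩ := h.1
    obtain ⟨c', hc'⟩ := h'.1
    refine ⟨fun mu => c mu - c' mu, fun n => ?_⟩
    classical
    rw [map_sub, hc, hc']
    simp only [finsum_eq_sum_of_fintype, finsum_eq_if, add_sub_add_left_eq_sub,
      ← Finset.sum_sub_distrib]
    refine Finset.sum_congr rfl fun mu _ => ?_
    split_ifs
    · rw [sub_smul]
    · simp
  have := eq_zero_of_scalarProduct_self hpos (f := P - P') (by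
    rw [scalarProduct_sub_left, h.2 _ hlow, h'.2 _ hlow, sub_zero])
  exact sub_eq_zero.1 this

theorem macdonaldSym_eq_of_orthogonal_family {q t : ℝ}
    (hpos : ∀ k : ℕ+, 0 < (1 - q ^ (k : ℕ)) / (1 - t ^ (k : ℕ))) {d : ℕ}
    (P : d.Partition → SymFun) (htri : ∀ lam, IsMonicTriangular lam (P lam))
    (horth : ∀ lam mu, lam ≠ mu → scalarProduct q t (P lam) (P mu) = 0) (lam : d.Partition) :
    macdonaldSym q t lam = P lam := by
  classical
  have hmon : ∀ nu : d.Partition, ∃ M : SymFun, (∀ n, toVars n M = msymm (Fin n) ℝ nu) ∧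
      ∀ lam, DomLE nu lam → ¬ DomLE lam nu → scalarProduct q t (P lam) M = 0 := by
    intro nu
    induction nu using domLT_wf.induction with
    | _ nu ih =>
      obtain ⟨c, hc⟩ := htri nu
      choose! M hM hM' using ih
      refine ⟨P nu - ∑ mu with DomLT mu nu, c mu • M mu, fun n => ?_, fun lam h1 h2 => ?_⟩
      · rw [map_sub, hc, map_sum, sub_eq_iff_eq_add]
        congr 1
        simp only [finsum_eq_sum_of_fintype, finsum_eq_if, Finset.sum_filter]
        refine Finset.sum_congr rfl fun mu _ => ?_
        split_ifs with hmu
        · rw [map_smul, hM mu hmu]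
        · rfl
      · have hz : ∀ mu, DomLT mu nu → scalarProduct q t (P lam) (M mu) = 0 := fun mu hmu =>
          hM' mu hmu lam (fun k => (hmu.1 k).trans (h1 k)) fun h => hmu.2 fun k =>
            (h1 k).trans (h k)
        have h0 : scalarProduct q t (P lam) (P nu) = 0 :=
          horth _ _ fun h => h2 (h ▸ fun _ => le_rfl)
        have hlin : scalarProduct q t (P lam) (P nu - ∑ mu with DomLT mu nu, c mu • M mu) =
            scalarProduct q t (P lam) (P nu) -
              ∑ mu with DomLT mu nu, c mu * scalarProduct q t (P lam) (M mu) := by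
          simp only [scalarProduct, coeff_sub, coeff_sum, coeff_smul, smul_eq_mul, mul_sub, sub_mul,
            Finset.sum_sub_distrib, Finset.mul_sum, Finset.sum_mul]
          rw [Finset.sum_comm]
          congr 1
          refine Finset.sum_congr rfl fun _ _ => Finset.sum_congr rfl fun _ _ => by ring
        rw [hlin, h0, Finset.sum_eq_zero, sub_zero]
        intro mu hmu
        rw [hz mu (Finset.mem_filter.1 hmu).2, mul_zero]
  choose M hM hM' using hmon
  have hP : IsMacdonald q t lam (P lam) := by
    refine ⟨htri lam, fun Q ⟨c, hc⟩ => ?_⟩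
    have hQ : Q = ∑ mu with DomLT mu lam, c mu • M mu := by
      rw [← sub_eq_zero]
      refine eq_zero_of_toVars fun n => ?_
      rw [map_sub, hc, map_sum, sub_eq_zero]
      simp only [finsum_eq_sum_of_fintype, finsum_eq_if, Finset.sum_filter, map_smul, hM]
    have hlin : scalarProduct q t (P lam) Q =
        ∑ mu with DomLT mu lam, c mu * scalarProduct q t (P lam) (M mu) := by
      rw [hQ]
      simp only [scalarProduct, coeff_sum, coeff_smul, smul_eq_mul, Finset.mul_sum, Finset.sum_mul]
      rw [Finset.sum_comm]
      refine Finset.sum_congr rfl fun _ _ => Finset.sum_congr rfl fun _ _ => by ring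
    rw [hlin]
    refine Finset.sum_eq_zero fun mu hmu => ?_
    have := (Finset.mem_filter.1 hmu).2
    rw [hM' mu lam this.1 this.2, mul_zero]
  have hex : ∃! R, IsMacdonald q t lam R :=
    ⟨P lam, hP, fun R hR => isMacdonald_unique hpos hR hP⟩
  rw [macdonaldSym, dif_pos hex]
  exact isMacdonald_unique hpos hex.choose_spec.1 hP

end JackSum

end

noncomputable section

open MvPolynomial Filter Topology
open scoped Finset

namespace JackSum

/-!
For a composition `mu ≠ 0` let `f_mu = x_mu ∑_nu w(mu, nu) f_nu`, where `nu` runs over the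
rearrangements of `mu - 1` (truncated at `0`), `w` are the coefficients of the sum formula and
`f_0 = 1`; the nested sum is then the sum of `f_nu` over the rearrangements `nu` of `lam`. Exchange
identities for `w` show by induction that the `f_mu` solve a Knizhnik-Zamolodchikov system:
`α x_i ∂_i f_mu` is an explicit combination of `f_mu` and the `f_{s_ij mu}` minus
`∑_{j ≠ i} x_i / (x_i - x_j) (f_mu - f_{s_ij mu})`. Summed over an orbit this system closes up, and
the nested sum is an eigenfunction of the Laplace-Beltrami operator.

In the power sums this operator is self-adjoint for the Jack scalar product, the `t → 1` limit of
Macdonald's. Its eigenvalues strictly increase along the dominance order, and the nested sum is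
`m_lam` plus lower terms, so it is orthogonal to all lower monomial symmetric functions. By Cramer's
rule the Gram-Schmidt coefficients depend continuously on the scalar product, so that those of the
Macdonald polynomials converge to those of the nested sum.
-/

variable {n : ℕ}

/-! ### Rearrangements of a composition -/

section Rearrangements

variable {mu nu : Fin n → ℕ}

theorem permComp_one (mu : Fin n → ℕ) : permComp 1 mu = mu := rfl

theorem permComp_mul (s t : Equiv.Perm (Fin n)) (mu : Fin n → ℕ) :
    permComp (s * t) mu = permComp s (permComp t mu) := by
  funext k
  simp only [permComp, mul_inv_rev, Equiv.Perm.mul_apply]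

theorem permComp_swap_apply (i j k : Fin n) (mu : Fin n → ℕ) :
    permComp (Equiv.swap i j) mu k = mu (Equiv.swap i j k) := by
  rw [permComp, Equiv.swap_inv]

theorem permComp_swap_swap (i j : Fin n) (mu : Fin n → ℕ) :
    permComp (Equiv.swap i j) (permComp (Equiv.swap i j) mu) = mu := by
  rw [← permComp_mul, Equiv.swap_mul_self, permComp_one]

theorem permComp_swap_of_eq {i j : Fin n} (h : mu i = mu j) :
    permComp (Equiv.swap i j) mu = mu := by
  funext k
  rw [permComp_swap_apply, Equiv.swap_apply_def]
  split_ifs with hi hj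
  · rw [hi, h]
  · rw [hj, h]
  · rfl

@[to_additive]
theorem prod_permComp_swap_mul {M : Type*} [CommMonoid M] {i j : Fin n} (hij : i ≠ j)
    (mu : Fin n → ℕ) (g : Fin n → ℕ → M) :
    (∏ k, g k (permComp (Equiv.swap i j) mu k)) * (g i (mu i) * g j (mu j)) =
      (∏ k, g k (mu k)) * (g i (mu j) * g j (mu i)) := by
  have split (f : Fin n → M) :
      ∏ k, f k = (f i * f j) * ∏ k ∈ (Finset.univ.erase i).erase j, f k := by
    rw [mul_assoc, Finset.mul_prod_erase _ _ (Finset.mem_erase.2 ⟨hij.symm, Finset.mem_univ j⟩),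
      Finset.mul_prod_erase _ _ (Finset.mem_univ i)]
  have away : ∀ k ∈ (Finset.univ.erase i).erase j,
      g k (permComp (Equiv.swap i j) mu k) = g k (mu k) := by
    intro k hk
    simp only [Finset.mem_erase] at hk
    rw [permComp_swap_apply, Equiv.swap_apply_of_ne_of_ne hk.2.1 hk.1]
  rw [split, split fun k => g k (mu k), Finset.prod_congr rfl away, permComp_swap_apply,
    permComp_swap_apply, Equiv.swap_apply_left, Equiv.swap_apply_right, mul_right_comm,
    mul_comm (g i (mu j) * _), mul_right_comm, mul_comm (g i (mu i) * _)]

/-- The finite set of all rearrangements of a composition. -/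
def orbit (mu : Fin n → ℕ) : Finset (Fin n → ℕ) :=
  Finset.univ.image fun sigma : Equiv.Perm (Fin n) => permComp sigma mu

theorem mem_orbit : nu ∈ orbit mu ↔ ∃ s, permComp s mu = nu := by
  simp only [orbit, Finset.mem_image, Finset.mem_univ, true_and]

theorem self_mem_orbit (mu : Fin n → ℕ) : mu ∈ orbit mu := mem_orbit.2 ⟨1, permComp_one mu⟩

theorem orbit_permComp (s : Equiv.Perm (Fin n)) (mu : Fin n → ℕ) :
    orbit (permComp s mu) = orbit mu := by
  ext nu
  simp only [mem_orbit, ← permComp_mul]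
  exact (Equiv.mulRight s).exists_congr_left.trans (by simp)

theorem orbit_eq_of_mem (h : nu ∈ orbit mu) : orbit nu = orbit mu := by
  obtain ⟨s, rfl⟩ := mem_orbit.1 h
  exact orbit_permComp s mu

theorem permComp_mem_orbit (s : Equiv.Perm (Fin n)) (h : nu ∈ orbit mu) :
    permComp s nu ∈ orbit mu := by
  rw [← orbit_eq_of_mem h, ← orbit_permComp s nu]
  exact self_mem_orbit _

theorem orbit_zero : orbit (0 : Fin n → ℕ) = {0} :=
  Finset.eq_singleton_iff_unique_mem.2 ⟨self_mem_orbit 0, fun _ h => by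
    obtain ⟨_, rfl⟩ := mem_orbit.1 h
    rfl⟩

theorem sum_orbit_permComp {M : Type*} [AddCommMonoid M] (mu : Fin n → ℕ)
    (s : Equiv.Perm (Fin n)) (g : (Fin n → ℕ) → M) :
    ∑ nu ∈ orbit mu, g (permComp s nu) = ∑ nu ∈ orbit mu, g nu := by
  refine Finset.sum_bij' (fun nu _ => permComp s nu) (fun nu _ => permComp s⁻¹ nu)
    (fun nu h => permComp_mem_orbit s h) (fun nu h => permComp_mem_orbit s⁻¹ h) ?_ ?_
    fun _ _ => rfl
  · intro nu _
    rw [← permComp_mul, inv_mul_cancel, permComp_one]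
  · intro nu _
    rw [← permComp_mul, mul_inv_cancel, permComp_one]

theorem sum_orbit_sum_permComp_swap {M : Type*} [AddCommMonoid M] (mu : Fin n → ℕ) (i : Fin n)
    (g : Fin n → (Fin n → ℕ) → M) :
    ∑ nu ∈ orbit mu, ∑ j, g j (permComp (Equiv.swap i j) nu) = ∑ nu ∈ orbit mu, ∑ j, g j nu := by
  rw [Finset.sum_comm, Finset.sum_comm (s := orbit mu)]
  exact Finset.sum_congr rfl fun j _ => sum_orbit_permComp mu (Equiv.swap i j) (g j)

theorem sum_comp_of_mem_orbit {M : Type*} [AddCommMonoid M] (h : nu ∈ orbit mu) (g : ℕ → M) :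
    ∑ k, g (nu k) = ∑ k, g (mu k) := by
  obtain ⟨s, rfl⟩ := mem_orbit.1 h
  exact Equiv.sum_comp s⁻¹ fun k => g (mu k)

theorem card_filter_comp_of_mem_orbit (h : nu ∈ orbit mu) (p : ℕ → Prop) [DecidablePred p] :
    #{k | p (nu k)} = #{k | p (mu k)} := by
  simp only [Finset.card_filter]
  exact sum_comp_of_mem_orbit h fun v => if p v then 1 else 0

theorem card_filter_comp_perm {ι : Type*} [Fintype ι] (s : Equiv.Perm ι) (p : ι → Prop)
    [DecidablePred p] : #{k | p (s k)} = #{k | p k} := by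
  simp only [Finset.card_filter]
  exact Equiv.sum_comp s fun k => if p k then 1 else 0

theorem le_largestPart (mu : Fin n → ℕ) (k : Fin n) : mu k ≤ largestPart mu :=
  Finset.le_sup (f := mu) (Finset.mem_univ k)

theorem largestPart_le {R : ℕ} (h : ∀ k, mu k ≤ R) : largestPart mu ≤ R :=
  Finset.sup_le fun k _ => h k

theorem le_of_mem_orbit {R : ℕ} (h : nu ∈ orbit mu) (hR : ∀ k, mu k ≤ R) (k : Fin n) :
    nu k ≤ R := by
  obtain ⟨s, rfl⟩ := mem_orbit.1 h
  exact hR _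

theorem largestPart_of_mem_orbit (h : nu ∈ orbit mu) : largestPart nu = largestPart mu :=
  le_antisymm (largestPart_le (le_of_mem_orbit h (le_largestPart mu)))
    (largestPart_le (le_of_mem_orbit (orbit_eq_of_mem h ▸ self_mem_orbit mu) (le_largestPart nu)))

end Rearrangements

/-! ### Step weights -/

section StepWeight

variable {α : ℝ} {mu nu nu' : Fin n → ℕ} {i j : Fin n}

/-- The number of parts of size `a` of `mu` which drop by more than one on passing to `nu`. -/
def dropCount (mu nu : Fin n → ℕ) (a : ℕ) : ℕ := #{k | mu k = a ∧ nu k + 1 < a}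

/-- The number of nonzero parts of `mu` smaller than `a`. -/
def numPartsBelow (mu : Fin n → ℕ) (a : ℕ) : ℕ := #{k | 0 < mu k ∧ mu k < a}

/-- Every nonzero part of `mu` gets strictly smaller on passing to `nu`; this is the condition for
the coefficient of the step from `mu` to `nu` to be nonzero. -/
def Admissible (mu nu : Fin n → ℕ) : Prop := ∀ k, mu k = 0 ∨ nu k < mu k

instance (mu nu : Fin n → ℕ) : Decidable (Admissible mu nu) :=
  inferInstanceAs (Decidable (∀ k, mu k = 0 ∨ nu k < mu k))

/-- The coefficient with which a rearrangement `nu` of `mu - 1` enters the recursion for `mu`. It is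
the coefficient `C_i(lam[i-1], nu[i])` of the sum formula, expressed through the compositions
obtained by lowering all parts by `i - 1` instead of the truncations. -/
def stepWeight (α : ℝ) (mu nu : Fin n → ℕ) : ℝ :=
  if Admissible mu nu then
    ∏ a ∈ Finset.Icc 2 (largestPart mu), ∏ k ∈ Finset.Icc 1 (dropCount mu nu a),
      (k : ℝ) / ((a - 1) * α + numPartsBelow mu a + k)
  else 0

/-- The relative change of `stepWeight α mu nu` when `dropCount mu nu a` is lowered by one. -/
def stepGain (α : ℝ) (mu nu : Fin n → ℕ) (a : ℕ) : ℝ :=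
  ((a - 1) * α + numPartsBelow mu a) / dropCount mu nu a

theorem dropCount_permComp (s : Equiv.Perm (Fin n)) (mu nu : Fin n → ℕ) (a : ℕ) :
    dropCount (permComp s mu) (permComp s nu) a = dropCount mu nu a :=
  card_filter_comp_perm s⁻¹ fun k => mu k = a ∧ nu k + 1 < a

theorem numPartsBelow_of_mem_orbit (h : nu ∈ orbit mu) (a : ℕ) :
    numPartsBelow nu a = numPartsBelow mu a :=
  card_filter_comp_of_mem_orbit h fun v => 0 < v ∧ v < a

theorem admissible_permComp (s : Equiv.Perm (Fin n)) :
    Admissible (permComp s mu) (permComp s nu) ↔ Admissible mu nu :=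
  Equiv.forall_congr_left s⁻¹ |>.trans (by simp [Admissible, permComp])

theorem stepWeight_permComp (α : ℝ) (s : Equiv.Perm (Fin n)) (mu nu : Fin n → ℕ) :
    stepWeight α (permComp s mu) (permComp s nu) = stepWeight α mu nu := by
  have hs : permComp s mu ∈ orbit mu := permComp_mem_orbit s (self_mem_orbit mu)
  simp only [stepWeight, admissible_permComp, dropCount_permComp, numPartsBelow_of_mem_orbit hs,
    largestPart_of_mem_orbit hs]

theorem stepWeight_of_not_admissible (h : ¬ Admissible mu nu) : stepWeight α mu nu = 0 :=
  if_neg h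

theorem stepWeight_congr (h : Admissible mu nu) (h' : Admissible mu nu')
    (hdrop : ∀ a, dropCount mu nu a = dropCount mu nu' a) :
    stepWeight α mu nu = stepWeight α mu nu' := by
  simp only [stepWeight, if_pos h, if_pos h', hdrop]

theorem prod_Icc_div_add_eq_mul {x : ℝ} (hx : 0 ≤ x) (u : ℕ) :
    ∏ k ∈ Finset.Icc 1 u, (k : ℝ) / (x + k) =
      (∏ k ∈ Finset.Icc 1 (u + 1), (k : ℝ) / (x + k)) * (1 + x / (u + 1 : ℕ)) := by
  rw [Finset.prod_Icc_succ_top u.succ_pos]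
  field_simp
  ring

theorem stepWeight_eq_mul_of_dropCount (hα : 0 ≤ α) (h : Admissible mu nu)
    (h' : Admissible mu nu') (hj : 2 ≤ mu j)
    (hdrop : ∀ a, dropCount mu nu a = dropCount mu nu' a + if mu j = a then 1 else 0) :
    stepWeight α mu nu' = stepWeight α mu nu * (1 + stepGain α mu nu (mu j)) := by
  have hmem : mu j ∈ Finset.Icc 2 (largestPart mu) := Finset.mem_Icc.2 ⟨hj, le_largestPart mu j⟩
  have hj1 : (1 : ℝ) ≤ mu j := by exact_mod_cast one_le_two.trans hj
  have hx : 0 ≤ ((mu j : ℝ) - 1) * α + numPartsBelow mu (mu j) :=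
    add_nonneg (mul_nonneg (sub_nonneg.2 hj1) hα) (Nat.cast_nonneg _)
  have hother : ∀ a ∈ (Finset.Icc 2 (largestPart mu)).erase (mu j),
      dropCount mu nu a = dropCount mu nu' a := fun a ha => by
    rw [hdrop a, if_neg (Finset.ne_of_mem_erase ha).symm, add_zero]
  rw [stepWeight, stepWeight, if_pos h, if_pos h', ← Finset.mul_prod_erase _ _ hmem,
    ← Finset.mul_prod_erase _ _ hmem, prod_Icc_div_add_eq_mul hx, stepGain, hdrop (mu j),
    if_pos rfl, mul_right_comm]
  congr 2
  exact Finset.prod_congr rfl fun a ha => by rw [hother a ha]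

theorem dropCount_swap (hij : i ≠ j) (mu nu : Fin n → ℕ) (a : ℕ) :
    dropCount mu (permComp (Equiv.swap i j) nu) a +
        ((if mu i = a ∧ nu i + 1 < a then 1 else 0) +
          (if mu j = a ∧ nu j + 1 < a then 1 else 0)) =
      dropCount mu nu a +
        ((if mu i = a ∧ nu j + 1 < a then 1 else 0) +
          (if mu j = a ∧ nu i + 1 < a then 1 else 0)) := by
  simp only [dropCount, Finset.card_filter]
  exact sum_permComp_swap_add hij nu fun k v => if mu k = a ∧ v + 1 < a then 1 else 0

theorem admissible_swap_iff (hij : i ≠ j) :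
    Admissible mu (permComp (Equiv.swap i j) nu) ↔
      (mu i = 0 ∨ nu j < mu i) ∧ (mu j = 0 ∨ nu i < mu j) ∧
        ∀ k, k ≠ i → k ≠ j → mu k = 0 ∨ nu k < mu k := by
  constructor
  · intro h
    have hi := h i
    have hj := h j
    rw [permComp_swap_apply, Equiv.swap_apply_left] at hi
    rw [permComp_swap_apply, Equiv.swap_apply_right] at hj
    refine ⟨hi, hj, fun k hki hkj => ?_⟩
    simpa only [permComp_swap_apply, Equiv.swap_apply_of_ne_of_ne hki hkj] using h k
  · rintro ⟨hi, hj, hk⟩ k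
    rcases eq_or_ne k i with rfl | hki
    · rwa [permComp_swap_apply, Equiv.swap_apply_left]
    rcases eq_or_ne k j with rfl | hkj
    · rwa [permComp_swap_apply, Equiv.swap_apply_right]
    rw [permComp_swap_apply, Equiv.swap_apply_of_ne_of_ne hki hkj]
    exact hk k hki hkj

theorem Admissible.swap (h : Admissible mu nu) (hij : i ≠ j) (hi : mu i = 0 ∨ nu j < mu i)
    (hj : mu j = 0 ∨ nu i < mu j) : Admissible mu (permComp (Equiv.swap i j) nu) :=
  (admissible_swap_iff hij).2 ⟨hi, hj, fun k _ _ => h k⟩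

end StepWeight

/-! ### Exchange identities for step weights -/

section Exchange

variable {α : ℝ} {mu nu : Fin n → ℕ} {i j : Fin n}

theorem card_lt_of_mem_orbit_sub_one (h : nu ∈ orbit (mu - 1)) {c : ℕ} (hc : 0 < c) :
    #{k | nu k < c} = #{k | mu k < c} + #{k | mu k = c} := by
  simp only [card_filter_comp_of_mem_orbit h (· < c), Finset.card_filter,
    ← Finset.sum_add_distrib, Pi.sub_apply, Pi.one_apply]
  exact Finset.sum_congr rfl fun k _ => by split_ifs <;> omega

theorem card_add_one_eq_of_mem_orbit_sub_one (h : nu ∈ orbit (mu - 1)) {a : ℕ} (ha : 2 ≤ a) :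
    #{k | nu k + 1 = a} = #{k | mu k = a} := by
  simp only [card_filter_comp_of_mem_orbit h (· + 1 = a), Pi.sub_apply, Pi.one_apply]
  exact congrArg Finset.card (Finset.filter_congr fun k _ => by omega)

theorem Admissible.dropCount_eq_card (hadm : Admissible mu nu) (h : nu ∈ orbit (mu - 1)) {a : ℕ}
    (ha : 2 ≤ a) : dropCount mu nu a = #{k | nu k + 1 = a ∧ mu k ≠ a} := by
  have hcard := card_add_one_eq_of_mem_orbit_sub_one h ha
  have hsplit : dropCount mu nu a + #{k | nu k + 1 = a} =
      #{k | nu k + 1 = a ∧ mu k ≠ a} + #{k | mu k = a} := by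
    simp only [dropCount, Finset.card_filter, ← Finset.sum_add_distrib]
    refine Finset.sum_congr rfl fun k _ => ?_
    have := hadm k
    split_ifs <;> omega
  omega

theorem Admissible.stepWeight_swap_of_lt (hadm : Admissible mu nu) (hα : 0 ≤ α)
    (hi : mu i = 0 ∨ nu i + 1 < mu i) (hj : nu j < nu i) :
    stepWeight α mu (permComp (Equiv.swap i j) nu) = stepWeight α mu nu *
      (1 + (if mu j = nu i + 1 then stepGain α mu nu (nu i + 1) else 0) -
        (if 0 < mu j ∧ mu j < nu i + 1 then 1 else 0)) := by
  have hij : i ≠ j := by rintro rfl; omega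
  have hdrop := dropCount_swap hij mu nu
  by_cases hblocked : 0 < mu j ∧ mu j < nu i + 1
  · rw [if_pos hblocked, if_neg (by omega), add_zero, sub_self, mul_zero]
    exact stepWeight_of_not_admissible fun h => by
      have := ((admissible_swap_iff hij).1 h).2.1
      omega
  have hswap := hadm.swap hij (by omega) (by omega)
  rw [if_neg hblocked, sub_zero]
  by_cases hfix : mu j = nu i + 1
  · rw [if_pos hfix, ← hfix]
    refine stepWeight_eq_mul_of_dropCount hα hadm hswap (by omega) fun a => ?_
    have := hdrop a
    split_ifs at this ⊢ <;> omega
  · rw [if_neg hfix, add_zero, mul_one]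
    refine stepWeight_congr hswap hadm fun a => ?_
    have := hdrop a
    split_ifs at this <;> omega

theorem Admissible.stepWeight_swap_of_gt (hadm : Admissible mu nu) (hα : 0 ≤ α)
    (hi : nu i + 1 < mu i) (hj : mu i < mu j ∨ mu j = 0) :
    stepWeight α mu (permComp (Equiv.swap i j) nu) = stepWeight α mu nu *
      (1 + (if nu j + 1 = mu i then stepGain α mu nu (mu i) else 0) -
        (if mu i < nu j + 1 then 1 else 0)) := by
  have hij : i ≠ j := by rintro rfl; omega
  have hdrop := dropCount_swap hij mu nu
  by_cases hblocked : mu i < nu j + 1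
  · rw [if_pos hblocked, if_neg (by omega), add_zero, sub_self, mul_zero]
    exact stepWeight_of_not_admissible fun h => by
      have := ((admissible_swap_iff hij).1 h).1
      omega
  have hswap := hadm.swap hij (by omega) (by omega)
  rw [if_neg hblocked, sub_zero]
  by_cases hfix : nu j + 1 = mu i
  · rw [if_pos hfix]
    refine stepWeight_eq_mul_of_dropCount hα hadm hswap (by omega) fun a => ?_
    have := hdrop a
    split_ifs at this ⊢ <;> omega
  · rw [if_neg hfix, add_zero, mul_one]
    refine stepWeight_congr hswap hadm fun a => ?_
    have := hdrop a
    split_ifs at this <;> omega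

theorem Admissible.stepWeight_swap_sub_of_eq (hadm : Admissible mu nu) (hi : nu i + 1 = mu i) :
    (if nu j < nu i then stepWeight α mu (permComp (Equiv.swap i j) nu) else 0) -
        (if mu i < mu j ∨ mu j = 0 then stepWeight α mu (permComp (Equiv.swap i j) nu) else 0) =
      ((if mu j = mu i ∧ nu j + 1 < mu i then 1 else 0) -
        (if nu j + 1 = mu i ∧ mu j ≠ mu i then 1 else 0)) * stepWeight α mu nu := by
  rcases eq_or_ne i j with rfl | hij
  · simp [show mu i ≠ 0 by omega, show ¬ nu i + 1 < mu i by omega]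
  have hj := hadm j
  have hdrop := dropCount_swap hij mu nu
  by_cases hswap : Admissible mu (permComp (Equiv.swap i j) nu)
  · obtain ⟨hi', hj', -⟩ := (admissible_swap_iff hij).1 hswap
    have hweight : (mu j = mu i ∨ nu j + 1 = mu i) →
        stepWeight α mu (permComp (Equiv.swap i j) nu) = stepWeight α mu nu := fun hor => by
      refine stepWeight_congr hswap hadm fun a => ?_
      have := hdrop a
      split_ifs at this <;> omega
    by_cases hor : mu j = mu i ∨ nu j + 1 = mu i
    · rw [hweight hor]
      split_ifs <;> first | omega | simp
    · split_ifs <;> first | omega | simp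
  · have hblocked : ¬ ((mu i = 0 ∨ nu j < mu i) ∧ (mu j = 0 ∨ nu i < mu j)) := fun h =>
      hswap (hadm.swap hij h.1 h.2)
    rw [stepWeight_of_not_admissible hswap, ite_self, ite_self, sub_zero]
    split_ifs <;> first | omega | simp

theorem sum_one_add_sub_ite {ι : Type*} (s : Finset ι) (p q : ι → Prop) [DecidablePred p]
    [DecidablePred q] (x : ℝ) :
    ∑ j ∈ s, (1 + (if p j then x else 0) - (if q j then 1 else 0)) =
      #s + #{j ∈ s | p j} * x - #{j ∈ s | q j} := by
  simp only [Finset.sum_sub_distrib, Finset.sum_add_distrib, ← Finset.sum_filter,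
    Finset.sum_const, nsmul_eq_mul, mul_one]

theorem dropCount_mul_stepGain {a : ℕ} (h : dropCount mu nu a ≠ 0) :
    dropCount mu nu a * stepGain α mu nu a = (a - 1) * α + numPartsBelow mu a :=
  mul_div_cancel₀ _ (Nat.cast_ne_zero.2 h)

theorem Admissible.sum_stepWeight_swap_lt (hadm : Admissible mu nu) (hα : 0 ≤ α)
    (h : nu ∈ orbit (mu - 1)) (hi : mu i = 0 ∨ nu i + 1 < mu i) :
    ∑ j with nu j < nu i, stepWeight α mu (permComp (Equiv.swap i j) nu) =
      (#{j | nu j < nu i} + nu i * α) * stepWeight α mu nu := by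
  rcases Nat.eq_zero_or_pos (nu i) with hzero | hpos
  · simp [hzero]
  rw [Finset.sum_congr rfl fun j hj =>
      hadm.stepWeight_swap_of_lt hα hi (Finset.mem_filter.1 hj).2,
    ← Finset.mul_sum, sum_one_add_sub_ite, Finset.filter_filter, Finset.filter_filter]
  have hrestored : #{j | nu j < nu i ∧ mu j = nu i + 1} = dropCount mu nu (nu i + 1) :=
    congrArg Finset.card (Finset.filter_congr fun k _ => by omega)
  have hblocked : #{j | nu j < nu i ∧ 0 < mu j ∧ mu j < nu i + 1} =
      numPartsBelow mu (nu i + 1) :=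
    congrArg Finset.card (Finset.filter_congr fun k _ => by have := hadm k; omega)
  have hne : dropCount mu nu (nu i + 1) ≠ 0 := by
    rw [hadm.dropCount_eq_card h (by omega)]
    exact (Finset.card_pos.2 ⟨i, by
      simp only [Finset.mem_filter, Finset.mem_univ, true_and]
      omega⟩).ne'
  rw [hrestored, hblocked, dropCount_mul_stepGain hne]
  push_cast
  ring

theorem Admissible.card_add_numPartsBelow (hadm : Admissible mu nu) (h : nu ∈ orbit (mu - 1))
    {c : ℕ} (hc : 0 < c) :
    #{k | c < mu k ∨ mu k = 0} + numPartsBelow mu c =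
      #{k | mu k < c} + #{k | (c < mu k ∨ mu k = 0) ∧ c < nu k + 1} := by
  have hcard := card_lt_of_mem_orbit_sub_one h hc
  have hsplit : #{k | nu k < c} + #{k | (c < mu k ∨ mu k = 0) ∧ c < nu k + 1} =
      #{k | c < mu k ∨ mu k = 0} + numPartsBelow mu c + #{k | mu k = c} := by
    simp only [numPartsBelow, Finset.card_filter, ← Finset.sum_add_distrib]
    refine Finset.sum_congr rfl fun k _ => ?_
    have := hadm k
    split_ifs <;> omega
  omega

theorem Admissible.sum_stepWeight_swap_gt (hadm : Admissible mu nu) (hα : 0 ≤ α)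
    (h : nu ∈ orbit (mu - 1)) (hi : nu i + 1 < mu i) :
    ∑ j with mu i < mu j ∨ mu j = 0, stepWeight α mu (permComp (Equiv.swap i j) nu) =
      (#{j | mu j < mu i} + (mu i - 1) * α) * stepWeight α mu nu := by
  rw [Finset.sum_congr rfl fun j hj =>
      hadm.stepWeight_swap_of_gt hα hi (Finset.mem_filter.1 hj).2,
    ← Finset.mul_sum, sum_one_add_sub_ite, Finset.filter_filter, Finset.filter_filter]
  have hrestored : #{j | (mu i < mu j ∨ mu j = 0) ∧ nu j + 1 = mu i} =
      dropCount mu nu (mu i) := by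
    rw [hadm.dropCount_eq_card h (by omega)]
    exact congrArg Finset.card (Finset.filter_congr fun k _ => by have := hadm k; omega)
  have hne : dropCount mu nu (mu i) ≠ 0 := (Finset.card_pos.2 ⟨i, by simpa using hi⟩).ne'
  have hcount : (#{j | mu i < mu j ∨ mu j = 0} : ℝ) + numPartsBelow mu (mu i) =
      #{j | mu j < mu i} + #{j | (mu i < mu j ∨ mu j = 0) ∧ mu i < nu j + 1} := by
    exact_mod_cast hadm.card_add_numPartsBelow h (by omega)
  rw [hrestored, dropCount_mul_stepGain hne]
  linear_combination stepWeight α mu nu * hcount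

theorem Admissible.card_add_dropCount (hadm : Admissible mu nu) (h : nu ∈ orbit (mu - 1))
    {a : ℕ} (ha : 0 < a) :
    dropCount mu nu a + #{j | mu j < a} =
      #{j | nu j + 1 < a} + #{j | nu j + 1 = a ∧ mu j ≠ a} := by
  have hcard := card_lt_of_mem_orbit_sub_one h ha
  have hsplit : #{j | nu j < a} + dropCount mu nu a =
      #{j | nu j + 1 < a} + #{j | nu j + 1 = a ∧ mu j ≠ a} + #{k | mu k = a} := by
    simp only [dropCount, Finset.card_filter, ← Finset.sum_add_distrib]
    refine Finset.sum_congr rfl fun k _ => ?_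
    have := hadm k
    split_ifs <;> omega
  omega

theorem sum_stepWeight_swap_of_eq_zero (hα : 0 ≤ α) (h : nu ∈ orbit (mu - 1)) (hi : mu i = 0) :
    ∑ j with nu j < nu i, stepWeight α mu (permComp (Equiv.swap i j) nu) =
      (nu i * α + #{j | nu j < nu i}) * stepWeight α mu nu := by
  by_cases hadm : Admissible mu nu
  · rw [hadm.sum_stepWeight_swap_lt hα h (Or.inl hi), add_comm]
  rw [stepWeight_of_not_admissible hadm, mul_zero]
  refine Finset.sum_eq_zero fun j hj => stepWeight_of_not_admissible fun hswap => hadm fun k => ?_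
  have hlt : nu j < nu i := (Finset.mem_filter.1 hj).2
  obtain ⟨-, hj', hother⟩ := (admissible_swap_iff (by rintro rfl; omega)).1 hswap
  rcases eq_or_ne k i with rfl | hki
  · exact Or.inl hi
  rcases eq_or_ne k j with rfl | hkj
  · omega
  · exact hother k hki hkj

theorem sum_stepWeight_swap_of_not_admissible (hadm : ¬ Admissible mu nu) (hi : 0 < mu i) :
    ∑ j with nu j < nu i, stepWeight α mu (permComp (Equiv.swap i j) nu) =
      ∑ j with mu i < mu j ∨ mu j = 0, stepWeight α mu (permComp (Equiv.swap i j) nu) := by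
  rw [Finset.sum_filter, Finset.sum_filter]
  refine Finset.sum_congr rfl fun j _ => ?_
  by_cases hswap : Admissible mu (permComp (Equiv.swap i j) nu)
  · have hij : i ≠ j := by
      rintro rfl
      rw [permComp_swap_of_eq rfl] at hswap
      exact hadm hswap
    obtain ⟨hi', hj', hother⟩ := (admissible_swap_iff hij).1 hswap
    have hbad : ¬ ((mu i = 0 ∨ nu i < mu i) ∧ (mu j = 0 ∨ nu j < mu j)) := fun hgood =>
      hadm fun k => by
        by_cases hki : k = i
        · exact hki ▸ hgood.1
        by_cases hkj : k = j
        · exact hkj ▸ hgood.2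
        exact hother k hki hkj
    exact if_congr (by omega) rfl rfl
  · rw [stepWeight_of_not_admissible hswap, ite_self, ite_self]

theorem sum_stepWeight_swap_of_pos (hα : 0 ≤ α) (h : nu ∈ orbit (mu - 1)) (hi : 0 < mu i) :
    ∑ j with nu j < nu i, stepWeight α mu (permComp (Equiv.swap i j) nu) -
        ∑ j with mu i < mu j ∨ mu j = 0, stepWeight α mu (permComp (Equiv.swap i j) nu) =
      ((nu i + 1 - mu i) * α + #{j | nu j < nu i} - #{j | mu j < mu i}) *
        stepWeight α mu nu := by
  by_cases hadm : Admissible mu nu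
  swap
  · rw [sum_stepWeight_swap_of_not_admissible hadm hi, stepWeight_of_not_admissible hadm,
      sub_self, mul_zero]
  rcases (Nat.lt_or_eq_of_le (show nu i + 1 ≤ mu i by have := hadm i; omega)) with hdrop | hfix
  · rw [hadm.sum_stepWeight_swap_lt hα h (Or.inr hdrop), hadm.sum_stepWeight_swap_gt hα h hdrop]
    ring
  rw [Finset.sum_filter, Finset.sum_filter, ← Finset.sum_sub_distrib,
    Finset.sum_congr rfl fun j _ => hadm.stepWeight_swap_sub_of_eq hfix, ← Finset.sum_mul,
    Finset.sum_sub_distrib, Finset.sum_boole, Finset.sum_boole]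
  have hcount : (#{j | mu j = mu i ∧ nu j + 1 < mu i} : ℝ) + #{j | mu j < mu i} =
      #{j | nu j + 1 < mu i} + #{j | nu j + 1 = mu i ∧ mu j ≠ mu i} := by
    exact_mod_cast hadm.card_add_dropCount h hi
  have hlt : ∀ j, nu j + 1 < mu i ↔ nu j < nu i := by omega
  simp only [hlt] at hcount ⊢
  have hfix' : (nu i : ℝ) + 1 = mu i := by exact_mod_cast hfix
  linear_combination stepWeight α mu nu * (hcount - α * hfix')

end Exchange

/-! ### The nonsymmetric polynomials -/

section KZPoly

variable {α : ℝ} {mu nu : Fin n → ℕ} {i j : Fin n}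

theorem largestPart_sub (mu : Fin n → ℕ) (c : ℕ) :
    largestPart (mu - (c : Fin n → ℕ)) = largestPart mu - c :=
  (Finset.apply_sup_eq_sup_comp (fun v => v - c) (fun x y => by omega) (Nat.zero_sub c)).symm

theorem largestPart_eq_zero : largestPart mu = 0 ↔ mu = 0 := by
  refine ⟨fun h => funext fun k => ?_, fun h => h ▸ Finset.sup_bot _⟩
  exact Nat.le_zero.1 (h ▸ le_largestPart mu k)

theorem largestPart_lt_of_mem_orbit_sub_one (h : nu ∈ orbit (mu - 1)) (hmu : mu ≠ 0) :
    largestPart nu < largestPart mu := by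
  rw [largestPart_of_mem_orbit h, ← Nat.cast_one, largestPart_sub]
  exact Nat.sub_one_lt (largestPart_eq_zero.not.2 hmu)

/-- The weighted sum of the values of `F` at the rearrangements of `mu - 1`. -/
def stepSum {M : Type*} [AddCommMonoid M] [Module ℝ M] (α : ℝ) (F : (Fin n → ℕ) → M)
    (mu : Fin n → ℕ) : M :=
  ∑ nu ∈ orbit (mu - 1), stepWeight α mu nu • F nu

/-- The polynomials solving the Knizhnik-Zamolodchikov equations `IsKZSolutionAt`, indexed by
compositions. -/
def kzPoly (α : ℝ) (mu : Fin n → ℕ) : MvPolynomial (Fin n) ℝ :=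
  if mu = 0 then 1
  else xMon mu * ∑ nu ∈ (orbit (mu - 1)).attach, stepWeight α mu nu.1 • kzPoly α nu.1
termination_by largestPart mu
decreasing_by exact largestPart_lt_of_mem_orbit_sub_one nu.2 ‹_›

theorem xMon_zero : xMon (0 : Fin n → ℕ) = 1 := by
  simp only [xMon, Pi.zero_apply, lt_irrefl, Finset.filter_false, Finset.prod_empty]

theorem stepWeight_zero (α : ℝ) : stepWeight α (0 : Fin n → ℕ) 0 = 1 := by
  have hadm : Admissible (0 : Fin n → ℕ) 0 := fun _ => Or.inl rfl
  rw [stepWeight, if_pos hadm, largestPart_eq_zero.2 rfl]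
  rfl

theorem kzPoly_zero (α : ℝ) : kzPoly α (0 : Fin n → ℕ) = 1 := by
  rw [kzPoly, if_pos rfl]

theorem kzPoly_eq (α : ℝ) (mu : Fin n → ℕ) :
    kzPoly α mu = xMon mu * stepSum α (kzPoly α) mu := by
  rcases eq_or_ne mu 0 with rfl | hmu
  · rw [xMon_zero, stepSum, zero_tsub, orbit_zero, Finset.sum_singleton, stepWeight_zero,
      kzPoly_zero, one_smul, one_mul]
  · rw [kzPoly, if_neg hmu, stepSum, Finset.sum_attach _ fun nu => stepWeight α mu nu • kzPoly α nu]

theorem stepInduction {P : (Fin n → ℕ) → Prop} (zero : P 0)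
    (step : ∀ mu, (∀ nu ∈ orbit (mu - 1), P nu) → P mu) (mu : Fin n → ℕ) : P mu := by
  induction h : largestPart mu using Nat.strong_induction_on generalizing mu with
  | _ r ih =>
    rcases eq_or_ne mu 0 with rfl | hmu
    · exact zero
    · exact step mu fun nu hnu =>
        ih _ (h ▸ largestPart_lt_of_mem_orbit_sub_one hnu hmu) nu rfl

theorem rename_xMon (s : Equiv.Perm (Fin n)) (mu : Fin n → ℕ) :
    rename s (xMon mu) = xMon (permComp s mu) := by
  rw [xMon, xMon, map_prod, Finset.prod_filter, Finset.prod_filter,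
    ← Equiv.prod_comp s fun k => if 0 < permComp s mu k then X k else 1]
  simp [permComp]

theorem stepSum_permComp {M : Type*} [AddCommMonoid M] [Module ℝ M] (α : ℝ)
    (F : (Fin n → ℕ) → M) (s : Equiv.Perm (Fin n)) (mu : Fin n → ℕ) :
    stepSum α F (permComp s mu) = stepSum α (fun nu => F (permComp s nu)) mu := by
  rw [stepSum, show permComp s mu - 1 = permComp s (mu - 1) from rfl, orbit_permComp,
    ← sum_orbit_permComp (mu - 1) s]
  simp only [stepWeight_permComp, stepSum]

theorem stepSum_permComp_swap {M : Type*} [AddCommMonoid M] [Module ℝ M] (α : ℝ)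
    (F : (Fin n → ℕ) → M) (i j : Fin n) (mu : Fin n → ℕ) :
    stepSum α F (permComp (Equiv.swap i j) mu) =
      ∑ nu ∈ orbit (mu - 1), stepWeight α mu (permComp (Equiv.swap i j) nu) • F nu := by
  rw [stepSum_permComp, stepSum, ← sum_orbit_permComp (mu - 1) (Equiv.swap i j)]
  simp only [permComp_swap_swap]

theorem rename_kzPoly (α : ℝ) (s : Equiv.Perm (Fin n)) (mu : Fin n → ℕ) :
    rename s (kzPoly α mu) = kzPoly α (permComp s mu) := by
  induction mu using stepInduction with
  | zero => rw [show permComp s 0 = 0 from rfl, kzPoly_zero, map_one]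
  | step mu ih =>
    rw [kzPoly_eq, kzPoly_eq, map_mul, rename_xMon, stepSum_permComp, stepSum, map_sum]
    exact congrArg _ (Finset.sum_congr rfl fun nu hnu => by rw [map_smul, ih nu hnu])

theorem xMon_congr (h : ∀ k, 0 < mu k ↔ 0 < nu k) : xMon mu = xMon nu :=
  congrArg (fun s => ∏ k ∈ s, X k) (Finset.filter_congr fun k _ => h k)

theorem xMon_swap_of_iff (h : 0 < mu i ↔ 0 < mu j) :
    xMon (permComp (Equiv.swap i j) mu) = xMon mu := by
  refine xMon_congr fun k => ?_
  rw [permComp_swap_apply, Equiv.swap_apply_def]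
  split_ifs with hi hj
  · rw [hi, h]
  · rw [hj, h]
  · rfl

theorem X_mul_xMon_swap (hi : 0 < mu i) (hj : mu j = 0) :
    X i * xMon (permComp (Equiv.swap i j) mu) = X j * xMon mu := by
  have hij : i ≠ j := by rintro rfl; omega
  have h := prod_permComp_swap_mul hij mu fun k v =>
    if 0 < v then (X k : MvPolynomial (Fin n) ℝ) else 1
  simp only [hi, hj, lt_irrefl, if_true, if_false, mul_one, one_mul] at h
  rw [xMon, xMon, Finset.prod_filter, Finset.prod_filter, mul_comm, h, mul_comm]

/-- At `i = j` the quotient on the left is the junk value `0`. -/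
theorem div_sub_mul_eval_xMon_sub {x : Fin n → ℝ} (hx : Function.Injective x) (i j : Fin n)
    (mu : Fin n → ℕ) :
    x i / (x i - x j) *
        (eval x (xMon mu) - eval x (xMon (permComp (Equiv.swap i j) mu))) =
      (if 0 < mu i ∧ mu j = 0 then eval x (xMon mu) else 0) -
        (if mu i = 0 ∧ 0 < mu j then eval x (xMon (permComp (Equiv.swap i j) mu)) else 0) := by
  by_cases hiff : 0 < mu i ↔ 0 < mu j
  · rw [xMon_swap_of_iff hiff, sub_self, mul_zero, if_neg (by omega), if_neg (by omega), sub_zero]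
  have hij : i ≠ j := by rintro rfl; exact hiff Iff.rfl
  have hne : x i - x j ≠ 0 := sub_ne_zero.2 (hx.ne hij)
  rw [div_mul_eq_mul_div, div_eq_iff hne]
  rcases Nat.eq_zero_or_pos (mu i) with hi | hi
  · have hj : 0 < mu j := by omega
    have h := congrArg (eval x) (X_mul_xMon_swap hj hi)
    rw [Equiv.swap_comm, map_mul, map_mul, eval_X, eval_X] at h
    rw [if_neg (by omega), if_pos ⟨hi, hj⟩]
    linear_combination -h
  · have hj : mu j = 0 := by omega
    have h := congrArg (eval x) (X_mul_xMon_swap hi hj)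
    rw [map_mul, map_mul, eval_X, eval_X] at h
    rw [if_pos ⟨hi, hj⟩, if_neg (by omega)]
    linear_combination -h

end KZPoly

/-! ### Knizhnik-Zamolodchikov equations -/

section Theta

variable {σ R : Type*} [CommSemiring R]

/-- The Euler operator `x_i ∂ / ∂ x_i`. -/
def theta (i : σ) : Derivation R (MvPolynomial σ R) (MvPolynomial σ R) :=
  (X i : MvPolynomial σ R) • pderiv i

theorem theta_monomial (i : σ) (m : σ →₀ ℕ) (c : R) :
    theta i (monomial m c) = m i • monomial m c :=
  X_mul_pderiv_monomial

theorem theta_X_self (i : σ) : theta i (X i : MvPolynomial σ R) = X i := by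
  rw [X, theta_monomial, Finsupp.single_eq_same, one_smul]

theorem theta_X_of_ne {i k : σ} (h : k ≠ i) : theta i (X k : MvPolynomial σ R) = 0 := by
  rw [X, theta_monomial, Finsupp.single_eq_of_ne h.symm, zero_smul]

theorem theta_prod_X [DecidableEq σ] (i : σ) (s : Finset σ) :
    theta i (∏ k ∈ s, (X k : MvPolynomial σ R)) = if i ∈ s then ∏ k ∈ s, X k else 0 := by
  induction s using Finset.induction_on with
  | empty => rw [Finset.prod_empty, Derivation.map_one_eq_zero, if_neg (Finset.notMem_empty i)]
  | insert a s ha ih =>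
    rw [Finset.prod_insert ha, Derivation.leibniz, ih]
    rcases eq_or_ne a i with rfl | hne
    · rw [if_neg ha, theta_X_self, smul_zero, zero_add, if_pos (Finset.mem_insert_self a s),
        smul_eq_mul, mul_comm]
    · simp only [theta_X_of_ne hne, Finset.mem_insert, hne.symm, false_or, smul_eq_mul, mul_zero,
        add_zero, mul_ite]

end Theta

section KZ

variable {α : ℝ} {mu nu : Fin n → ℕ} {i j : Fin n} {x : Fin n → ℝ}

/-- The divided-difference part `∑_{j ≠ i} x_i / (x_i - x_j) (1 - s_ij)` of the
Knizhnik-Zamolodchikov operator; the summand for `j = i` vanishes. -/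
def dividedSum (x : Fin n → ℝ) (i : Fin n) (F : (Fin n → ℕ) → ℝ) (mu : Fin n → ℕ) : ℝ :=
  ∑ j, x i / (x i - x j) * (F mu - F (permComp (Equiv.swap i j) mu))

/-- The combinatorial part of the Knizhnik-Zamolodchikov operator. -/
def exchangeSum (α : ℝ) (i : Fin n) (F : (Fin n → ℕ) → ℝ) (mu : Fin n → ℕ) : ℝ :=
  (α * mu i + #{j | mu j < mu i}) * F mu -
    ∑ j with mu i < mu j, F (permComp (Equiv.swap i j) mu)

/-- The Knizhnik-Zamolodchikov equation in direction `i` for the family `f` of polynomials, at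
the index `mu` and the point `x`. -/
def IsKZSolutionAt (α : ℝ) (f : (Fin n → ℕ) → MvPolynomial (Fin n) ℝ) (x : Fin n → ℝ)
    (i : Fin n) (mu : Fin n → ℕ) : Prop :=
  α * eval x (theta i (f mu)) =
    exchangeSum α i (fun nu => eval x (f nu)) mu - dividedSum x i (fun nu => eval x (f nu)) mu

theorem stepSum_dividedSum (α : ℝ) (x : Fin n → ℝ) (i : Fin n) (F : (Fin n → ℕ) → ℝ)
    (mu : Fin n → ℕ) :
    stepSum α (dividedSum x i F) mu = dividedSum x i (stepSum α F) mu := by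
  simp only [dividedSum, stepSum_permComp]
  simp only [stepSum, dividedSum, ← Finset.sum_sub_distrib, Finset.smul_sum, Finset.mul_sum]
  rw [Finset.sum_comm]
  exact Finset.sum_congr rfl fun j _ => Finset.sum_congr rfl fun nu _ => by
    simp only [smul_eq_mul]
    ring

theorem stepSum_exchangeSum (α : ℝ) (i : Fin n) (F : (Fin n → ℕ) → ℝ) (mu : Fin n → ℕ) :
    stepSum α (exchangeSum α i F) mu =
      ∑ nu ∈ orbit (mu - 1), ((nu i * α + #{j | nu j < nu i}) * stepWeight α mu nu -
        ∑ j with nu j < nu i, stepWeight α mu (permComp (Equiv.swap i j) nu)) * F nu := by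
  have htransfer := sum_orbit_sum_permComp_swap (mu - 1) i fun j nu =>
    if nu j < nu i then stepWeight α mu (permComp (Equiv.swap i j) nu) * F nu else 0
  simp only [permComp_swap_swap, permComp_swap_apply, Equiv.swap_apply_left,
    Equiv.swap_apply_right] at htransfer
  simp only [stepSum, exchangeSum, smul_eq_mul, mul_sub, sub_mul, Finset.sum_sub_distrib,
    Finset.mul_sum, Finset.sum_mul, Finset.sum_filter, mul_ite, mul_zero, ite_mul, zero_mul,
    htransfer]
  exact congrArg (· - _) (Finset.sum_congr rfl fun nu _ => by ring)

theorem stepSum_exchangeSum_of_eq_zero (hα : 0 ≤ α) (F : (Fin n → ℕ) → ℝ) (hi : mu i = 0) :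
    stepSum α (exchangeSum α i F) mu = 0 := by
  rw [stepSum_exchangeSum]
  refine Finset.sum_eq_zero fun nu hnu => ?_
  rw [sum_stepWeight_swap_of_eq_zero hα hnu hi, sub_self, zero_mul]

theorem stepSum_exchangeSum_of_pos (hα : 0 ≤ α) (F : (Fin n → ℕ) → ℝ) (hi : 0 < mu i) :
    stepSum α (exchangeSum α i F) mu =
      ((mu i - 1) * α + #{j | mu j < mu i}) * stepSum α F mu -
        ∑ j with mu i < mu j ∨ mu j = 0, stepSum α F (permComp (Equiv.swap i j) mu) := by
  simp only [stepSum_permComp_swap]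
  rw [stepSum_exchangeSum, Finset.sum_comm, stepSum, Finset.mul_sum, ← Finset.sum_sub_distrib]
  refine Finset.sum_congr rfl fun nu hnu => ?_
  simp only [smul_eq_mul, ← Finset.sum_mul]
  linear_combination -F nu * sum_stepWeight_swap_of_pos hα hnu hi

theorem dividedSum_mul (x : Fin n → ℝ) (i : Fin n) (E G : (Fin n → ℕ) → ℝ) (mu : Fin n → ℕ) :
    dividedSum x i (fun nu => E nu * G nu) mu = E mu * dividedSum x i G mu +
      ∑ j, x i / (x i - x j) * (E mu - E (permComp (Equiv.swap i j) mu)) *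
        G (permComp (Equiv.swap i j) mu) := by
  simp only [dividedSum, Finset.mul_sum, ← Finset.sum_add_distrib]
  exact Finset.sum_congr rfl fun j _ => by ring

theorem exchangeSum_sub_dividedSum_xMon_mul_of_eq_zero (hx : Function.Injective x) (α : ℝ)
    (G : (Fin n → ℕ) → ℝ) (hi : mu i = 0) :
    exchangeSum α i (fun nu => eval x (xMon nu) * G nu) mu -
        dividedSum x i (fun nu => eval x (xMon nu) * G nu) mu =
      -(eval x (xMon mu) * dividedSum x i G mu) := by
  simp only [dividedSum_mul, div_sub_mul_eval_xMon_sub hx, exchangeSum, hi, lt_irrefl, false_and,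
    if_false, true_and, zero_sub, Nat.not_lt_zero, Finset.filter_false, Finset.card_empty,
    Finset.sum_filter, neg_mul, ite_mul, zero_mul, Finset.sum_neg_distrib, Nat.cast_zero, mul_zero,
    add_zero]
  ring

theorem exchangeSum_sub_dividedSum_xMon_mul_of_pos (hx : Function.Injective x) (α : ℝ)
    (G : (Fin n → ℕ) → ℝ) (hi : 0 < mu i) :
    exchangeSum α i (fun nu => eval x (xMon nu) * G nu) mu -
        dividedSum x i (fun nu => eval x (xMon nu) * G nu) mu =
      eval x (xMon mu) * ((α * mu i + #{j | mu j < mu i}) * G mu -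
        ∑ j with mu i < mu j ∨ mu j = 0, G (permComp (Equiv.swap i j) mu) -
        dividedSum x i G mu) := by
  have hsplit : eval x (xMon mu) *
        ∑ j with mu i < mu j ∨ mu j = 0, G (permComp (Equiv.swap i j) mu) =
      ∑ j with mu i < mu j, eval x (xMon (permComp (Equiv.swap i j) mu)) *
          G (permComp (Equiv.swap i j) mu) +
        ∑ j, (if mu j = 0 then eval x (xMon mu) else 0) * G (permComp (Equiv.swap i j) mu) := by
    rw [Finset.mul_sum, Finset.sum_filter, Finset.sum_filter, ← Finset.sum_add_distrib]
    refine Finset.sum_congr rfl fun j _ => ?_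
    by_cases hlt : mu i < mu j
    · rw [if_pos (Or.inl hlt), if_pos hlt, if_neg (by omega), xMon_swap_of_iff (by omega),
        zero_mul, add_zero]
    · by_cases hj : mu j = 0 <;> simp [hlt, hj]
  simp only [dividedSum_mul, div_sub_mul_eval_xMon_sub hx, exchangeSum, hi, hi.ne', true_and,
    false_and, if_false, sub_zero]
  linear_combination hsplit

theorem theta_xMon (i : Fin n) (mu : Fin n → ℕ) :
    theta i (xMon mu) = if 0 < mu i then xMon mu else 0 := by
  simp only [xMon, theta_prod_X, Finset.mem_filter, Finset.mem_univ, true_and]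

theorem theta_kzPoly (α : ℝ) (i : Fin n) (mu : Fin n → ℕ) :
    theta i (kzPoly α mu) = (if 0 < mu i then kzPoly α mu else 0) +
      xMon mu * stepSum α (fun nu => theta i (kzPoly α nu)) mu := by
  rw [kzPoly_eq, Derivation.leibniz, theta_xMon, add_comm, smul_eq_mul, smul_eq_mul, mul_ite,
    mul_zero, mul_comm (stepSum α (kzPoly α) mu)]
  simp only [stepSum, map_sum, Derivation.map_smul]

theorem eval_stepSum (x : Fin n → ℝ) (α : ℝ) (f : (Fin n → ℕ) → MvPolynomial (Fin n) ℝ)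
    (mu : Fin n → ℕ) : eval x (stepSum α f mu) = stepSum α (fun nu => eval x (f nu)) mu := by
  simp only [stepSum, map_sum, smul_eval, smul_eq_mul]

theorem isKZSolutionAt_kzPoly (hα : 0 ≤ α) (hx : Function.Injective x) (i : Fin n)
    (mu : Fin n → ℕ) : IsKZSolutionAt α (kzPoly α) x i mu := by
  induction mu using stepInduction with
  | zero =>
    have hperm (s : Equiv.Perm (Fin n)) : permComp s (0 : Fin n → ℕ) = 0 := rfl
    simp [IsKZSolutionAt, exchangeSum, dividedSum, kzPoly_zero, hperm]
  | step mu ih =>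
    set F : (Fin n → ℕ) → ℝ := fun nu => eval x (kzPoly α nu) with hF
    have hfactor : F = fun nu => eval x (xMon nu) * stepSum α F nu := by
      funext nu
      rw [hF, ← eval_stepSum, ← map_mul, ← kzPoly_eq]
    have hstep : α * stepSum α (fun nu => eval x (theta i (kzPoly α nu))) mu =
        stepSum α (exchangeSum α i F) mu - dividedSum x i (stepSum α F) mu := by
      rw [← stepSum_dividedSum, stepSum, stepSum, stepSum, Finset.mul_sum,
        ← Finset.sum_sub_distrib]
      refine Finset.sum_congr rfl fun nu hnu => ?_
      rw [← smul_sub, ← ih nu hnu, smul_eq_mul, smul_eq_mul, mul_left_comm]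
    rw [IsKZSolutionAt, theta_kzPoly, map_add, map_mul, eval_stepSum, apply_ite (eval x), map_zero,
      mul_add, mul_left_comm, hstep, ← hF, hfactor]
    rcases Nat.eq_zero_or_pos (mu i) with hi | hi
    · rw [exchangeSum_sub_dividedSum_xMon_mul_of_eq_zero hx α _ hi, ← hfactor,
        stepSum_exchangeSum_of_eq_zero hα F hi, if_neg hi.not_gt]
      ring
    · rw [exchangeSum_sub_dividedSum_xMon_mul_of_pos hx α _ hi, ← hfactor,
        stepSum_exchangeSum_of_pos hα F hi, if_pos hi,
        show eval x (kzPoly α mu) = eval x (xMon mu) * stepSum α F mu from congrFun hfactor mu]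
      ring

end KZ

/-! ### The Laplace-Beltrami operator -/

section Laplace

variable {α : ℝ} {mu nu lam : Fin n → ℕ} {x : Fin n → ℝ}

/-- The sum of the polynomials `kzPoly α nu` over all rearrangements `nu` of `lam`; it turns out to
be the Jack polynomial. -/
def jackSum (α : ℝ) (lam : Fin n → ℕ) : MvPolynomial (Fin n) ℝ :=
  ∑ nu ∈ orbit lam, kzPoly α nu

/-- The value at `x` of the Laplace-Beltrami operator applied to `g`. The terms with `i = j`
vanish; for the others to be meaningful `x` must have distinct coordinates. -/
def laplaceAt (α : ℝ) (x : Fin n → ℝ) (g : MvPolynomial (Fin n) ℝ) : ℝ :=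
  ∑ i, (α * eval x (theta i (theta i g)) +
    ∑ j, x i / (x i - x j) * (eval x (theta i g) - eval x (theta j g)) - n * eval x (theta i g))

/-- The eigenvalue of the Laplace-Beltrami operator belonging to `lam`. -/
def eigenval (α : ℝ) (lam : Fin n → ℕ) : ℝ :=
  ∑ i, (α * lam i ^ 2 - ∑ j, ((min (lam i) (lam j) : ℕ) : ℝ))

theorem prod_X_sub_X_ne_zero {σ R : Type*} [Fintype σ] [DecidableEq σ] [CommRing R] [IsDomain R] :
    ∏ ij : σ × σ with ij.1 ≠ ij.2, (X ij.1 - X ij.2 : MvPolynomial σ R) ≠ 0 :=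
  Finset.prod_ne_zero_iff.2 fun _ hij h =>
    (Finset.mem_filter.1 hij).2 (X_injective (sub_eq_zero.1 h))

theorem eq_of_eval_eq_of_injective {σ R : Type*} [Finite σ] [CommRing R] [IsDomain R]
    [Infinite R] {p q : MvPolynomial σ R}
    (h : ∀ x : σ → R, Function.Injective x → eval x p = eval x q) : p = q := by
  classical
  have := Fintype.ofFinite σ
  refine mul_right_cancel₀ prod_X_sub_X_ne_zero (MvPolynomial.funext fun x => ?_)
  simp only [map_mul, map_prod, map_sub, eval_X]
  by_cases hx : Function.Injective x
  · rw [h x hx]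
  · obtain ⟨a, b, hab, hne⟩ := Function.not_injective_iff.1 hx
    have hzero : ∏ ij : σ × σ with ij.1 ≠ ij.2, (x ij.1 - x ij.2) = 0 :=
      Finset.prod_eq_zero (i := (a, b)) (by simp [hne]) (sub_eq_zero.2 hab)
    rw [hzero, mul_zero, mul_zero]

theorem sum_orbit_mul_dividedSum (x : Fin n → ℝ) (i : Fin n) (F : (Fin n → ℕ) → ℝ) (φ : ℕ → ℝ)
    (mu : Fin n → ℕ) :
    ∑ nu ∈ orbit mu, φ (nu i) * dividedSum x i F nu =
      ∑ j, x i / (x i - x j) *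
        (∑ nu ∈ orbit mu, φ (nu i) * F nu - ∑ nu ∈ orbit mu, φ (nu j) * F nu) := by
  simp only [dividedSum, Finset.mul_sum]
  rw [Finset.sum_comm]
  refine Finset.sum_congr rfl fun j _ => ?_
  have hswap := sum_orbit_permComp mu (Equiv.swap i j) fun nu => φ (nu j) * F nu
  simp only [permComp_swap_apply, Equiv.swap_apply_right] at hswap
  rw [← hswap, ← Finset.sum_sub_distrib, Finset.mul_sum]
  exact Finset.sum_congr rfl fun nu _ => by ring

theorem sum_orbit_mul_exchangeSum (α : ℝ) (i : Fin n) (F : (Fin n → ℕ) → ℝ) (φ : ℕ → ℝ)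
    (mu : Fin n → ℕ) :
    ∑ nu ∈ orbit mu, φ (nu i) * exchangeSum α i F nu =
      ∑ nu ∈ orbit mu, (φ (nu i) * (α * nu i) +
        ∑ j with nu j < nu i, (φ (nu i) - φ (nu j))) * F nu := by
  have htransfer := sum_orbit_sum_permComp_swap mu i fun j nu =>
    if nu j < nu i then φ (nu j) * F nu else 0
  simp only [permComp_swap_apply, Equiv.swap_apply_left, Equiv.swap_apply_right] at htransfer
  simp only [exchangeSum, mul_sub, Finset.sum_sub_distrib, Finset.mul_sum, Finset.sum_filter,
    mul_ite, mul_zero, htransfer]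
  rw [← Finset.sum_sub_distrib]
  refine Finset.sum_congr rfl fun nu _ => ?_
  simp only [← Finset.sum_filter, Finset.sum_const, nsmul_eq_mul, ← Finset.sum_mul]
  ring

theorem sum_orbit_mul_eval_theta (hα : 0 ≤ α) (hx : Function.Injective x) (i : Fin n)
    (φ : ℕ → ℝ) (mu : Fin n → ℕ) :
    ∑ nu ∈ orbit mu, φ (nu i) * (α * eval x (theta i (kzPoly α nu))) =
      ∑ nu ∈ orbit mu, (φ (nu i) * (α * nu i) + ∑ j with nu j < nu i, (φ (nu i) - φ (nu j))) *
        eval x (kzPoly α nu) -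
      ∑ j, x i / (x i - x j) * (∑ nu ∈ orbit mu, φ (nu i) * eval x (kzPoly α nu) -
        ∑ nu ∈ orbit mu, φ (nu j) * eval x (kzPoly α nu)) := by
  rw [← sum_orbit_mul_exchangeSum, ← sum_orbit_mul_dividedSum, ← Finset.sum_sub_distrib]
  refine Finset.sum_congr rfl fun nu _ => ?_
  rw [isKZSolutionAt_kzPoly hα hx, mul_sub]

theorem theta_jackSum (hα : 0 < α) (lam : Fin n → ℕ) (i : Fin n) :
    theta i (jackSum α lam) = ∑ nu ∈ orbit lam, (nu i : ℝ) • kzPoly α nu := by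
  refine eq_of_eval_eq_of_injective fun x hx => mul_left_cancel₀ hα.ne' ?_
  have h := sum_orbit_mul_eval_theta hα.le hx i (fun _ => 1) lam
  simp only [one_mul, sub_self, Finset.sum_const_zero, mul_zero, sub_zero, add_zero] at h
  simp only [jackSum, map_sum, Finset.mul_sum, h, smul_eval, mul_assoc]

theorem eigenval_of_mem_orbit (α : ℝ) (h : nu ∈ orbit lam) : eigenval α nu = eigenval α lam := by
  have hmin (a : ℕ) : ∑ j, ((min a (nu j) : ℕ) : ℝ) = ∑ j, ((min a (lam j) : ℕ) : ℝ) :=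
    sum_comp_of_mem_orbit h fun v => ((min a v : ℕ) : ℝ)
  simp only [eigenval, hmin]
  exact sum_comp_of_mem_orbit h fun v => α * (v : ℝ) ^ 2 - ∑ j, ((min v (lam j) : ℕ) : ℝ)

theorem sum_filter_lt_sub_eq (mu : Fin n → ℕ) (i : Fin n) :
    ∑ j with mu j < mu i, ((mu i : ℝ) - mu j) = n * mu i - ∑ j, ((min (mu i) (mu j) : ℕ) : ℝ) := by
  have hconst : (n : ℝ) * mu i = ∑ _j : Fin n, (mu i : ℝ) := by simp
  rw [hconst, ← Finset.sum_sub_distrib, Finset.sum_filter]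
  refine Finset.sum_congr rfl fun j _ => ?_
  split_ifs with h
  · rw [min_eq_right h.le]
  · rw [min_eq_left (not_lt.1 h), sub_self]

theorem laplaceAt_jackSum (hα : 0 < α) (lam : Fin n → ℕ) (hx : Function.Injective x) :
    laplaceAt α x (jackSum α lam) = eigenval α lam * eval x (jackSum α lam) := by
  have htheta (i : Fin n) : eval x (theta i (jackSum α lam)) =
      ∑ nu ∈ orbit lam, (nu i : ℝ) * eval x (kzPoly α nu) := by
    simp only [theta_jackSum hα, map_sum, smul_eval]
  have htheta_theta (i : Fin n) : α * eval x (theta i (theta i (jackSum α lam))) =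
      ∑ nu ∈ orbit lam, (nu i : ℝ) * (α * eval x (theta i (kzPoly α nu))) := by
    simp only [theta_jackSum hα, map_sum, Derivation.map_smul, smul_eval, Finset.mul_sum]
    exact Finset.sum_congr rfl fun nu _ => mul_left_comm _ _ _
  simp only [laplaceAt, htheta, htheta_theta,
    sum_orbit_mul_eval_theta hα.le hx _ (Nat.cast (R := ℝ)), sum_filter_lt_sub_eq,
    sub_add_cancel, Finset.mul_sum, ← Finset.sum_sub_distrib]
  rw [Finset.sum_comm, jackSum, map_sum, Finset.mul_sum]
  refine Finset.sum_congr rfl fun nu hnu => ?_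
  rw [← eigenval_of_mem_orbit α hnu, eigenval, Finset.sum_mul]
  exact Finset.sum_congr rfl fun i _ => by ring

end Laplace

/-! ### Self-adjointness of the Laplace-Beltrami operator -/

section DiagForm

/-- The bilinear form for which products of power sums are pairwise orthogonal, with squared
norms given by `w`. -/
def diagForm (w : (ℕ+ →₀ ℕ) → ℝ) : SymFun →ₗ[ℝ] SymFun →ₗ[ℝ] ℝ :=
  (basisMonomials ℕ+ ℝ).constr ℝ fun m => w m • lcoeff ℝ m

theorem diagForm_monomial (w : (ℕ+ →₀ ℕ) → ℝ) (m : ℕ+ →₀ ℕ) (a : ℝ) (g : SymFun) :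
    diagForm w (monomial m a) g = a * coeff m g * w m := by
  have h : diagForm w (monomial m 1) = w m • lcoeff ℝ m := by
    simpa only [diagForm, coe_basisMonomials] using
      (basisMonomials ℕ+ ℝ).constr_basis ℝ (fun m => w m • lcoeff ℝ m) m
  rw [← mul_one a, ← smul_eq_mul, ← smul_monomial, map_smul, h]
  simp only [LinearMap.smul_apply, lcoeff_apply, smul_eq_mul, mul_one]
  ring

theorem diagForm_apply (w : (ℕ+ →₀ ℕ) → ℝ) (f g : SymFun) :
    diagForm w f g = ∑ m ∈ f.support, coeff m f * coeff m g * w m := by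
  conv_lhs => rw [f.as_sum]
  simp only [map_sum, LinearMap.sum_apply, diagForm_monomial]

theorem diagForm_comm (w : (ℕ+ →₀ ℕ) → ℝ) (f g : SymFun) : diagForm w f g = diagForm w g f := by
  classical
  suffices h : diagForm w = (diagForm w).flip from LinearMap.congr_fun₂ h f g
  refine (basisMonomials ℕ+ ℝ).ext fun l => (basisMonomials ℕ+ ℝ).ext fun m => ?_
  simp only [coe_basisMonomials, LinearMap.flip_apply, diagForm_monomial, coeff_monomial]
  split_ifs with h h' h' <;> simp_all

/-- The squared norms of products of power sums for the Jack scalar product. -/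
def jackNorm (α : ℝ) (m : ℕ+ →₀ ℕ) : ℝ :=
  m.prod fun k e => (k : ℝ) ^ e * e.factorial * α ^ e

theorem jackNorm_add_single (α : ℝ) (m : ℕ+ →₀ ℕ) (k : ℕ+) :
    jackNorm α (m + Finsupp.single k 1) = α * k * (m k + 1) * jackNorm α m := by
  classical
  have hsplit (m : ℕ+ →₀ ℕ) : jackNorm α m =
      ((k : ℝ) ^ m k * (m k).factorial * α ^ m k) * jackNorm α (m.erase k) :=
    (Finsupp.mul_prod_erase' m k (fun k e => (k : ℝ) ^ e * e.factorial * α ^ e) (by simp)).symm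
  rw [hsplit, hsplit m, Finsupp.erase_add, Finsupp.erase_single, add_zero]
  simp only [Finsupp.add_apply, Finsupp.single_eq_same, Nat.factorial_succ, pow_succ]
  push_cast
  ring

theorem diagForm_X_mul (α : ℝ) (k : ℕ+) (f g : SymFun) :
    diagForm (jackNorm α) (X k * f) g = α * k * diagForm (jackNorm α) f (pderiv k g) := by
  induction f using MvPolynomial.induction_on' with
  | add f f' hf hf' => simp only [mul_add, map_add, LinearMap.add_apply, hf, hf']
  | monomial m a =>
    rw [mul_comm, X, monomial_mul, diagForm_monomial, diagForm_monomial, jackNorm_add_single,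
      coeff_pderiv]
    ring

theorem diagForm_mul_X (α : ℝ) (k : ℕ+) (f g : SymFun) :
    diagForm (jackNorm α) f (X k * g) = α * k * diagForm (jackNorm α) (pderiv k f) g := by
  rw [diagForm_comm, diagForm_X_mul, diagForm_comm]

theorem pderiv_comm {σ R : Type*} [CommRing R] (i j : σ) (f : MvPolynomial σ R) :
    pderiv i (pderiv j f) = pderiv j (pderiv i f) := by
  classical
  have h : ⁅pderiv (R := R) i, pderiv (R := R) j⁆ = 0 := by
    refine derivation_ext fun k => ?_
    simp only [Derivation.commutator_apply, pderiv_X, Pi.single_apply, apply_ite,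
      pderiv_one, map_zero, ite_self, sub_self, Derivation.zero_apply]
  rw [← sub_eq_zero, ← Derivation.commutator_apply, h, Derivation.zero_apply]

/-- The Laplace-Beltrami operator in the power sums `X k`, truncated to `k ≤ D`; it corresponds to
`laplaceAt` on the polynomials in these power sums (`laplaceAt_toVars`). -/
def symLaplace (α : ℝ) (D : ℕ+) (f : SymFun) : SymFun :=
  ∑ k ∈ Finset.Icc 1 D, ((α - 1) * (k : ℝ) ^ 2) • (X k * pderiv k f) +
    ∑ a ∈ Finset.Icc 1 D, ∑ b ∈ Finset.Icc 1 D,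
      ((α * a * b) • (X (a + b) * pderiv a (pderiv b f)) +
        ((a + b : ℕ+) : ℝ) • (X a * (X b * pderiv (a + b) f)))

theorem diagForm_symLaplace (α : ℝ) (D : ℕ+) (f g : SymFun) :
    diagForm (jackNorm α) (symLaplace α D f) g = diagForm (jackNorm α) f (symLaplace α D g) := by
  simp only [symLaplace, map_add, map_sum, map_smul, LinearMap.add_apply, LinearMap.sum_apply,
    LinearMap.smul_apply, diagForm_X_mul, diagForm_mul_X, smul_eq_mul]
  refine congrArg _ (Finset.sum_congr rfl fun a _ => Finset.sum_congr rfl fun b _ => ?_)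
  rw [pderiv_comm a b f, pderiv_comm a b g]
  ring

end DiagForm

/-! ### The Laplace-Beltrami operator in the power sums -/

section Supported

variable {σ R : Type*} [CommRing R] {s : Set σ} {f : MvPolynomial σ R}

theorem pderiv_mem_supported (hf : f ∈ supported R s) (k : σ) : pderiv k f ∈ supported R s := by
  classical
  induction hf using Algebra.adjoin_induction with
  | mem f hf =>
    obtain ⟨l, -, rfl⟩ := hf
    rw [pderiv_X, Pi.single_apply]
    split_ifs
    · exact one_mem _
    · exact zero_mem _
  | algebraMap r => exact Derivation.map_algebraMap (pderiv k) r ▸ zero_mem _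
  | add f g _ _ hf hg => exact map_add (pderiv k) f g ▸ add_mem hf hg
  | mul f g hf hg hf' hg' =>
    exact Derivation.leibniz (pderiv k) f g ▸ add_mem (mul_mem hf hg') (mul_mem hg hf')

theorem pderiv_eq_zero_of_mem_supported (hf : f ∈ supported R s) {k : σ} (hk : k ∉ s) :
    pderiv k f = 0 :=
  pderiv_eq_zero_of_notMem_vars fun h => hk (mem_supported.1 hf h)

theorem derivation_aeval {A : Type*} [CommRing A] [Algebra R A] (d : Derivation R A A) (φ : σ → A)
    {s : Finset σ} (hf : f ∈ supported R (s : Set σ)) :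
    d (aeval φ f) = ∑ k ∈ s, aeval φ (pderiv k f) * d (φ k) := by
  classical
  induction hf using Algebra.adjoin_induction with
  | mem f hf =>
    obtain ⟨l, hl, rfl⟩ := hf
    have hl : l ∈ s := hl
    simp [pderiv_X, Pi.single_apply, apply_ite (aeval φ), hl]
  | algebraMap r => simp [Derivation.map_algebraMap]
  | add f g _ _ hf hg => simp only [map_add, hf, hg, add_mul, Finset.sum_add_distrib]
  | mul f g _ _ hf hg =>
    simp only [map_mul, Derivation.leibniz, hf, hg, smul_eq_mul, Finset.mul_sum, map_add,
      ← Finset.sum_add_distrib]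
    exact Finset.sum_congr rfl fun k _ => by ring

end Supported

theorem theta_X_pow {σ R : Type*} [CommRing R] (i : σ) (k : ℕ) :
    theta i (X i ^ k : MvPolynomial σ R) = (k : R) • X i ^ k := by
  rw [X_pow_eq_monomial, theta_monomial, Finsupp.single_eq_same, Nat.cast_smul_eq_nsmul]

theorem theta_psum {σ R : Type*} [Fintype σ] [CommRing R] (i : σ) (k : ℕ) :
    theta i (psum σ R k) = (k : R) • X i ^ k := by
  rw [psum, map_sum, Finset.sum_eq_single i (fun j _ hj => ?_) (by simp), theta_X_pow]
  rw [Derivation.leibniz_pow, theta_X_of_ne hj, smul_zero, smul_zero]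

theorem theta_toVars (i : Fin n) {s : Finset ℕ+} {f : SymFun}
    (hf : f ∈ supported ℝ (s : Set ℕ+)) :
    theta i (toVars n f) = ∑ k ∈ s, (k : ℝ) • (toVars n (pderiv k f) * X i ^ (k : ℕ)) := by
  simp only [toVars, derivation_aeval _ _ hf, theta_psum, mul_smul_comm]

section PowerSums

theorem div_sub_mul_pow_sub_pow {K : Type*} [Field K] {x y : K} (h : x ≠ y) (k : ℕ) :
    x / (x - y) * (x ^ k - y ^ k) = ∑ a ∈ Finset.Icc 1 k, x ^ a * y ^ (k - a) := by
  rw [← (Commute.all x y).geom_sum₂_mul, mul_comm _ (x - y), ← mul_assoc,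
    div_mul_cancel₀ _ (sub_ne_zero.2 h), Finset.mul_sum, Finset.range_eq_Ico,
    ← Finset.Ico_add_one_right_eq_Icc, ← Finset.sum_Ico_add' _ 0 k 1]
  exact Finset.sum_congr rfl fun a _ => by rw [pow_succ', mul_assoc, Nat.sub_sub, add_comm 1]

variable {ι K : Type*} [Fintype ι] [Field K] {x : ι → K}

theorem sum_div_sub_mul_pow_sub_pow (hx : Function.Injective x) (i : ι) (k : ℕ) :
    ∑ j, x i / (x i - x j) * (x i ^ k - x j ^ k) =
      ∑ a ∈ Finset.Icc 1 k, x i ^ a * ∑ j, x j ^ (k - a) - k * x i ^ k := by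
  classical
  have hdiag : ∑ a ∈ Finset.Icc 1 k, x i ^ a * x i ^ (k - a) = k * x i ^ k := by
    rw [Finset.sum_congr rfl fun a ha => by
      rw [← pow_add, Nat.add_sub_cancel' (Finset.mem_Icc.1 ha).2],
      Finset.sum_const, Nat.card_Icc, Nat.add_sub_cancel, nsmul_eq_mul]
  simp only [Finset.mul_sum]
  rw [Finset.sum_comm, ← hdiag, ← Finset.add_sum_erase _ _ (Finset.mem_univ i),
    ← Finset.add_sum_erase _ _ (Finset.mem_univ i), sub_self (x i), div_zero, zero_mul, zero_add,
    add_sub_cancel_left]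
  exact Finset.sum_congr rfl fun j hj =>
    div_sub_mul_pow_sub_pow (hx.ne (Finset.ne_of_mem_erase hj).symm) k

theorem sum_sum_div_sub_mul_pow_sub_pow (hx : Function.Injective x) {k : ℕ} (hk : 0 < k) :
    ∑ i, (∑ j, x i / (x i - x j) * (x i ^ k - x j ^ k) - Fintype.card ι * x i ^ k) =
      ∑ a ∈ Finset.Ico 1 k, (∑ i, x i ^ a) * ∑ i, x i ^ (k - a) - k * ∑ i, x i ^ k := by
  have hlast (i : ι) : ∑ a ∈ Finset.Icc 1 k, x i ^ a * ∑ j, x j ^ (k - a) =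
      ∑ a ∈ Finset.Ico 1 k, x i ^ a * ∑ j, x j ^ (k - a) + Fintype.card ι * x i ^ k := by
    rw [← Finset.Ico_insert_right hk, Finset.sum_insert Finset.right_notMem_Ico, Nat.sub_self]
    simp only [pow_zero, Finset.sum_const, Finset.card_univ, nsmul_eq_mul, mul_one]
    ring
  simp only [sum_div_sub_mul_pow_sub_pow hx, hlast, Finset.sum_sub_distrib,
    Finset.sum_add_distrib, ← Finset.mul_sum, Finset.sum_mul]
  rw [Finset.sum_comm]
  ring

theorem sum_Icc_sum_Icc_eq {M : Type*} [AddCommMonoid M] {D : ℕ+} {F : ℕ+ → ℕ+ → M}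
    (hF : ∀ a b, D < a + b → F a b = 0) :
    ∑ a ∈ Finset.Icc 1 D, ∑ b ∈ Finset.Icc 1 D, F a b =
      ∑ k ∈ Finset.Icc 1 D, ∑ a ∈ Finset.Ico 1 k, F a (k - a) := by
  rw [← Finset.sum_product', Finset.sum_sigma',
    ← Finset.sum_filter_of_ne (f := fun q : ℕ+ × ℕ+ => F q.1 q.2)
      (p := fun q => q.1 + q.2 ≤ D) fun q _ hq =>
      not_lt.1 fun h => hq (hF _ _ h)]
  refine Finset.sum_nbij' (fun q => ⟨q.1 + q.2, q.1⟩) (fun q => (q.2, q.1 - q.2)) ?_ ?_ ?_ ?_ ?_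
  · rintro ⟨a, b⟩ h
    simp_all [PNat.lt_add_right]
  · rintro ⟨k, a⟩ h
    simp only [Finset.mem_sigma, Finset.mem_Icc, Finset.mem_Ico, one_le, true_and] at h
    simp [PNat.add_sub_of_lt h.2, h.1, h.2.le.trans h.1, (PNat.sub_le k a).trans h.1]
  · rintro ⟨a, b⟩ -
    simp only [add_comm a, PNat.add_sub]
  · rintro ⟨k, a⟩ h
    simp only [Finset.mem_sigma, Finset.mem_Ico] at h
    simp [PNat.add_sub_of_lt h.2.2]
  · rintro ⟨a, b⟩ -
    simp only [add_comm a, PNat.add_sub]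

theorem sum_Ico_one_coe {M : Type*} [AddCommMonoid M] (k : ℕ+) (f : ℕ → M) :
    ∑ a ∈ Finset.Ico 1 (k : ℕ), f a = ∑ a ∈ Finset.Ico 1 k, f a :=
  (congrArg (fun s => ∑ a ∈ s, f a) (PNat.map_subtype_embedding_Ico 1 k)).symm.trans
    (Finset.sum_map _ _ _)

end PowerSums

section LaplaceToVars

variable {f : SymFun} {x : Fin n → ℝ} {s : Finset ℕ+}

theorem eval_theta_toVars (hf : f ∈ supported ℝ (s : Set ℕ+)) (x : Fin n → ℝ) (i : Fin n) :
    eval x (theta i (toVars n f)) =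
      ∑ k ∈ s, k * eval x (toVars n (pderiv k f)) * x i ^ (k : ℕ) := by
  simp only [theta_toVars i hf, map_sum, smul_eval, map_mul, map_pow, eval_X, mul_assoc]

theorem sum_eval_theta_theta_toVars (hf : f ∈ supported ℝ (s : Set ℕ+)) (x : Fin n → ℝ) :
    ∑ i, eval x (theta i (theta i (toVars n f))) =
      ∑ k ∈ s, (k : ℝ) ^ 2 * eval x (toVars n (pderiv k f)) * ∑ i, x i ^ (k : ℕ) +
        ∑ a ∈ s, ∑ b ∈ s, a * b * eval x (toVars n (pderiv a (pderiv b f))) *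
          ∑ i, x i ^ (a + b : ℕ) := by
  have htheta (i : Fin n) : eval x (theta i (theta i (toVars n f))) =
      ∑ k ∈ s, (k : ℝ) ^ 2 * eval x (toVars n (pderiv k f)) * x i ^ (k : ℕ) +
        ∑ a ∈ s, ∑ b ∈ s, a * b * eval x (toVars n (pderiv a (pderiv b f))) *
          x i ^ (a + b : ℕ) := by
    rw [theta_toVars i hf, Finset.sum_comm (s := s), ← Finset.sum_add_distrib, map_sum, map_sum]
    refine Finset.sum_congr rfl fun b _ => ?_
    simp only [Derivation.map_smul, Derivation.leibniz, theta_X_pow, smul_eq_mul, smul_eval,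
      map_add, map_mul, map_pow, eval_X, eval_theta_toVars (pderiv_mem_supported hf b),
      Finset.mul_sum, mul_add]
    congr 1
    · ring
    · exact Finset.sum_congr rfl fun a _ => by rw [pow_add]; ring
  simp only [htheta, Finset.sum_add_distrib, Finset.mul_sum]
  rw [Finset.sum_comm, Finset.sum_comm (s := Finset.univ)]
  exact congrArg _ (Finset.sum_congr rfl fun a _ => Finset.sum_comm)

theorem sum_sum_div_sub_mul_eval_theta_toVars (hf : f ∈ supported ℝ (s : Set ℕ+))
    (hx : Function.Injective x) :
    ∑ i, (∑ j, x i / (x i - x j) * (eval x (theta i (toVars n f)) - eval x (theta j (toVars n f))) -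
        n * eval x (theta i (toVars n f))) =
      ∑ k ∈ s, k * eval x (toVars n (pderiv k f)) *
        (∑ a ∈ Finset.Ico 1 (k : ℕ), (∑ i, x i ^ a) * ∑ i, x i ^ ((k : ℕ) - a) -
          k * ∑ i, x i ^ (k : ℕ)) := by
  rw [eq_comm, Finset.sum_congr rfl fun k _ => by
    rw [← sum_sum_div_sub_mul_pow_sub_pow hx k.pos, Fintype.card_fin, Finset.mul_sum],
    Finset.sum_comm]
  refine Finset.sum_congr rfl fun i _ => ?_
  simp only [eval_theta_toVars hf, ← Finset.sum_sub_distrib, Finset.mul_sum]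
  rw [Finset.sum_comm, ← Finset.sum_sub_distrib]
  refine Finset.sum_congr rfl fun k _ => ?_
  rw [mul_sub, Finset.mul_sum]
  exact congrArg₂ _ (Finset.sum_congr rfl fun j _ => by ring) (by ring)

theorem eval_toVars_symLaplace (α : ℝ) (D : ℕ+) (f : SymFun) (x : Fin n → ℝ) :
    eval x (toVars n (symLaplace α D f)) =
      ∑ k ∈ Finset.Icc 1 D, (α - 1) * k ^ 2 * eval x (toVars n (pderiv k f)) *
          ∑ i, x i ^ (k : ℕ) +
        ∑ a ∈ Finset.Icc 1 D, ∑ b ∈ Finset.Icc 1 D,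
          (α * a * b * eval x (toVars n (pderiv a (pderiv b f))) * ∑ i, x i ^ (a + b : ℕ) +
            (a + b : ℕ+) * eval x (toVars n (pderiv (a + b) f)) *
              ((∑ i, x i ^ (a : ℕ)) * ∑ i, x i ^ (b : ℕ))) := by
  have hX (k : ℕ+) : eval x (toVars n (X k)) = ∑ i, x i ^ (k : ℕ) := by simp [toVars, psum]
  simp only [symLaplace, map_add, map_sum, map_smul, map_mul, smul_eval, hX, PNat.add_coe]
  exact congrArg₂ _ (Finset.sum_congr rfl fun k _ => by ring)
    (Finset.sum_congr rfl fun a _ => Finset.sum_congr rfl fun b _ => by ring)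

theorem laplaceAt_toVars (α : ℝ) {D : ℕ+} (hf : f ∈ supported ℝ (Finset.Icc 1 D : Set ℕ+))
    (hx : Function.Injective x) :
    laplaceAt α x (toVars n f) = eval x (toVars n (symLaplace α D f)) := by
  have hzero (a b : ℕ+) (h : D < a + b) : (a + b : ℕ+) * eval x (toVars n (pderiv (a + b) f)) *
      ((∑ i, x i ^ (a : ℕ)) * ∑ i, x i ^ (b : ℕ)) = 0 := by
    rw [pderiv_eq_zero_of_mem_supported hf fun hab => h.not_ge (Finset.mem_Icc.1 hab).2, map_zero,
      map_zero, mul_zero, zero_mul]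
  have hIco (k : ℕ+) : ∑ a ∈ Finset.Ico 1 k, ((a + (k - a) : ℕ+) : ℝ) *
        eval x (toVars n (pderiv (a + (k - a)) f)) *
          ((∑ i, x i ^ (a : ℕ)) * ∑ i, x i ^ ((k - a : ℕ+) : ℕ)) =
      k * eval x (toVars n (pderiv k f)) *
        ∑ a ∈ Finset.Ico 1 (k : ℕ), (∑ i, x i ^ a) * ∑ i, x i ^ ((k : ℕ) - a) := by
    rw [sum_Ico_one_coe, Finset.mul_sum]
    refine Finset.sum_congr rfl fun a ha => ?_
    have hak := (Finset.mem_Ico.1 ha).2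
    rw [PNat.add_sub_of_lt hak, PNat.sub_coe, if_pos hak]
  simp only [eval_toVars_symLaplace, Finset.sum_add_distrib, sum_Icc_sum_Icc_eq hzero, hIco]
  have hsplit : laplaceAt α x (toVars n f) = α * ∑ i, eval x (theta i (theta i (toVars n f))) +
      ∑ i, (∑ j, x i / (x i - x j) * (eval x (theta i (toVars n f)) -
        eval x (theta j (toVars n f))) - n * eval x (theta i (toVars n f))) := by
    rw [laplaceAt, Finset.mul_sum, ← Finset.sum_add_distrib]
    exact Finset.sum_congr rfl fun i _ => by ring
  rw [hsplit, sum_eval_theta_theta_toVars hf, sum_sum_div_sub_mul_eval_theta_toVars hf hx]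
  simp only [mul_sub, Finset.sum_sub_distrib]
  have hpow : ∑ k ∈ Finset.Icc 1 D, (α - 1) * (k : ℝ) ^ 2 * eval x (toVars n (pderiv k f)) *
        ∑ i, x i ^ (k : ℕ) =
      α * ∑ k ∈ Finset.Icc 1 D, (k : ℝ) ^ 2 * eval x (toVars n (pderiv k f)) *
        ∑ i, x i ^ (k : ℕ) -
      ∑ k ∈ Finset.Icc 1 D, k * eval x (toVars n (pderiv k f)) * (k * ∑ i, x i ^ (k : ℕ)) := by
    rw [Finset.mul_sum, ← Finset.sum_sub_distrib]
    exact Finset.sum_congr rfl fun k _ => by ring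
  rw [hpow]
  simp only [mul_assoc, ← Finset.mul_sum]
  ring

end LaplaceToVars

/-! ### Parts of compositions and the dominance order -/

section Parts

variable {mu nu : Fin n → ℕ} {s t : Multiset ℕ}

/-- The multiset of nonzero parts of a composition. -/
def partsOf (mu : Fin n → ℕ) : Multiset ℕ := (Finset.univ.val.map mu).filter (· ≠ 0)

theorem zero_notMem_partsOf (mu : Fin n → ℕ) : 0 ∉ partsOf mu := fun h =>
  (Multiset.mem_filter.1 h).2 rfl

theorem zero_notMem_parts {d : ℕ} (lam : d.Partition) : 0 ∉ lam.parts := fun h =>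
  (lam.parts_pos h).ne' rfl

theorem partsOf_eq_zero : partsOf mu = 0 ↔ mu = 0 := by
  simp [partsOf, funext_iff]

theorem partsOf_add_replicate (mu : Fin n → ℕ) :
    partsOf mu + Multiset.replicate (n - (partsOf mu).card) 0 = Finset.univ.val.map mu := by
  have hsplit := Multiset.filter_add_not (· ≠ 0) (Finset.univ.val.map mu)
  simp only [not_not, Multiset.filter_eq', ← partsOf.eq_1] at hsplit
  have hcard := congrArg Multiset.card hsplit
  simp only [Multiset.card_add, Multiset.card_replicate, Multiset.card_map, Finset.card_val,
    Finset.card_univ, Fintype.card_fin] at hcard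
  rwa [← Nat.eq_sub_of_add_eq' hcard]

theorem sum_map_partsOf {M : Type*} [AddCommMonoid M] (mu : Fin n → ℕ) {g : ℕ → M} (hg : g 0 = 0) :
    ((partsOf mu).map g).sum = ∑ k, g (mu k) := by
  have h := congrArg (fun s => (s.map g).sum) (partsOf_add_replicate mu)
  simp only [Multiset.map_add, Multiset.sum_add, Multiset.map_replicate, Multiset.sum_replicate,
    hg, smul_zero, add_zero, Multiset.map_map] at h
  exact h

theorem sum_partsOf (mu : Fin n → ℕ) : (partsOf mu).sum = ∑ k, mu k := by
  simpa only [id, Multiset.map_id'] using sum_map_partsOf mu (g := id) rfl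

theorem partsOf_permComp (sigma : Equiv.Perm (Fin n)) (mu : Fin n → ℕ) :
    partsOf (permComp sigma mu) = partsOf mu := by
  conv_rhs => rw [partsOf, ← Multiset.map_univ_val_equiv sigma⁻¹, Multiset.map_map]
  rfl

theorem mem_orbit_iff : nu ∈ orbit mu ↔ partsOf nu = partsOf mu := by
  refine ⟨fun h => ?_, fun h => mem_orbit.2 ?_⟩
  · obtain ⟨sigma, rfl⟩ := mem_orbit.1 h
    exact partsOf_permComp sigma mu
  · have hval : Finset.univ.val.map nu = Finset.univ.val.map mu := by
      rw [← partsOf_add_replicate nu, ← partsOf_add_replicate mu, h]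
    have hfiber (v : ℕ) : Fintype.card {k // nu k = v} = Fintype.card {k // mu k = v} := by
      have hcount := congrArg (Multiset.count v) hval
      rw [Multiset.count_map, Multiset.count_map] at hcount
      simp only [Fintype.card_subtype, eq_comm (b := v)]
      exact hcount
    let e := Equiv.ofFiberEquiv fun v => Fintype.equivOfCardEq (hfiber v)
    refine ⟨e⁻¹, funext fun k => ?_⟩
    rw [permComp, inv_inv]
    exact Equiv.ofFiberEquiv_map _ k

theorem exists_partsOf_eq (hs : 0 ∉ s) (hn : s.card ≤ n) : ∃ mu : Fin n → ℕ, partsOf mu = s := by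
  obtain ⟨l, hl⟩ : ∃ l : List ℕ, (l : Multiset ℕ) = s + Multiset.replicate (n - s.card) 0 :=
    ⟨_, Multiset.coe_toList _⟩
  have hlen : l.length = n := by
    rw [← Multiset.coe_card, hl, Multiset.card_add,
      Multiset.card_replicate, Nat.add_sub_cancel' hn]
  subst hlen
  refine ⟨l.get, ?_⟩
  rw [partsOf, Fin.univ_val_map, List.ofFn_get, hl, Multiset.filter_add,
    Multiset.filter_eq_self.2 fun v hv => ne_of_mem_of_not_mem hv hs, Multiset.filter_eq_nil.2,
    add_zero]
  exact fun v hv => not_not.2 (Multiset.eq_of_mem_replicate hv)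

theorem partsOf_update (mu : Fin n → ℕ) (i : Fin n) (v : ℕ) :
    partsOf (Function.update mu i v) =
      (partsOf mu).erase (mu i) + ({v} : Multiset ℕ).filter (· ≠ 0) := by
  obtain ⟨r, hr⟩ := Multiset.exists_cons_of_mem (Finset.mem_univ_val i)
  have hi : i ∉ r := (Multiset.nodup_cons.1 (hr ▸ Finset.univ.nodup)).1
  have hrest : r.map (Function.update mu i v) = r.map mu :=
    Multiset.map_congr rfl fun j hj =>
      Function.update_of_ne (ne_of_mem_of_not_mem hj hi) v mu
  have hcons (a : ℕ) : (a ::ₘ r.map mu).filter (· ≠ 0) =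
      ({a} : Multiset ℕ).filter (· ≠ 0) + (r.map mu).filter (· ≠ 0) := by
    rw [← Multiset.singleton_add, Multiset.filter_add]
  simp only [partsOf, hr, Multiset.map_cons, Function.update_self, hrest, hcons]
  rw [add_comm]
  congr 1
  by_cases h : mu i = 0
  · rw [Multiset.filter_singleton, if_neg (not_not.2 h), Multiset.empty_eq_zero, zero_add,
      Multiset.erase_of_notMem]
    simp [h]
  · rw [Multiset.filter_singleton, if_pos h, Multiset.singleton_add, Multiset.erase_cons_head]

/-- The sum of the excesses of the parts over `c`. As a function of `c` it determines the partial
sums of the parts and vice versa, which turns dominance into a pointwise inequality. -/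
def excess (s : Multiset ℕ) (c : ℕ) : ℕ := (s.map (· - c)).sum

theorem excess_cons (a : ℕ) (s : Multiset ℕ) (c : ℕ) :
    excess (a ::ₘ s) c = a - c + excess s c := by
  rw [excess, Multiset.map_cons, Multiset.sum_cons, excess]

theorem excess_coe_cons (a : ℕ) (l : List ℕ) (c : ℕ) :
    excess ((a :: l : List ℕ) : Multiset ℕ) c = a - c + excess (l : Multiset ℕ) c := by
  rw [← Multiset.cons_coe, excess_cons]

theorem excess_zero_right (s : Multiset ℕ) : excess s 0 = s.sum := by
  simp only [excess, Nat.sub_zero, Multiset.map_id']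

theorem excess_partsOf (mu : Fin n → ℕ) (c : ℕ) : excess (partsOf mu) c = ∑ i, (mu i - c) :=
  sum_map_partsOf mu (Nat.zero_sub c)

theorem excess_eq_zero {c : ℕ} (h : ∀ x ∈ s, x ≤ c) : excess s c = 0 :=
  Multiset.sum_eq_zero (Multiset.forall_mem_map_iff.2 fun x hx => Nat.sub_eq_zero_of_le (h x hx))

theorem sum_take_le (l : List ℕ) (k c : ℕ) : (l.take k).sum ≤ k * c + excess l c := by
  induction l generalizing k with
  | nil => simp
  | cons a l ih =>
    rcases k with _ | k
    · simp
    · rw [List.take_succ_cons, List.sum_cons, excess_coe_cons, add_one_mul]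
      have := ih k
      omega

theorem sum_take_eq_mul_add_excess {l : List ℕ} (hl : l.Pairwise (· ≥ ·)) (k : ℕ) :
    (l.take k).sum = k * l.getD k 0 + excess l (l.getD k 0) := by
  induction l generalizing k with
  | nil => simp [excess]
  | cons a l ih =>
    obtain ⟨ha, hl⟩ := List.pairwise_cons.1 hl
    rcases k with _ | k
    · rw [List.take_zero, List.sum_nil, zero_mul, zero_add, List.getD_cons_zero]
      exact (excess_eq_zero (by simpa using ha)).symm
    · have hle : l.getD k 0 ≤ a := by
        rcases lt_or_ge k l.length with h | h
        · rw [List.getD_eq_getElem l 0 h]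
          exact ha _ (List.getElem_mem h)
        · rw [List.getD_eq_default l 0 h]
          exact Nat.zero_le a
      rw [List.take_succ_cons, List.sum_cons, List.getD_cons_succ, excess_coe_cons, ih hl k,
        add_one_mul]
      omega

theorem excess_add_countP_mul {l : List ℕ} (hl : l.Pairwise (· ≥ ·)) (c : ℕ) :
    excess l c + l.countP (c < ·) * c = (l.take (l.countP (c < ·))).sum := by
  induction l with
  | nil => simp [excess]
  | cons a l ih =>
    obtain ⟨ha, hl⟩ := List.pairwise_cons.1 hl
    by_cases h : c < a
    · rw [List.countP_cons_of_pos (by simpa using h), List.take_succ_cons, List.sum_cons, ← ih hl,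
        excess_coe_cons, add_one_mul]
      omega
    · have hle : ∀ x ∈ a :: l, x ≤ c := by
        simp only [List.mem_cons, forall_eq_or_imp]
        exact ⟨not_lt.1 h, fun x hx => (ha x hx).trans (not_lt.1 h)⟩
      have hcount : (a :: l).countP (c < ·) = 0 :=
        List.countP_eq_zero.2 fun x hx => by simpa using hle x hx
      rw [hcount, zero_mul, add_zero, List.take_zero, List.sum_nil]
      exact excess_eq_zero hle

theorem domLE_iff_excess_le {d : ℕ} {mu lam : d.Partition} :
    DomLE mu lam ↔ ∀ c, excess mu.parts c ≤ excess lam.parts c := by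
  have sorted (nu : d.Partition) : (nu.parts.sort (· ≥ ·)).Pairwise (· ≥ ·) :=
    Multiset.pairwise_sort _ _
  have excess_sort (nu : d.Partition) (c : ℕ) :
      excess nu.parts c = excess (nu.parts.sort (· ≥ ·)) c := by rw [Multiset.sort_eq]
  simp only [excess_sort, DomLE, partialSum]
  refine ⟨fun h c => ?_, fun h k => ?_⟩
  · have hmu := excess_add_countP_mul (sorted mu) c
    exact Nat.le_of_add_le_add_left (by
      rw [add_comm, hmu]
      exact (h _).trans (sum_take_le _ _ c))
  · rw [sum_take_eq_mul_add_excess (sorted lam) k]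
    exact (sum_take_le _ k _).trans (Nat.add_le_add_left (h _) _)

theorem excess_eq_excess_succ_add_countP (s : Multiset ℕ) (c : ℕ) :
    excess s c = excess s (c + 1) + s.countP (c < ·) := by
  induction s using Multiset.induction_on with
  | empty => simp [excess]
  | cons a s ih =>
    rw [excess_cons, excess_cons, Multiset.countP_cons, ih]
    split_ifs <;> omega

theorem countP_lt_eq_countP_succ_lt_add_count (s : Multiset ℕ) (c : ℕ) :
    s.countP (c < ·) = s.countP (c + 1 < ·) + s.count (c + 1) := by
  induction s using Multiset.induction_on with
  | empty => simp
  | cons a s ih =>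
    rw [Multiset.countP_cons, Multiset.countP_cons, Multiset.count_cons, ih]
    split_ifs <;> omega

theorem eq_of_excess_eq (hs : 0 ∉ s) (ht : 0 ∉ t) (h : excess s = excess t) : s = t := by
  have hcountP (c : ℕ) : s.countP (c < ·) = t.countP (c < ·) := by
    have hstep := excess_eq_excess_succ_add_countP s c
    rwa [h, excess_eq_excess_succ_add_countP t c, Nat.add_left_cancel_iff, eq_comm] at hstep
  ext v
  rcases v with _ | v
  · rw [Multiset.count_eq_zero_of_notMem hs, Multiset.count_eq_zero_of_notMem ht]
  · have hstep := countP_lt_eq_countP_succ_lt_add_count s v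
    rwa [hcountP, hcountP, countP_lt_eq_countP_succ_lt_add_count t v, Nat.add_left_cancel_iff,
      eq_comm] at hstep

theorem domLT_of_excess_le {d : ℕ} {mu lam : d.Partition}
    (h : ∀ c, excess mu.parts c ≤ excess lam.parts c) (hne : mu ≠ lam) : DomLT mu lam :=
  ⟨domLE_iff_excess_le.2 h, fun h' => hne <| Nat.Partition.ext <|
    eq_of_excess_eq (zero_notMem_parts _) (zero_notMem_parts _) <|
      funext fun c => le_antisymm (h c) (domLE_iff_excess_le.1 h' c)⟩

theorem domLT_trans {d : ℕ} {mu nu lam : d.Partition} (h : DomLT mu nu) (h' : DomLT nu lam) :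
    DomLT mu lam :=
  ⟨fun k => (h.1 k).trans (h'.1 k), fun hle => h.2 fun k => (h'.1 k).trans (hle k)⟩

end Parts

/-! ### Monotonicity of the eigenvalues -/

section Eigenvalues

variable {s t : Multiset ℕ}

/-- The sum of `min x y` over the parts `x` of `s` and `y` of `t`. -/
def minSum (s t : Multiset ℕ) : ℕ := (s.map fun x => (t.map fun y => min x y).sum).sum

theorem minSum_comm (s t : Multiset ℕ) : minSum s t = minSum t s := by
  rw [minSum, Multiset.sum_map_sum_map]
  simp only [min_comm, minSum]

theorem sum_min_add_excess (t : Multiset ℕ) (x : ℕ) :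
    (t.map fun y => min x y).sum + excess t x = t.sum := by
  rw [excess, ← Multiset.sum_map_add]
  simp only [show ∀ y, min x y + (y - x) = y by omega, Multiset.map_id']

theorem minSum_le_minSum_right (hsum : s.sum = t.sum) (h : ∀ c, excess s c ≤ excess t c)
    (u : Multiset ℕ) : minSum u t ≤ minSum u s := by
  refine Multiset.sum_map_le_sum_map _ _ fun x _ => ?_
  have hs := sum_min_add_excess s x
  have ht := sum_min_add_excess t x
  have := h x
  omega

theorem mul_self_eq_add_two_mul_sum {x B : ℕ} (h : x ≤ B) :
    x * x = x + 2 * ∑ c ∈ Finset.range B, (x - (c + 1)) := by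
  induction B with
  | zero => simp [Nat.le_zero.1 h]
  | succ B ih =>
    rcases Nat.lt_or_ge B x with hx | hx
    · obtain rfl : x = B + 1 := le_antisymm h hx
      have hreflect := Finset.sum_range_reflect (fun i => i) (B + 1)
      rw [Finset.sum_congr rfl fun c _ => show B + 1 - (c + 1) = B + 1 - 1 - c by omega, hreflect,
        mul_comm 2, Finset.sum_range_id_mul_two, Nat.add_sub_cancel]
      ring
    · rw [ih hx, Finset.sum_range_succ]
      omega

theorem sum_mul_self_eq_sum_add_excess {B : ℕ} (h : ∀ x ∈ s, x ≤ B) :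
    (s.map fun x => x * x).sum = s.sum + 2 * ∑ c ∈ Finset.range B, excess s (c + 1) := by
  rw [Multiset.map_congr rfl fun x hx => mul_self_eq_add_two_mul_sum (h x hx),
    Multiset.sum_map_add, Multiset.map_id', Multiset.sum_map_mul_left]
  congr 2
  exact Multiset.sum_map_sum_map _ _

/-- The eigenvalue of the Laplace-Beltrami operator in terms of the multiset of parts. -/
def partsEigenval (α : ℝ) (s : Multiset ℕ) : ℝ :=
  α * ((s.map fun x => x * x).sum : ℕ) - (minSum s s : ℕ)

theorem eigenval_eq_partsEigenval (α : ℝ) (mu : Fin n → ℕ) :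
    eigenval α mu = partsEigenval α (partsOf mu) := by
  have hmin (x : ℕ) : ((partsOf mu).map fun y => min x y).sum = ∑ j, min x (mu j) :=
    sum_map_partsOf mu (Nat.min_zero x)
  simp only [partsEigenval, minSum, hmin]
  rw [sum_map_partsOf mu (g := fun x => x * x) (mul_zero 0), sum_map_partsOf mu (by simp),
    eigenval, Finset.sum_sub_distrib, ← Finset.mul_sum]
  push_cast
  simp only [sq]

theorem exists_lt_excess_succ_lt_of_domLT {d : ℕ} {mu lam : d.Partition} (h : DomLT mu lam) :
    ∃ c < d, excess mu.parts (c + 1) < excess lam.parts (c + 1) := by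
  obtain ⟨c, hc⟩ : ∃ c, excess mu.parts c < excess lam.parts c := by
    by_contra! hle
    exact h.2 (domLE_iff_excess_le.2 hle)
  rcases c with _ | c
  · rw [excess_zero_right, excess_zero_right, mu.parts_sum, lam.parts_sum] at hc
    exact absurd hc (lt_irrefl d)
  · refine ⟨c, ?_, hc⟩
    by_contra! hd
    rw [excess_eq_zero (s := lam.parts) fun x hx => (lam.le_of_mem_parts hx).trans
      (hd.trans c.le_succ)] at hc
    exact Nat.not_lt_zero _ hc

theorem sum_mul_self_lt_of_domLT {d : ℕ} {mu lam : d.Partition} (h : DomLT mu lam) :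
    (mu.parts.map fun x => x * x).sum < (lam.parts.map fun x => x * x).sum := by
  obtain ⟨c, hcd, hc⟩ := exists_lt_excess_succ_lt_of_domLT h
  have hexcess : ∑ c ∈ Finset.range d, excess mu.parts (c + 1) <
      ∑ c ∈ Finset.range d, excess lam.parts (c + 1) :=
    Finset.sum_lt_sum (fun c _ => domLE_iff_excess_le.1 h.1 (c + 1))
      ⟨c, Finset.mem_range.2 hcd, hc⟩
  rw [sum_mul_self_eq_sum_add_excess fun _ => mu.le_of_mem_parts,
    sum_mul_self_eq_sum_add_excess fun _ => lam.le_of_mem_parts, mu.parts_sum, lam.parts_sum]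
  omega

theorem partsEigenval_lt {α : ℝ} (hα : 0 < α) {d : ℕ} {mu lam : d.Partition}
    (h : DomLT mu lam) : partsEigenval α mu.parts < partsEigenval α lam.parts := by
  have hle := minSum_le_minSum_right (mu.parts_sum.trans lam.parts_sum.symm)
    (domLE_iff_excess_le.1 h.1)
  have hmin : minSum lam.parts lam.parts ≤ minSum mu.parts mu.parts :=
    (hle lam.parts).trans (minSum_comm lam.parts mu.parts ▸ hle mu.parts)
  have hsq := mul_lt_mul_of_pos_left (Nat.cast_lt.2 (sum_mul_self_lt_of_domLT h)) hα
  exact (sub_lt_sub_right hsq _).trans_le (sub_le_sub_left (Nat.cast_le.2 hmin) _)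

end Eigenvalues

/-! ### Monomial symmetric functions -/

section MonomialSymmetric

theorem ofSym_parts {d : ℕ} (a : Sym (Fin n) d) :
    (Nat.Partition.ofSym a).parts = partsOf fun k => (a : Multiset (Fin n)).count k := by
  have hdedup : (Finset.univ.val.filter fun k => (a : Multiset (Fin n)).count k ≠ 0) =
      (a : Multiset (Fin n)).dedup :=
    (Multiset.Nodup.ext (Finset.univ.nodup.filter _) (Multiset.nodup_dedup _)).2 fun k => by simp
  rw [partsOf, Multiset.filter_map]
  exact congrArg (Multiset.map fun k => (a : Multiset (Fin n)).count k) hdedup.symm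

theorem prod_map_X_eq_monomial {σ R : Type*} [DecidableEq σ] [CommSemiring R] (s : Multiset σ) :
    (s.map (X : σ → MvPolynomial σ R)).prod = monomial (Multiset.toFinsupp s) 1 := by
  induction s using Multiset.induction_on with
  | empty => simp
  | cons a s ih =>
    rw [Multiset.map_cons, Multiset.prod_cons, ih, ← Multiset.singleton_add, map_add,
      Multiset.toFinsupp_singleton, X, monomial_mul, one_mul]

theorem coeff_msymm {d : ℕ} (lam : d.Partition) (k : Fin n →₀ ℕ) :
    coeff k (msymm (Fin n) ℝ lam) = if partsOf k = lam.parts then 1 else 0 := by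
  simp only [msymm, prod_map_X_eq_monomial, coeff_sum, coeff_monomial]
  split_ifs with h
  · have hcard : Multiset.card (Finsupp.toMultiset k) = d := by
      rw [Finsupp.card_toMultiset, Finsupp.sum_fintype _ _ fun _ => rfl]
      exact (sum_partsOf k).symm.trans (h ▸ lam.parts_sum)
    have hparts : Nat.Partition.ofSym (Sym.mk (Finsupp.toMultiset k) hcard) = lam := by
      refine Nat.Partition.ext ((ofSym_parts _).trans (Eq.trans ?_ h))
      exact congrArg partsOf (funext (Finsupp.count_toMultiset k))
    rw [Finset.sum_eq_single ⟨Sym.mk (Finsupp.toMultiset k) hcard, hparts⟩]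
    · exact if_pos (Finsupp.toMultiset_toFinsupp k)
    · intro b _ hb
      refine if_neg fun e => hb (Subtype.ext (Subtype.ext ?_))
      exact (Multiset.toFinsupp_toMultiset _).symm.trans (congrArg Finsupp.toMultiset e)
    · exact fun hmem => absurd (Finset.mem_univ _) hmem
  · refine Finset.sum_eq_zero fun b _ => if_neg fun e => h ?_
    rw [← b.2, ofSym_parts, ← e]
    rfl

/-- The coefficient of `m_t` in the product `p_k m_s`. -/
def pieriCoeff (k : ℕ) (s t : Multiset ℕ) : ℕ :=
  (t.map fun v =>
    if k ≤ v ∧ t.erase v + ({v - k} : Multiset ℕ).filter (· ≠ 0) = s then 1 else 0).sum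

/-- `M` is the monomial symmetric function of the multiset of parts `s`. -/
def IsSymMon (s : Multiset ℕ) (M : SymFun) : Prop :=
  ∀ (n : ℕ) (l : Fin n →₀ ℕ), coeff l (toVars n M) = if partsOf l = s then 1 else 0

theorem toVars_X (n : ℕ) (k : ℕ+) : toVars n (X k) = psum (Fin n) ℝ k := by
  rw [toVars, aeval_X]

theorem coeff_toVars_X_mul {k : ℕ+} {s : Multiset ℕ} {M : SymFun} (hM : IsSymMon s M)
    (l : Fin n →₀ ℕ) : coeff l (toVars n (X k * M)) = pieriCoeff k s (partsOf l) := by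
  have hk : ¬ (k : ℕ) ≤ 0 := k.pos.not_ge
  have herase (i : Fin n) : partsOf (l - Finsupp.single i (k : ℕ) : Fin n →₀ ℕ) =
      (partsOf l).erase (l i) + ({l i - k} : Multiset ℕ).filter (· ≠ 0) := by
    rw [← partsOf_update]
    congr 1
    ext j
    rcases eq_or_ne j i with rfl | hj
    · simp
    · simp [hj]
  rw [pieriCoeff, sum_map_partsOf l (by simp [hk]), map_mul, toVars_X, psum, Finset.sum_mul,
    coeff_sum, Nat.cast_sum]
  refine Finset.sum_congr rfl fun i _ => ?_
  rw [X_pow_eq_monomial, coeff_monomial_mul']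
  by_cases h : (k : ℕ) ≤ l i
  · rw [if_pos (Finsupp.single_le_iff.2 h), one_mul, hM, herase]
    simp [h]
  · rw [if_neg (mt Finsupp.single_le_iff.1 h), if_neg fun hs => h hs.1, Nat.cast_zero]

theorem eq_of_pieriCoeff_ne_zero {k : ℕ} {s t : Multiset ℕ} (h : pieriCoeff k s t ≠ 0) :
    t = k ::ₘ s ∨ ∃ w ∈ s, t = (w + k) ::ₘ s.erase w := by
  rw [pieriCoeff, Ne, Multiset.sum_eq_zero_iff] at h
  push Not at h
  obtain ⟨_, hmem, hne⟩ := h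
  obtain ⟨v, hv, rfl⟩ := Multiset.mem_map.1 hmem
  obtain ⟨hkv, hs⟩ := of_not_not (mt (fun hneg => if_neg hneg) hne)
  rcases hkv.eq_or_lt with rfl | hlt
  · left
    rw [Nat.sub_self, Multiset.filter_singleton, if_neg (by simp), Multiset.empty_eq_zero,
      add_zero] at hs
    rw [← hs, Multiset.cons_erase hv]
  · right
    rw [Multiset.filter_singleton, if_pos (Nat.sub_ne_zero_of_lt hlt), add_comm,
      Multiset.singleton_add] at hs
    refine ⟨v - k, hs ▸ Multiset.mem_cons_self _ _, ?_⟩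
    rw [← hs, Multiset.erase_cons_head, Nat.sub_add_cancel hkv, Multiset.cons_erase hv]

theorem pieriCoeff_cons_ne_zero (k : ℕ) (s : Multiset ℕ) : pieriCoeff k s (k ::ₘ s) ≠ 0 := by
  rw [pieriCoeff, Multiset.map_cons, Multiset.sum_cons, if_pos (by simp)]
  omega

theorem isSymMon_zero_one : IsSymMon 0 1 := fun n l => by
  rw [map_one, coeff_one]
  exact if_congr (by rw [partsOf_eq_zero, Finsupp.coe_eq_zero, eq_comm]) rfl rfl

/-- The multisets obtained from `s` by adding `k` to one of its elements. -/
def raisings (k : ℕ) (s : Multiset ℕ) : Finset (Multiset ℕ) :=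
  s.toFinset.image fun w => (w + k) ::ₘ s.erase w

theorem mem_raisings {k : ℕ} {s t : Multiset ℕ} :
    t ∈ raisings k s ↔ ∃ w ∈ s, (w + k) ::ₘ s.erase w = t := by
  simp only [raisings, Finset.mem_image, Multiset.mem_toFinset]

theorem card_of_mem_raisings {k : ℕ} {s t : Multiset ℕ} (h : t ∈ raisings k s) :
    t.card = s.card := by
  obtain ⟨w, hw, rfl⟩ := mem_raisings.1 h
  rw [Multiset.card_cons, Multiset.card_erase_add_one hw]

theorem zero_notMem_of_mem_raisings {k : ℕ+} {s t : Multiset ℕ} (hs : 0 ∉ s)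
    (h : t ∈ raisings k s) : 0 ∉ t := by
  obtain ⟨w, -, rfl⟩ := mem_raisings.1 h
  rw [Multiset.mem_cons, not_or]
  exact ⟨(Nat.add_pos_right w k.pos).ne, fun h0 => hs (Multiset.mem_of_mem_erase h0)⟩

theorem isSymMon_cons {k : ℕ+} {s : Multiset ℕ} {M : SymFun} {N : Multiset ℕ → SymFun}
    (hM : IsSymMon s M) (hN : ∀ t ∈ raisings k s, IsSymMon t (N t)) :
    IsSymMon ((k : ℕ) ::ₘ s) ((pieriCoeff k s (k ::ₘ s) : ℝ)⁻¹ •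
      (X k * M - ∑ t ∈ raisings k s, (pieriCoeff k s t : ℝ) • N t)) := by
  intro n l
  have hlead : (k : ℕ) ::ₘ s ∉ raisings k s := fun h => by
    simpa using card_of_mem_raisings h
  have hsum : ∑ t ∈ raisings k s, coeff l (toVars n ((pieriCoeff k s t : ℝ) • N t)) =
      if partsOf l ∈ raisings k s then (pieriCoeff k s (partsOf l) : ℝ) else 0 := by
    rw [← Finset.sum_ite_eq _ _ fun t => (pieriCoeff k s t : ℝ)]
    refine Finset.sum_congr rfl fun t ht => ?_
    rw [map_smul, coeff_smul, hN t ht, smul_eq_mul, mul_ite, mul_one, mul_zero]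
  rw [map_smul, map_sub, coeff_smul, coeff_sub, coeff_toVars_X_mul hM, map_sum, coeff_sum, hsum,
    smul_eq_mul]
  split_ifs with hmem hcons hcons
  · exact absurd (hcons ▸ hmem) hlead
  · rw [sub_self, mul_zero]
  · rw [hcons, sub_zero, inv_mul_cancel₀ (Nat.cast_ne_zero.2 (pieriCoeff_cons_ne_zero k s))]
  · have hzero : pieriCoeff k s (partsOf l) = 0 := by
      by_contra hne
      rcases eq_of_pieriCoeff_ne_zero hne with h | ⟨w, hw, h⟩
      · exact hcons h
      · exact hmem (mem_raisings.2 ⟨w, hw, h.symm⟩)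
    rw [hzero, Nat.cast_zero, sub_zero, mul_zero]

theorem exists_isSymMon {s : Multiset ℕ} (hs : 0 ∉ s) : ∃ M, IsSymMon s M := by
  induction hc : s.card generalizing s with
  | zero =>
    rw [Multiset.card_eq_zero.1 hc]
    exact ⟨_, isSymMon_zero_one⟩
  | succ c ih =>
    obtain ⟨k, s, rfl, hcard⟩ := Multiset.card_eq_succ_iff.1 hc
    rw [Multiset.mem_cons, not_or] at hs
    lift k to ℕ+ using Nat.pos_of_ne_zero fun h => hs.1 h.symm
    obtain ⟨M, hM⟩ := ih hs.2 hcard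
    have hraise : ∀ t ∈ raisings k s, ∃ N, IsSymMon t N := fun t ht =>
      ih (zero_notMem_of_mem_raisings hs.2 ht) ((card_of_mem_raisings ht).trans hcard)
    choose! N hN using hraise
    exact ⟨_, isSymMon_cons hM hN⟩

/-- The monomial symmetric function `m_lam`. -/
def symMon {d : ℕ} (lam : d.Partition) : SymFun :=
  (exists_isSymMon (zero_notMem_parts lam)).choose

theorem toVars_symMon {d : ℕ} (lam : d.Partition) (n : ℕ) :
    toVars n (symMon lam) = msymm (Fin n) ℝ lam := by
  ext l
  rw [coeff_msymm]
  exact (exists_isSymMon (zero_notMem_parts lam)).choose_spec n l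

end MonomialSymmetric

/-! ### Coefficients -/

section Coefficients

variable {α : ℝ} {mu nu : Fin n → ℕ} {k : Fin n →₀ ℕ}

/-- The exponent of the squarefree monomial `xMon mu`. -/
def supportExp (mu : Fin n → ℕ) : Fin n →₀ ℕ := Finsupp.equivFunOnFinite.symm (mu ⊓ 1)

theorem supportExp_apply (mu : Fin n → ℕ) (i : Fin n) : supportExp mu i = min (mu i) 1 := rfl

theorem xMon_eq_monomial (mu : Fin n → ℕ) : xMon mu = monomial (supportExp mu) 1 := by
  rw [monomial_eq, map_one, one_mul, Finsupp.prod_fintype _ _ fun _ => pow_zero _, xMon,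
    Finset.prod_filter]
  refine Finset.prod_congr rfl fun i _ => ?_
  rw [supportExp_apply]
  split_ifs with hi
  · rw [min_eq_right hi, pow_one]
  · rw [Nat.eq_zero_of_not_pos hi, Nat.zero_min, pow_zero]

theorem coeff_kzPoly (α : ℝ) (mu : Fin n → ℕ) (k : Fin n →₀ ℕ) [Decidable (supportExp mu ≤ k)] :
    coeff k (kzPoly α mu) = if supportExp mu ≤ k then
      stepSum α (fun nu => coeff (k - supportExp mu) (kzPoly α nu)) mu else 0 := by
  rw [kzPoly_eq, xMon_eq_monomial, coeff_monomial_mul', one_mul, stepSum, stepSum, coeff_sum]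
  simp only [coeff_smul]

theorem supportExp_le_of_coeff_kzPoly_ne_zero (h : coeff k (kzPoly α mu) ≠ 0) :
    supportExp mu ≤ k := by
  classical
  rw [coeff_kzPoly] at h
  exact (ite_ne_right_iff.1 h).1

theorem exists_coeff_kzPoly_ne_zero (h : coeff k (kzPoly α mu) ≠ 0) :
    ∃ nu ∈ orbit (mu - 1), coeff (k - supportExp mu) (kzPoly α nu) ≠ 0 := by
  classical
  have hle := supportExp_le_of_coeff_kzPoly_ne_zero h
  rw [coeff_kzPoly, if_pos hle] at h
  obtain ⟨nu, hnu, hne⟩ := Finset.exists_ne_zero_of_sum_ne_zero h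
  exact ⟨nu, hnu, right_ne_zero_of_mul hne⟩

theorem sum_eq_of_coeff_kzPoly_ne_zero (h : coeff k (kzPoly α mu) ≠ 0) :
    ∑ i, k i = ∑ i, mu i := by
  classical
  induction mu using stepInduction generalizing k with
  | zero =>
    rw [kzPoly_zero, coeff_one] at h
    rw [← (ite_ne_right_iff.1 h).1]
    rfl
  | step mu ih =>
    have hle := supportExp_le_of_coeff_kzPoly_ne_zero h
    obtain ⟨nu, hnu, hne⟩ := exists_coeff_kzPoly_ne_zero h
    have hsplit (l : Fin n → ℕ) (hl : ∀ i, supportExp mu i ≤ l i) :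
        ∑ i, l i = ∑ i, (l i - supportExp mu i) + ∑ i, supportExp mu i := by
      rw [← Finset.sum_add_distrib]
      exact Finset.sum_congr rfl fun i _ => (Nat.sub_add_cancel (hl i)).symm
    rw [hsplit k hle, hsplit mu fun i => min_le_left _ _]
    refine congrArg (· + _) ((ih nu hnu hne).trans ?_)
    rw [sum_comp_of_mem_orbit hnu fun v => v]
    exact Finset.sum_congr rfl fun i _ => by
      rw [Pi.sub_apply, Pi.one_apply, supportExp_apply]; omega

theorem excess_le_of_coeff_kzPoly_ne_zero (h : coeff k (kzPoly α mu) ≠ 0) (c : ℕ) :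
    excess (partsOf k) c ≤ excess (partsOf mu) c := by
  classical
  simp only [excess_partsOf]
  induction c generalizing mu k with
  | zero => exact (sum_eq_of_coeff_kzPoly_ne_zero h).le
  | succ c ih =>
    obtain ⟨nu, hnu, hne⟩ := exists_coeff_kzPoly_ne_zero h
    calc ∑ i, (k i - (c + 1)) ≤ ∑ i, ((k - supportExp mu) i - c) :=
          Finset.sum_le_sum fun i _ => by
            rw [Finsupp.tsub_apply, supportExp_apply]; omega
      _ ≤ ∑ i, (nu i - c) := ih hne
      _ = ∑ i, ((mu - 1) i - c) := sum_comp_of_mem_orbit hnu fun v => v - c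
      _ = ∑ i, (mu i - (c + 1)) := Finset.sum_congr rfl fun i _ => by
            rw [Pi.sub_apply, Pi.one_apply, Nat.sub_sub, add_comm]

theorem eq_of_le_of_mem_orbit (h : nu ∈ orbit mu) (hle : nu ≤ mu) : nu = mu :=
  funext fun i => (Finset.sum_eq_sum_iff_of_le fun i _ => hle i).1
    (sum_comp_of_mem_orbit h fun v => v) i (Finset.mem_univ i)

theorem inf_one_mem_orbit (h : nu ∈ orbit mu) : nu ⊓ 1 ∈ orbit (mu ⊓ 1) := by
  obtain ⟨s, rfl⟩ := mem_orbit.1 h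
  exact mem_orbit.2 ⟨s, rfl⟩

theorem sub_one_mem_orbit (h : nu ∈ orbit mu) : nu - 1 ∈ orbit (mu - 1) := by
  obtain ⟨s, rfl⟩ := mem_orbit.1 h
  exact mem_orbit.2 ⟨s, rfl⟩

theorem stepWeight_sub_one_self (α : ℝ) (mu : Fin n → ℕ) : stepWeight α mu (mu - 1) = 1 := by
  have hadm : Admissible mu (mu - 1) := fun i => by
    rw [Pi.sub_apply, Pi.one_apply]; omega
  have hdrop (a : ℕ) : dropCount mu (mu - 1) a = 0 := by
    rw [dropCount, Finset.card_eq_zero, Finset.filter_eq_empty_iff]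
    intro i _
    rw [Pi.sub_apply, Pi.one_apply]
    omega
  simp only [stepWeight, if_pos hadm, hdrop, Finset.Icc_eq_empty_of_lt zero_lt_one,
    Finset.prod_empty, Finset.prod_const_one]

theorem stepWeight_sub_one_of_ne (h : nu ∈ orbit mu) (hsupp : nu ⊓ 1 = mu ⊓ 1) (hne : nu ≠ mu) :
    stepWeight α mu (nu - 1) = 0 := by
  refine stepWeight_of_not_admissible fun hadm => hne (eq_of_le_of_mem_orbit h fun i => ?_)
  have hadmi := hadm i
  have hsuppi := congrFun hsupp i
  simp only [Pi.sub_apply, Pi.inf_apply, Pi.one_apply] at hadmi hsuppi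
  change nu i ≤ mu i
  omega

theorem coeff_kzPoly_of_mem_orbit (hk : ⇑k ∈ orbit mu) :
    coeff k (kzPoly α mu) = if ⇑k = mu then 1 else 0 := by
  classical
  induction mu using stepInduction generalizing k with
  | zero =>
    rw [kzPoly_zero, coeff_one]
    exact if_congr (by rw [eq_comm, Finsupp.coe_eq_zero]) rfl rfl
  | step mu ih =>
    by_cases hle : supportExp mu ≤ k
    · have hsupp : mu ⊓ 1 = ⇑k ⊓ 1 := by
        have hmem : mu ⊓ 1 ∈ orbit (⇑k ⊓ 1) := by
          rw [orbit_eq_of_mem (inf_one_mem_orbit hk)]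
          exact self_mem_orbit _
        exact eq_of_le_of_mem_orbit hmem (le_inf hle inf_le_right)
      have hstrip : ⇑(k - supportExp mu) = ⇑k - 1 := funext fun i => by
        have hi := congrFun hsupp i
        simp only [Pi.inf_apply, Pi.one_apply] at hi
        rw [Finsupp.tsub_apply, supportExp_apply, hi, Pi.sub_apply, Pi.one_apply]
        omega
      have hmem : ⇑k - 1 ∈ orbit (mu - 1) := sub_one_mem_orbit hk
      have hcoeff : ∀ nu ∈ orbit (mu - 1),
          coeff (k - supportExp mu) (kzPoly α nu) = if ⇑k - 1 = nu then 1 else 0 :=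
        fun nu hnu => by
          rw [ih nu hnu (by rwa [hstrip, orbit_eq_of_mem hnu]), hstrip]
      rw [coeff_kzPoly, if_pos hle, stepSum,
        Finset.sum_congr rfl fun nu hnu => congrArg _ (hcoeff nu hnu)]
      simp only [smul_eq_mul, mul_ite, mul_one, mul_zero, Finset.sum_ite_eq, if_pos hmem]
      split_ifs with hkmu
      · rw [hkmu, stepWeight_sub_one_self]
      · exact stepWeight_sub_one_of_ne hk hsupp.symm hkmu
    · rw [coeff_kzPoly, if_neg hle, if_neg]
      rintro rfl
      exact hle fun i => min_le_left _ _

theorem coeff_jackSum_of_mem_orbit (hk : ⇑k ∈ orbit mu) : coeff k (jackSum α mu) = 1 := by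
  have hcoeff : ∀ nu ∈ orbit mu, coeff k (kzPoly α nu) = if ⇑k = nu then 1 else 0 :=
    fun nu hnu => coeff_kzPoly_of_mem_orbit (by rwa [orbit_eq_of_mem hnu])
  rw [jackSum, coeff_sum, Finset.sum_congr rfl hcoeff, Finset.sum_ite_eq, if_pos hk]

theorem exists_coeff_kzPoly_ne_zero_of_coeff_jackSum_ne_zero (h : coeff k (jackSum α mu) ≠ 0) :
    ∃ nu, partsOf nu = partsOf mu ∧ coeff k (kzPoly α nu) ≠ 0 := by
  rw [jackSum, coeff_sum] at h
  obtain ⟨nu, hnu, hne⟩ := Finset.exists_ne_zero_of_sum_ne_zero h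
  exact ⟨nu, mem_orbit_iff.1 hnu, hne⟩

theorem sum_partsOf_eq_of_coeff_jackSum_ne_zero (h : coeff k (jackSum α mu) ≠ 0) :
    (partsOf k).sum = (partsOf mu).sum := by
  obtain ⟨nu, hnu, hne⟩ := exists_coeff_kzPoly_ne_zero_of_coeff_jackSum_ne_zero h
  rw [← hnu, sum_partsOf, sum_partsOf, sum_eq_of_coeff_kzPoly_ne_zero hne]

theorem excess_le_of_coeff_jackSum_ne_zero (h : coeff k (jackSum α mu) ≠ 0) (c : ℕ) :
    excess (partsOf k) c ≤ excess (partsOf mu) c := by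
  obtain ⟨nu, hnu, hne⟩ := exists_coeff_kzPoly_ne_zero_of_coeff_jackSum_ne_zero h
  rw [← hnu]
  exact excess_le_of_coeff_kzPoly_ne_zero hne c

theorem rename_jackSum (α : ℝ) (mu : Fin n → ℕ) (s : Equiv.Perm (Fin n)) :
    rename s (jackSum α mu) = jackSum α mu := by
  simp only [jackSum, map_sum, rename_kzPoly]
  exact sum_orbit_permComp mu s _

theorem jackSum_congr (h : partsOf mu = partsOf nu) : jackSum α mu = jackSum α nu := by
  rw [jackSum, jackSum, orbit_eq_of_mem (mem_orbit_iff.2 h)]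

theorem coeff_jackSum_congr {l : Fin n →₀ ℕ} (h : partsOf k = partsOf l) :
    coeff k (jackSum α mu) = coeff l (jackSum α mu) := by
  obtain ⟨s, hs⟩ := mem_orbit.1 (mem_orbit_iff.2 h)
  have hk : k = l.mapDomain s := Finsupp.ext fun i => by
    rw [← hs, Finsupp.mapDomain_equiv_apply]
    rfl
  rw [hk, ← coeff_rename_mapDomain s s.injective (jackSum α mu) l, rename_jackSum]

end Coefficients

/-! ### Stability in the number of variables -/

section Stability

variable {m : ℕ} {α : ℝ} {mu nu : Fin n → ℕ} {e : Fin n ↪ Fin m} {i : Fin m}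

/-- The composition obtained from `mu` by relocating its entries along `e` and padding with zeros;
it compares polynomials in `n` and in `m` variables. -/
def extendZero (e : Fin n ↪ Fin m) (mu : Fin n → ℕ) : Fin m → ℕ := Function.extend e mu 0

theorem extendZero_apply (e : Fin n ↪ Fin m) (mu : Fin n → ℕ) (k : Fin n) :
    extendZero e mu (e k) = mu k :=
  e.injective.extend_apply _ _ _

theorem extendZero_of_notMem_range (hi : i ∉ Set.range e) (mu : Fin n → ℕ) :
    extendZero e mu i = 0 :=
  Function.extend_apply' _ _ _ hi

theorem extendZero_zero (e : Fin n ↪ Fin m) : extendZero e 0 = 0 := Function.extend_zero e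

theorem extendZero_sub_one (e : Fin n ↪ Fin m) (mu : Fin n → ℕ) :
    extendZero e mu - 1 = extendZero e (mu - 1) := by
  funext i
  by_cases hi : i ∈ Set.range e
  · obtain ⟨k, rfl⟩ := hi
    rw [Pi.sub_apply, extendZero_apply, extendZero_apply]
    rfl
  · rw [Pi.sub_apply, extendZero_of_notMem_range hi, extendZero_of_notMem_range hi, Nat.zero_sub]

theorem extendZero_injective (e : Fin n ↪ Fin m) : Function.Injective (extendZero e) :=
  fun mu nu h => funext fun k => by rw [← extendZero_apply e mu, h, extendZero_apply]

theorem card_filter_comp_embedding {ι κ : Type*} [Fintype ι] [Fintype κ] (e : ι ↪ κ) {p : κ → Prop}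
    [DecidablePred p] (hp : ∀ i, p i → i ∈ Set.range e) : #{k | p (e k)} = #{i | p i} := by
  rw [← Finset.card_map e]
  congr 1
  ext i
  simp only [Finset.mem_map, Finset.mem_filter, Finset.mem_univ, true_and]
  refine ⟨?_, fun hi => ?_⟩
  · rintro ⟨k, hk, rfl⟩
    exact hk
  · obtain ⟨k, rfl⟩ := hp i hi
    exact ⟨k, hi, rfl⟩

theorem mem_range_of_extendZero_ne_zero (h : extendZero e mu i ≠ 0) : i ∈ Set.range e :=
  not_imp_comm.1 (fun hi => extendZero_of_notMem_range hi mu) h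

theorem partsOf_extendZero (e : Fin n ↪ Fin m) (mu : Fin n → ℕ) :
    partsOf (extendZero e mu) = partsOf mu := by
  ext v
  by_cases hv : v = 0
  · rw [hv, Multiset.count_eq_zero_of_notMem (zero_notMem_partsOf _),
      Multiset.count_eq_zero_of_notMem (zero_notMem_partsOf _)]
  · rw [partsOf, partsOf, Multiset.count_filter_of_pos (p := (· ≠ 0)) hv,
      Multiset.count_filter_of_pos (p := (· ≠ 0)) hv, Multiset.count_map, Multiset.count_map]
    have hcard := card_filter_comp_embedding e (p := fun i => v = extendZero e mu i) fun i hi =>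
      mem_range_of_extendZero_ne_zero (hi ▸ hv)
    simp only [extendZero_apply] at hcard
    exact hcard.symm

theorem forall_extendZero_iff {p : ℕ → ℕ → Prop} (h0 : p 0 0) :
    (∀ i, p (extendZero e mu i) (extendZero e nu i)) ↔ ∀ k, p (mu k) (nu k) := by
  refine ⟨fun h k => by simpa only [extendZero_apply] using h (e k), fun h i => ?_⟩
  by_cases hi : i ∈ Set.range e
  · obtain ⟨k, rfl⟩ := hi
    simpa only [extendZero_apply] using h k
  · rwa [extendZero_of_notMem_range hi, extendZero_of_notMem_range hi]

theorem largestPart_extendZero (e : Fin n ↪ Fin m) (mu : Fin n → ℕ) :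
    largestPart (extendZero e mu) = largestPart mu :=
  le_antisymm
    (largestPart_le ((forall_extendZero_iff (nu := mu) (p := fun a _ => a ≤ largestPart mu)
      (Nat.zero_le _)).2 (le_largestPart mu)))
    (largestPart_le fun k => extendZero_apply e mu k ▸ le_largestPart _ (e k))

theorem stepWeight_extendZero (α : ℝ) (e : Fin n ↪ Fin m) (mu nu : Fin n → ℕ) :
    stepWeight α (extendZero e mu) (extendZero e nu) = stepWeight α mu nu := by
  have hadm : Admissible (extendZero e mu) (extendZero e nu) ↔ Admissible mu nu :=
    forall_extendZero_iff (p := fun a b => a = 0 ∨ b < a) (Or.inl rfl)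
  have hdrop (a : ℕ) : dropCount (extendZero e mu) (extendZero e nu) a = dropCount mu nu a := by
    rw [dropCount, ← card_filter_comp_embedding e fun i hi =>
      mem_range_of_extendZero_ne_zero (mu := mu) (by omega)]
    simp only [extendZero_apply, dropCount]
  have hbelow (a : ℕ) : numPartsBelow (extendZero e mu) a = numPartsBelow mu a := by
    rw [numPartsBelow, ← card_filter_comp_embedding e fun i hi =>
      mem_range_of_extendZero_ne_zero hi.1.ne']
    simp only [extendZero_apply, numPartsBelow]
  simp only [stepWeight, hadm, hdrop, hbelow, largestPart_extendZero]

theorem sum_orbit_extendZero {M : Type*} [AddCommMonoid M] (e : Fin n ↪ Fin m) (mu : Fin n → ℕ)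
    {g : (Fin m → ℕ) → M} (hg : ∀ nu, ∀ i ∉ Set.range e, nu i ≠ 0 → g nu = 0) :
    ∑ nu ∈ orbit (extendZero e mu), g nu = ∑ nu ∈ orbit mu, g (extendZero e nu) := by
  rw [← Finset.sum_image (f := g) fun _ _ _ _ h => extendZero_injective e h]
  refine (Finset.sum_subset (fun nu hnu => ?_) fun nu hnu hnotMem => ?_).symm
  · obtain ⟨k, hk, rfl⟩ := Finset.mem_image.1 hnu
    rw [mem_orbit_iff, partsOf_extendZero, partsOf_extendZero]
    exact mem_orbit_iff.1 hk
  · by_contra hne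
    have hnu' : extendZero e (nu ∘ e) = nu := funext fun i => by
      by_cases hi : i ∈ Set.range e
      · obtain ⟨k, rfl⟩ := hi
        exact extendZero_apply e _ k
      · rw [extendZero_of_notMem_range hi]
        exact (not_imp_comm.1 (hg nu i hi) hne).symm
    refine hnotMem (Finset.mem_image.2 ⟨nu ∘ e, ?_, hnu'⟩)
    rw [← hnu', mem_orbit_iff, partsOf_extendZero, partsOf_extendZero] at hnu
    exact mem_orbit_iff.2 hnu

theorem rename_embedding_xMon (e : Fin n ↪ Fin m) (mu : Fin n → ℕ) :
    rename e (xMon mu) = xMon (extendZero e mu) := by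
  have hmap : ({i | 0 < extendZero e mu i} : Finset (Fin m)) =
      ({k | 0 < mu k} : Finset (Fin n)).map e := by
    ext i
    simp only [Finset.mem_map, Finset.mem_filter, Finset.mem_univ, true_and]
    refine ⟨fun hi => ?_, ?_⟩
    · obtain ⟨k, rfl⟩ := mem_range_of_extendZero_ne_zero hi.ne'
      exact ⟨k, by rwa [extendZero_apply] at hi, rfl⟩
    · rintro ⟨k, hk, rfl⟩
      rwa [extendZero_apply]
  rw [xMon, xMon, hmap, Finset.prod_map, map_prod]
  simp only [rename_X]

theorem killCompl_X_of_notMem_range (hi : i ∉ Set.range e) :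
    killCompl e.injective (X i : MvPolynomial (Fin m) ℝ) = 0 := by
  rw [killCompl, aeval_X, dif_neg hi]

theorem killCompl_kzPoly_eq_zero (α : ℝ) {nu : Fin m → ℕ} (hi : i ∉ Set.range e)
    (hnu : nu i ≠ 0) : killCompl e.injective (kzPoly α nu) = 0 := by
  have hmem : i ∈ ({i | 0 < nu i} : Finset (Fin m)) :=
    Finset.mem_filter.2 ⟨Finset.mem_univ i, Nat.pos_of_ne_zero hnu⟩
  rw [kzPoly_eq, map_mul, xMon, map_prod,
    Finset.prod_eq_zero hmem (killCompl_X_of_notMem_range hi), zero_mul]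

theorem killCompl_kzPoly_extendZero (α : ℝ) (e : Fin n ↪ Fin m) (mu : Fin n → ℕ) :
    killCompl e.injective (kzPoly α (extendZero e mu)) = kzPoly α mu := by
  induction mu using stepInduction with
  | zero => rw [extendZero_zero, kzPoly_zero, kzPoly_zero, map_one]
  | step mu ih =>
    rw [kzPoly_eq, kzPoly_eq, map_mul, ← rename_embedding_xMon, killCompl_rename_app, stepSum,
      stepSum, map_sum, extendZero_sub_one, sum_orbit_extendZero]
    · refine congrArg _ (Finset.sum_congr rfl fun nu hnu => ?_)
      rw [map_smul, stepWeight_extendZero, ih nu hnu]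
    · intro nu i hi hnu
      rw [map_smul, killCompl_kzPoly_eq_zero α hi hnu, smul_zero]

theorem killCompl_jackSum_extendZero (α : ℝ) (e : Fin n ↪ Fin m) (mu : Fin n → ℕ) :
    killCompl e.injective (jackSum α (extendZero e mu)) = jackSum α mu := by
  rw [jackSum, map_sum, sum_orbit_extendZero e mu fun nu i => killCompl_kzPoly_eq_zero α]
  exact Finset.sum_congr rfl fun nu _ => killCompl_kzPoly_extendZero α e nu

theorem coe_mapDomain_eq_extendZero (e : Fin n ↪ Fin m) (k : Fin n →₀ ℕ) :
    ⇑(k.mapDomain e) = extendZero e k := by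
  funext i
  by_cases hi : i ∈ Set.range e
  · obtain ⟨l, rfl⟩ := hi
    rw [Finsupp.mapDomain_apply e.injective, extendZero_apply]
  · rw [Finsupp.mapDomain_of_notMem_range k i hi, extendZero_of_notMem_range hi]

theorem coeff_jackSum_eq_of_partsOf_eq {nu : Fin m → ℕ} {k : Fin n →₀ ℕ} {l : Fin m →₀ ℕ}
    (hmu : partsOf mu = partsOf nu) (hk : partsOf k = partsOf l) :
    coeff k (jackSum α mu) = coeff l (jackSum α nu) := by
  rw [← killCompl_jackSum_extendZero α (Fin.castAddEmb m) mu, coeff_killCompl,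
    ← killCompl_jackSum_extendZero α (Fin.natAddEmb n) nu, coeff_killCompl,
    jackSum_congr (mu := extendZero (Fin.castAddEmb m) mu) (nu := extendZero (Fin.natAddEmb n) nu)]
  · exact coeff_jackSum_congr (by
      rw [coe_mapDomain_eq_extendZero, coe_mapDomain_eq_extendZero, partsOf_extendZero,
        partsOf_extendZero, hk])
  · rw [partsOf_extendZero, partsOf_extendZero, hmu]

theorem killCompl_toVars (e : Fin n ↪ Fin m) (f : SymFun) :
    killCompl e.injective (toVars m f) = toVars n f := by
  suffices h : (killCompl e.injective).comp (toVars m) = toVars n from AlgHom.congr_fun h f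
  refine algHom_ext fun k => ?_
  rw [AlgHom.comp_apply, toVars_X, toVars_X, psum, psum, map_sum,
    ← Finset.sum_subset (Finset.subset_univ (Finset.univ.map e)), Finset.sum_map]
  · refine Finset.sum_congr rfl fun i _ => ?_
    rw [map_pow, ← rename_X, killCompl_rename_app]
  · intro i _ hi
    rw [map_pow, killCompl_X_of_notMem_range (by simpa using hi), zero_pow k.pos.ne']

end Stability

/-! ### The Jack symmetric functions -/

section JackSymmetric

variable {α : ℝ} {d : ℕ} {lam mu kap : d.Partition}

theorem card_parts_le (lam : d.Partition) : lam.parts.card ≤ d := by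
  have h := Multiset.card_nsmul_le_sum (s := lam.parts) (a := 1) fun x hx => lam.parts_pos hx
  rwa [lam.parts_sum, smul_eq_mul, mul_one] at h

/-- The partitions strictly below `lam` in the dominance order. -/
abbrev Below (lam : d.Partition) : Type := {kap : d.Partition // DomLT kap lam}

instance (lam : d.Partition) : Fintype (Below lam) := Fintype.ofFinite _

open Classical in
theorem sum_below {M : Type*} [AddCommMonoid M] (g : d.Partition → M) :
    ∑ kap : Below lam, g kap.1 = ∑ kap with DomLT kap lam, g kap :=
  (Finset.sum_subtype _ (fun _ => Finset.mem_filter_univ _) g).symm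

/-- The combination of monomial symmetric functions with leading term that of `lam` and
coefficients `c` below it. -/
def monicSum (lam : d.Partition) (c : Below lam → ℝ) : SymFun :=
  symMon lam + ∑ kap, c kap • symMon kap.1

/-- A composition of length `d` whose nonzero entries are the parts of the partition `lam` of `d`;
the order of the entries is an arbitrary choice. -/
def compOf (lam : d.Partition) : Fin d → ℕ :=
  (exists_partsOf_eq (zero_notMem_parts lam) (card_parts_le lam)).choose

theorem partsOf_compOf (lam : d.Partition) : partsOf (compOf lam) = lam.parts :=
  (exists_partsOf_eq (zero_notMem_parts lam) (card_parts_le lam)).choose_spec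

/-- The coefficient of the monomial symmetric function of `kap` in the Jack symmetric function
of `lam`, read off in `d` variables. -/
def jackSymCoeff (α : ℝ) (lam kap : d.Partition) : ℝ :=
  coeff (Finsupp.equivFunOnFinite.symm (compOf kap)) (jackSum α (compOf lam))

/-- The Jack symmetric function of `lam`, whose restriction to any sufficiently large number of
variables is given by the sum formula `jackSum`. -/
def jackSym (α : ℝ) (lam : d.Partition) : SymFun := ∑ kap, jackSymCoeff α lam kap • symMon kap

theorem toVars_jackSym (α : ℝ) {nu : Fin n → ℕ} (hnu : partsOf nu = lam.parts) :
    toVars n (jackSym α lam) = jackSum α nu := by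
  ext k
  simp only [jackSym, map_sum, coeff_sum, map_smul, toVars_symMon, coeff_smul, coeff_msymm,
    smul_eq_mul, mul_ite, mul_one, mul_zero]
  by_cases hk : (partsOf k).sum = d
  · let kap : d.Partition := ⟨partsOf k, fun {i} hi => Nat.pos_of_ne_zero fun h =>
      zero_notMem_partsOf k (h ▸ hi), hk⟩
    rw [Finset.sum_eq_single_of_mem kap (Finset.mem_univ _) fun kap' _ hne =>
      if_neg fun h => hne (Nat.Partition.ext h.symm), if_pos rfl]
    exact coeff_jackSum_eq_of_partsOf_eq ((partsOf_compOf lam).trans hnu.symm) (partsOf_compOf kap)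
  · rw [Finset.sum_eq_zero fun kap _ => if_neg fun h => hk <| by
      rw [h, kap.parts_sum]]
    by_contra hne
    exact hk ((sum_partsOf_eq_of_coeff_jackSum_ne_zero (Ne.symm hne)).trans
      (hnu ▸ lam.parts_sum))

theorem jackSymCoeff_self (α : ℝ) (lam : d.Partition) : jackSymCoeff α lam lam = 1 :=
  coeff_jackSum_of_mem_orbit (self_mem_orbit _)

theorem domLT_of_jackSymCoeff_ne_zero (h : jackSymCoeff α lam kap ≠ 0) (hne : kap ≠ lam) :
    DomLT kap lam := by
  refine domLT_of_excess_le (fun c => ?_) hne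
  rw [← partsOf_compOf kap, ← partsOf_compOf lam]
  exact excess_le_of_coeff_jackSum_ne_zero h c

theorem jackSym_eq_monicSum (α : ℝ) (lam : d.Partition) :
    jackSym α lam = monicSum lam fun kap => jackSymCoeff α lam kap.1 := by
  classical
  rw [jackSym, ← Finset.add_sum_erase _ _ (Finset.mem_univ lam), jackSymCoeff_self, one_smul,
    monicSum, sum_below fun kap => jackSymCoeff α lam kap • symMon kap]
  refine congrArg _ (Finset.sum_subset (fun kap hkap => ?_) fun kap hkap hnot => ?_).symm
  · refine Finset.mem_erase.2 ⟨?_, Finset.mem_univ _⟩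
    rintro rfl
    have hlt := (Finset.mem_filter.1 hkap).2
    exact hlt.2 hlt.1
  · by_contra h
    exact hnot (Finset.mem_filter.2 ⟨Finset.mem_univ _,
      domLT_of_jackSymCoeff_ne_zero (left_ne_zero_of_smul h) (Finset.ne_of_mem_erase hkap)⟩)

theorem exists_forall_ge_mem_supported (f : SymFun) :
    ∃ D₀ : ℕ+, ∀ D ≥ D₀, f ∈ supported ℝ (Finset.Icc 1 D : Set ℕ+) := by
  refine ⟨f.vars.sup id, fun D hD => mem_supported.2 fun k hk => ?_⟩
  exact Finset.mem_coe.2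
    (Finset.mem_Icc.2 ⟨one_le, (Finset.le_sup (f := id) (Finset.mem_coe.1 hk)).trans hD⟩)

theorem symLaplace_jackSym (hα : 0 < α) {D : ℕ+}
    (hD : jackSym α lam ∈ supported ℝ (Finset.Icc 1 D : Set ℕ+)) :
    symLaplace α D (jackSym α lam) = partsEigenval α lam.parts • jackSym α lam := by
  refine sub_eq_zero.1 (eq_zero_of_toVars fun n => ?_)
  -- `n + d` variables leave room for all the parts of `lam`
  suffices h : toVars (n + d) (symLaplace α D (jackSym α lam)) =
      toVars (n + d) (partsEigenval α lam.parts • jackSym α lam) by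
    rw [← killCompl_toVars (Fin.castAddEmb d), map_sub, h, sub_self, map_zero]
  obtain ⟨nu, hnu⟩ := exists_partsOf_eq (n := n + d) (zero_notMem_parts lam)
    ((card_parts_le lam).trans (Nat.le_add_left _ _))
  refine eq_of_eval_eq_of_injective fun x hx => ?_
  rw [← laplaceAt_toVars α hD hx, map_smul, toVars_jackSym α hnu, laplaceAt_jackSum hα nu hx,
    eigenval_eq_partsEigenval, hnu, smul_eval]

theorem diagForm_jackSym_jackSym (hα : 0 < α) (h : DomLT mu lam) :
    diagForm (jackNorm α) (jackSym α lam) (jackSym α mu) = 0 := by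
  obtain ⟨D₁, h₁⟩ := exists_forall_ge_mem_supported (jackSym α lam)
  obtain ⟨D₂, h₂⟩ := exists_forall_ge_mem_supported (jackSym α mu)
  have hself := diagForm_symLaplace α (max D₁ D₂) (jackSym α lam) (jackSym α mu)
  rw [symLaplace_jackSym hα (h₁ _ (le_max_left _ _)),
    symLaplace_jackSym hα (h₂ _ (le_max_right _ _)), map_smul, map_smul,
    LinearMap.smul_apply] at hself
  by_contra hne
  exact (partsEigenval_lt hα h).ne' (smul_left_injective ℝ hne hself)

theorem diagForm_jackSym_symMon (hα : 0 < α) (h : DomLT mu lam) :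
    diagForm (jackNorm α) (jackSym α lam) (symMon mu) = 0 := by
  induction mu using domLT_wf.induction with
  | _ mu ih =>
    have horth := diagForm_jackSym_jackSym hα h
    rwa [jackSym_eq_monicSum α mu, monicSum, map_add, map_sum, Finset.sum_eq_zero, add_zero]
      at horth
    intro kap _
    rw [map_smul, ih kap.1 kap.2 (domLT_trans kap.2 h), smul_zero]

end JackSymmetric

/-! ### Gram-Schmidt orthogonalization and its limit -/

section Gram

variable {w : (ℕ+ →₀ ℕ) → ℝ} {d : ℕ} {lam : d.Partition}

theorem eq_zero_of_diagForm_self (hw : ∀ m, 0 < w m) {f : SymFun} (h : diagForm w f f = 0) :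
    f = 0 := by
  rw [diagForm_apply, Finset.sum_eq_zero_iff_of_nonneg
    fun m _ => mul_nonneg (mul_self_nonneg _) (hw m).le] at h
  refine support_eq_empty.1 (Finset.eq_empty_of_forall_notMem fun m hm => ?_)
  have hm' := mem_support_iff.1 hm
  exact mul_ne_zero (mul_ne_zero hm' hm') (hw m).ne' (h m hm)

/-- The Gram matrix, for `diagForm w`, of the monomial symmetric functions below that of `lam`. -/
def gram (w : (ℕ+ →₀ ℕ) → ℝ) (lam : d.Partition) : Matrix (Below lam) (Below lam) ℝ :=
  Matrix.of fun kap mu => diagForm w (symMon kap.1) (symMon mu.1)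

/-- The pairings of the monomial symmetric function of `lam` with those below it. -/
def gramVec (w : (ℕ+ →₀ ℕ) → ℝ) (lam : d.Partition) : Below lam → ℝ :=
  fun mu => diagForm w (symMon lam) (symMon mu.1)

/-- The coefficients of the combination `monicSum` orthogonal to all lower monomial symmetric
functions, by Cramer's rule. -/
def gramCoeff (w : (ℕ+ →₀ ℕ) → ℝ) (lam : d.Partition) : Below lam → ℝ :=
  -Matrix.vecMul (gramVec w lam) (gram w lam)⁻¹

theorem diagForm_sum_smul_symMon (c : Below lam → ℝ) (mu : Below lam) :
    diagForm w (∑ kap, c kap • symMon kap.1) (symMon mu.1) = Matrix.vecMul c (gram w lam) mu := by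
  simp only [map_sum, map_smul, LinearMap.sum_apply, LinearMap.smul_apply, smul_eq_mul,
    Matrix.vecMul, dotProduct, gram, Matrix.of_apply]

theorem eq_zero_of_sum_smul_symMon {c : Below lam → ℝ} (h : ∑ kap, c kap • symMon kap.1 = 0) :
    c = 0 := by
  funext kap
  have hcoeff := congrArg
    (fun f => coeff (Finsupp.equivFunOnFinite.symm (compOf kap.1)) (toVars d f)) h
  simp only [map_sum, map_smul, toVars_symMon, map_zero, coeff_sum, coeff_smul, coeff_msymm,
    smul_eq_mul, coeff_zero, Finsupp.coe_equivFunOnFinite_symm, partsOf_compOf] at hcoeff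
  rwa [Finset.sum_eq_single_of_mem kap (Finset.mem_univ _) fun mu _ hmu => by
    rw [if_neg fun h => hmu (Subtype.ext (Nat.Partition.ext h.symm)), mul_zero], if_pos rfl,
    mul_one] at hcoeff

theorem isUnit_det_gram (hw : ∀ m, 0 < w m) (lam : d.Partition) : IsUnit (gram w lam).det := by
  refine isUnit_iff_ne_zero.2 fun h => ?_
  obtain ⟨c, hc, hc0⟩ := Matrix.exists_vecMul_eq_zero_iff.2 h
  refine hc (eq_zero_of_sum_smul_symMon (eq_zero_of_diagForm_self hw ?_))
  rw [map_sum]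
  exact Finset.sum_eq_zero fun mu _ => by
    rw [map_smul, diagForm_sum_smul_symMon, hc0, Pi.zero_apply, smul_zero]

theorem forall_diagForm_monicSum_eq_zero_iff (hw : ∀ m, 0 < w m) {c : Below lam → ℝ} :
    (∀ mu : Below lam, diagForm w (monicSum lam c) (symMon mu.1) = 0) ↔ c = gramCoeff w lam := by
  have hu := isUnit_det_gram hw lam
  calc (∀ mu : Below lam, diagForm w (monicSum lam c) (symMon mu.1) = 0)
      ↔ gramVec w lam + Matrix.vecMul c (gram w lam) = 0 := by
        simp only [funext_iff, monicSum, map_add, LinearMap.add_apply, diagForm_sum_smul_symMon,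
          Pi.add_apply, gramVec, Pi.zero_apply]
    _ ↔ Matrix.vecMul c (gram w lam) = -gramVec w lam := add_eq_zero_iff_eq_neg'
    _ ↔ c = gramCoeff w lam := by
        rw [gramCoeff, ← Matrix.neg_vecMul]
        refine ⟨fun h => ?_, fun h => ?_⟩
        · rw [← h, Matrix.vecMul_vecMul, Matrix.mul_nonsing_inv _ hu, Matrix.vecMul_one]
        · rw [h, Matrix.vecMul_vecMul, Matrix.nonsing_inv_mul _ hu, Matrix.vecMul_one]

theorem tendsto_vecMul_inv {ι κ K : Type*} [Fintype κ] [DecidableEq κ] [Field K]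
    [TopologicalSpace K] [IsTopologicalDivisionRing K] {l : Filter ι} {b : ι → κ → K} {b₀ : κ → K}
    {A : ι → Matrix κ κ K} {A₀ : Matrix κ κ K} (hb : Tendsto b l (𝓝 b₀)) (hA : Tendsto A l (𝓝 A₀))
    (hdet : A₀.det ≠ 0) :
    Tendsto (fun i => Matrix.vecMul (b i) (A i)⁻¹) l (𝓝 (Matrix.vecMul b₀ A₀⁻¹)) := by
  have hinv : Tendsto (fun i => (A i)⁻¹) l (𝓝 A₀⁻¹) := by
    simp only [Matrix.inv_def, Ring.inverse_eq_inv']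
    exact (((continuous_id.matrix_det.tendsto A₀).comp hA).inv₀ hdet).smul
      ((continuous_id.matrix_adjugate.tendsto A₀).comp hA)
  exact tendsto_pi_nhds.2 fun k => tendsto_finsetSum _ fun j _ =>
    (tendsto_pi_nhds.1 hb j).mul (tendsto_pi_nhds.1 (tendsto_pi_nhds.1 hinv j) k)

theorem tendsto_diagForm {ι : Type*} {l : Filter ι} {v : ι → (ℕ+ →₀ ℕ) → ℝ}
    (h : ∀ m, Tendsto (fun i => v i m) l (𝓝 (w m))) (f g : SymFun) :
    Tendsto (fun i => diagForm (v i) f g) l (𝓝 (diagForm w f g)) := by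
  simp only [diagForm_apply]
  exact tendsto_finsetSum _ fun m _ => (h m).const_mul _

theorem tendsto_gramCoeff {ι : Type*} {l : Filter ι} {v : ι → (ℕ+ →₀ ℕ) → ℝ}
    (hw : ∀ m, 0 < w m) (h : ∀ m, Tendsto (fun i => v i m) l (𝓝 (w m))) (lam : d.Partition) :
    Tendsto (fun i => gramCoeff (v i) lam) l (𝓝 (gramCoeff w lam)) := by
  have hgram : Tendsto (fun i => gram (v i) lam) l (𝓝 (gram w lam)) :=
    tendsto_pi_nhds.2 fun kap => tendsto_pi_nhds.2 fun mu => tendsto_diagForm h _ _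
  have hvec : Tendsto (fun i => gramVec (v i) lam) l (𝓝 (gramVec w lam)) :=
    tendsto_pi_nhds.2 fun mu => tendsto_diagForm h _ _
  exact (tendsto_vecMul_inv hvec hgram (isUnit_det_gram hw lam).ne_zero).neg

end Gram

section Macdonald

variable {q t α : ℝ} {d : ℕ} {lam : d.Partition}

theorem scalarProduct_eq_diagForm (q t : ℝ) (f g : SymFun) :
    scalarProduct q t f g = diagForm (powerSumNorm q t) f g :=
  (diagForm_apply _ f g).symm

theorem finsum_domLT {M : Type*} [AddCommMonoid M] (g : d.Partition → M) :
    ∑ᶠ (mu : d.Partition) (_ : DomLT mu lam), g mu = ∑ mu : Below lam, g mu.1 := by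
  classical
  simp only [finsum_eq_sum_of_fintype, finsum_eq_if, ← Finset.sum_filter, sum_below]

theorem isMonicTriangular_monicSum (c : Below lam → ℝ) :
    IsMonicTriangular lam (monicSum lam c) := by
  classical
  refine ⟨fun mu => if h : DomLT mu lam then c ⟨mu, h⟩ else 0, fun n => ?_⟩
  rw [monicSum, map_add, toVars_symMon, finsum_domLT, map_sum]
  exact congrArg _ (Finset.sum_congr rfl fun mu _ => by
    simp only [dif_pos mu.2, map_smul, toVars_symMon])

theorem exists_eq_sum_smul_symMon {Q : SymFun} (hQ : IsLower lam Q) :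
    ∃ c : Below lam → ℝ, Q = ∑ mu, c mu • symMon mu.1 := by
  obtain ⟨c, hc⟩ := hQ
  refine ⟨fun mu => c mu.1, sub_eq_zero.1 (eq_zero_of_toVars fun n => ?_)⟩
  rw [map_sub, hc, finsum_domLT, map_sum, sub_eq_zero]
  simp only [map_smul, toVars_symMon]

theorem powerSumNorm_pos (hpos : ∀ k : ℕ+, 0 < (1 - q ^ (k : ℕ)) / (1 - t ^ (k : ℕ)))
    (m : ℕ+ →₀ ℕ) : 0 < powerSumNorm q t m :=
  Finset.prod_pos fun k _ => by
    have := hpos k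
    have := k.pos
    positivity

theorem isMacdonald_monicSum_gramCoeff
    (hpos : ∀ k : ℕ+, 0 < (1 - q ^ (k : ℕ)) / (1 - t ^ (k : ℕ))) (lam : d.Partition) :
    IsMacdonald q t lam (monicSum lam (gramCoeff (powerSumNorm q t) lam)) := by
  refine ⟨isMonicTriangular_monicSum _, fun Q hQ => ?_⟩
  obtain ⟨c, rfl⟩ := exists_eq_sum_smul_symMon hQ
  rw [scalarProduct_eq_diagForm, map_sum]
  exact Finset.sum_eq_zero fun mu _ => by
    rw [map_smul, (forall_diagForm_monicSum_eq_zero_iff (powerSumNorm_pos hpos)).2 rfl, smul_zero]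

theorem macdonaldSym_eq_monicSum
    (hpos : ∀ k : ℕ+, 0 < (1 - q ^ (k : ℕ)) / (1 - t ^ (k : ℕ))) (lam : d.Partition) :
    macdonaldSym q t lam = monicSum lam (gramCoeff (powerSumNorm q t) lam) := by
  have hmac := isMacdonald_monicSum_gramCoeff hpos lam
  have hex : ∃! P, IsMacdonald q t lam P := ⟨_, hmac, fun P hP => isMacdonald_unique hpos hP hmac⟩
  rw [macdonaldSym, dif_pos hex]
  exact isMacdonald_unique hpos hex.choose_spec.1 hmac

theorem tendsto_one_sub_rpow_div (a : ℝ) {b : ℝ} (hb : b ≠ 0) :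
    Tendsto (fun t : ℝ => (1 - t ^ a) / (1 - t ^ b)) (𝓝[≠] 1) (𝓝 (a / b)) := by
  have hslope (a : ℝ) : Tendsto (slope (fun t : ℝ => t ^ a) 1) (𝓝[≠] 1) (𝓝 a) := by
    have h := hasDerivAt_iff_tendsto_slope.1
      (Real.hasDerivAt_rpow_const (x := 1) (p := a) (Or.inl one_ne_zero))
    rwa [Real.one_rpow, mul_one] at h
  refine ((hslope a).div (hslope b) hb).congr' ?_
  filter_upwards [self_mem_nhdsWithin] with t ht
  rw [Pi.div_apply, slope_def_field, slope_def_field, Real.one_rpow, Real.one_rpow,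
    div_div_div_cancel_right₀ (sub_ne_zero.2 ht), ← neg_div_neg_eq, neg_sub, neg_sub]

theorem eventually_pos_and_ne_one : ∀ᶠ t : ℝ in 𝓝[≠] 1, 0 < t ∧ t ≠ 1 :=
  ((eventually_gt_nhds one_pos).filter_mono nhdsWithin_le_nhds).and self_mem_nhdsWithin

theorem tendsto_powerSumNorm (α : ℝ) (m : ℕ+ →₀ ℕ) :
    Tendsto (fun t : ℝ => powerSumNorm (t ^ α) t m) (𝓝[≠] 1) (𝓝 (jackNorm α m)) := by
  refine tendsto_finsetProd _ fun k _ => Tendsto.const_mul _ (Tendsto.pow ?_ _)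
  have hk : ((k : ℕ) : ℝ) ≠ 0 := Nat.cast_ne_zero.2 k.pos.ne'
  have h := tendsto_one_sub_rpow_div (α * (k : ℕ)) hk
  rw [mul_div_cancel_right₀ _ hk] at h
  refine h.congr' ?_
  filter_upwards [eventually_pos_and_ne_one] with t ht
  rw [Real.rpow_mul ht.1.le, Real.rpow_natCast, Real.rpow_natCast]

theorem jackNorm_pos (hα : 0 < α) (m : ℕ+ →₀ ℕ) : 0 < jackNorm α m :=
  Finset.prod_pos fun k _ => by
    have := k.pos
    positivity

theorem one_sub_rpow_pow_div_pos (hα : 0 < α) (ht : 0 < t) (ht1 : t ≠ 1) (k : ℕ+) :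
    0 < (1 - (t ^ α) ^ (k : ℕ)) / (1 - t ^ (k : ℕ)) := by
  have hk := k.pos.ne'
  rcases lt_or_gt_of_ne ht1 with h | h
  · exact div_pos (sub_pos.2 (pow_lt_one₀ (Real.rpow_nonneg ht.le _)
      (Real.rpow_lt_one ht.le h hα) hk)) (sub_pos.2 (pow_lt_one₀ ht.le h hk))
  · exact div_pos_of_neg_of_neg (sub_neg.2 (one_lt_pow₀ (Real.one_lt_rpow h hα) hk))
      (sub_neg.2 (one_lt_pow₀ h hk))

theorem jackSym_eq_monicSum_gramCoeff (hα : 0 < α) (lam : d.Partition) :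
    jackSym α lam = monicSum lam (gramCoeff (jackNorm α) lam) := by
  rw [jackSym_eq_monicSum]
  refine congrArg _ ((forall_diagForm_monicSum_eq_zero_iff (jackNorm_pos hα)).1 fun mu => ?_)
  rw [← jackSym_eq_monicSum, diagForm_jackSym_symMon hα mu.2]

theorem coeff_toVars_monicSum (k : Fin n →₀ ℕ) (c : Below lam → ℝ) :
    coeff k (toVars n (monicSum lam c)) =
      coeff k (toVars n (symMon lam)) + ∑ mu, c mu * coeff k (toVars n (symMon mu.1)) := by
  simp only [monicSum, map_add, map_sum, map_smul, coeff_add, coeff_sum, coeff_smul, smul_eq_mul]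

theorem isJackPoly_jackSum (hα : 0 < α) (mu : Fin n → ℕ) : IsJackPoly α mu (jackSum α mu) := by
  intro k
  rw [← toVars_jackSym α (lam := toPartition mu) rfl, jackSym_eq_monicSum_gramCoeff hα,
    coeff_toVars_monicSum]
  have hgram := tendsto_pi_nhds.1
    (tendsto_gramCoeff (jackNorm_pos hα) (tendsto_powerSumNorm α) (toPartition mu))
  refine (tendsto_const_nhds.add
    (tendsto_finsetSum _ fun kap _ => (hgram kap).mul_const _)).congr' ?_
  filter_upwards [eventually_pos_and_ne_one] with t ht
  rw [macdonaldPoly, macdonaldSym_eq_monicSum (one_sub_rpow_pow_div_pos hα ht.1 ht.2),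
    coeff_toVars_monicSum]

end Macdonald

/-! ### The sum formulas -/

section Limit

variable {α : ℝ} {i j : ℕ}

theorem conj_antitone (mu : Fin n → ℕ) : Antitone (conj mu) := fun _ _ h =>
  Finset.card_le_card <| Finset.monotone_filter_right _ fun _ _ => h.trans

theorem rpow_sub_mul_add_conj_sub_conj {t : ℝ} (ht : 0 < t) (α : ℝ) (h : i ≤ j)
    (mu : Fin n → ℕ) (k : ℕ) :
    t ^ (((j : ℝ) - i) * α + conj mu i - conj mu j + k) =
      (t ^ α) ^ (j - i) * t ^ (conj mu i - conj mu j + k) := by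
  rw [← Real.rpow_natCast (t ^ α), ← Real.rpow_mul ht.le, ← Real.rpow_natCast t,
    ← Real.rpow_add ht, Nat.cast_sub h, Nat.cast_add, Nat.cast_sub (conj_antitone mu h)]
  ring_nf

theorem tendsto_macdonaldCoeff_factor (hα : 0 < α) (h : i < j) (mu : Fin n → ℕ) (k : ℕ) :
    Tendsto (fun t : ℝ => (1 - t ^ k) /
        (1 - (t ^ α) ^ (j - i) * t ^ (conj mu i - conj mu j + k))) (𝓝[≠] 1)
      (𝓝 (k / (((j : ℝ) - i) * α + conj mu i - conj mu j + k))) := by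
  have hconj : (conj mu j : ℝ) ≤ conj mu i := by exact_mod_cast conj_antitone mu h.le
  have hji : (0 : ℝ) < (j - i) * α := mul_pos (sub_pos.2 (by exact_mod_cast h)) hα
  have hexp : ((j : ℝ) - i) * α + conj mu i - conj mu j + k ≠ 0 := by
    have : (0 : ℝ) ≤ k := k.cast_nonneg
    exact ne_of_gt (by linarith)
  refine (tendsto_one_sub_rpow_div k hexp).congr' ?_
  filter_upwards [eventually_pos_and_ne_one] with t ht
  rw [rpow_sub_mul_add_conj_sub_conj ht.1 α h.le, Real.rpow_natCast]

theorem tendsto_macdonaldCoeff (hα : 0 < α) (r i : ℕ) (mu nu : Fin n → ℕ) :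
    Tendsto (fun t : ℝ => macdonaldCoeff (t ^ α) t r i mu nu) (𝓝[≠] 1)
      (𝓝 (jackCoeff α r i mu nu)) := by
  unfold macdonaldCoeff jackCoeff
  split_ifs
  · exact tendsto_const_nhds
  have hrpow : Tendsto (fun t : ℝ => t ^ α) (𝓝[≠] 1) (𝓝 1) := by
    simpa using ((Real.continuousAt_rpow_const 1 α (Or.inl one_ne_zero)).tendsto).mono_left
      nhdsWithin_le_nhds
  refine tendsto_finsetProd _ fun j hj => ?_
  simpa only [one_pow, one_mul] using (hrpow.pow ((j - i) * aFun j mu nu)).mul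
    (tendsto_finsetProd _ fun k _ =>
      tendsto_macdonaldCoeff_factor hα (Finset.mem_Icc.1 hj).1 mu k)

end Limit

section NestedSum

variable {lam mu : Fin n → ℕ} {S : Finset (Equiv.Perm (Fin n))} {i a : ℕ}

theorem trunc_zero (lam : Fin n → ℕ) : trunc lam 0 = lam := by
  funext k
  simp only [trunc]
  split_ifs <;> omega

theorem xMon_trunc (lam : Fin n → ℕ) (i : ℕ) : xMon (trunc lam i) = xMon (lam - (i : Fin n → ℕ)) :=
  xMon_congr fun k => by
    simp only [trunc, Pi.sub_apply, Pi.natCast_apply, Nat.cast_id]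
    split_ifs <;> omega

theorem admissible_sub_iff (lam : Fin n → ℕ) (i : ℕ) (s : Equiv.Perm (Fin n)) :
    Admissible (lam - (i : Fin n → ℕ)) (permComp s (lam - ((i + 1 : ℕ) : Fin n → ℕ))) ↔
      ¬ ∃ k, 0 < trunc lam i k ∧ trunc lam i k < permComp s (trunc lam (i + 1)) k := by
  rw [not_exists]
  refine forall_congr' fun k => ?_
  simp only [trunc, permComp, Pi.sub_apply, Pi.natCast_apply, Nat.cast_id]
  split_ifs <;> omega

theorem bFun_trunc (lam : Fin n → ℕ) (i : ℕ) (s : Equiv.Perm (Fin n)) (ha : 2 ≤ a) :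
    bFun (a + i) (trunc lam i) (permComp s (trunc lam (i + 1))) =
      dropCount (lam - (i : Fin n → ℕ)) (permComp s (lam - ((i + 1 : ℕ) : Fin n → ℕ))) a := by
  unfold bFun dropCount
  congr 1
  refine Finset.filter_congr fun k _ => ?_
  simp only [trunc, permComp, Pi.sub_apply, Pi.natCast_apply, Nat.cast_id]
  split_ifs <;> omega

theorem conj_trunc (lam : Fin n → ℕ) (i : ℕ) (ha : 0 < a) :
    conj (trunc lam i) (i + 1) =
      conj (trunc lam i) (a + i) + numPartsBelow (lam - (i : Fin n → ℕ)) a := by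
  unfold conj numPartsBelow
  rw [Finset.card_filter, Finset.card_filter, Finset.card_filter, ← Finset.sum_add_distrib]
  refine Finset.sum_congr rfl fun k _ => ?_
  simp only [trunc, Pi.sub_apply, Pi.natCast_apply, Nat.cast_id]
  split_ifs <;> omega

theorem jackCoeff_trunc (α : ℝ) (lam : Fin n → ℕ) (i : ℕ) (s : Equiv.Perm (Fin n)) :
    jackCoeff α (largestPart lam) (i + 1) (trunc lam i) (permComp s (trunc lam (i + 1))) =
      stepWeight α (lam - (i : Fin n → ℕ)) (permComp s (lam - ((i + 1 : ℕ) : Fin n → ℕ))) := by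
  rw [jackCoeff, stepWeight, ← ite_not]
  refine if_congr (admissible_sub_iff lam i s).symm ?_ rfl
  rw [largestPart_sub]
  symm
  refine Finset.prod_nbij' (· + i) (· - i) ?_ ?_ ?_ ?_ fun a ha => ?_
  any_goals
    intro _ h
    simp only [Finset.mem_Icc] at h ⊢
    omega
  have ha : 2 ≤ a := (Finset.mem_Icc.1 ha).1
  rw [bFun_trunc lam i s ha, conj_trunc lam i (zero_lt_two.trans_le ha)]
  refine Finset.prod_congr rfl fun k _ => ?_
  push_cast
  ring_nf

theorem IsReps.sum_eq {M : Type*} [AddCommMonoid M] (h : IsReps mu S) (g : (Fin n → ℕ) → M) :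
    ∑ s ∈ S, g (permComp s mu) = ∑ nu ∈ orbit mu, g nu := by
  refine Finset.sum_bij (fun s _ => permComp s mu)
    (fun s _ => mem_orbit.2 ⟨s, rfl⟩) (fun s hs t ht e => ?_) (fun nu hnu => ?_) fun _ _ => rfl
  · exact (h t).unique ⟨hs, e⟩ ⟨ht, rfl⟩
  · obtain ⟨t, rfl⟩ := mem_orbit.1 hnu
    obtain ⟨u, ⟨hu, he⟩, -⟩ := h t
    exact ⟨u, hu, he⟩

theorem IsReps.sub (h : IsReps (trunc lam i) S) : IsReps (lam - (i : Fin n → ℕ)) S := by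
  have permComp_eq_iff (s t : Equiv.Perm (Fin n)) :
      permComp s (lam - (i : Fin n → ℕ)) = permComp t (lam - (i : Fin n → ℕ)) ↔
        permComp s (trunc lam i) = permComp t (trunc lam i) := by
    rw [funext_iff, funext_iff]
    refine forall_congr' fun k => ?_
    simp only [permComp, trunc, Pi.sub_apply, Pi.natCast_apply, Nat.cast_id]
    split_ifs <;> omega
  intro t
  simpa only [permComp_eq_iff] using h t

theorem kzPoly_of_le_one (α : ℝ) (h : ∀ k, mu k ≤ 1) : kzPoly α mu = xMon mu := by
  have hsub : mu - 1 = 0 := funext fun k => Nat.sub_eq_zero_of_le (h k)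
  rw [kzPoly_eq, stepSum, hsub, orbit_zero, Finset.sum_singleton, kzPoly_zero, ← hsub,
    stepWeight_sub_one_self, one_smul, mul_one]

theorem xMon_mul_jackNestedTail (α : ℝ) (lam : Fin n → ℕ) {S : ℕ → Finset (Equiv.Perm (Fin n))}
    (hS : ∀ i ≤ largestPart lam - 1, IsReps (trunc lam i) (S i)) {i s : ℕ}
    (his : i + s = largestPart lam - 1) :
    xMon (trunc lam i) * jackNestedTail α lam S i s = kzPoly α (lam - (i : Fin n → ℕ)) := by
  induction s generalizing i with
  | zero =>
    rw [jackNestedTail, mul_one, xMon_trunc, kzPoly_of_le_one]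
    intro k
    have := le_largestPart lam k
    simp only [Pi.sub_apply, Pi.natCast_apply, Nat.cast_id]
    omega
  | succ s ih =>
    have hsub : lam - (i : Fin n → ℕ) - 1 = lam - ((i + 1 : ℕ) : Fin n → ℕ) := by
      rw [Nat.cast_succ, tsub_tsub]
    rw [jackNestedTail, kzPoly_eq, xMon_trunc, stepSum, hsub,
      ← (hS (i + 1) (by omega)).sub.sum_eq
        fun nu => stepWeight α (lam - (i : Fin n → ℕ)) nu • kzPoly α nu]
    simp only [jackCoeff_trunc, ih (i := i + 1) (by omega), rename_kzPoly]

theorem jackNestedSum_eq_jackSum (α : ℝ) (lam : Fin n → ℕ)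
    {S : ℕ → Finset (Equiv.Perm (Fin n))}
    (hS : ∀ i ≤ largestPart lam - 1, IsReps (trunc lam i) (S i)) :
    jackNestedSum α lam S = jackSum α lam := by
  have htail : xMon lam * jackNestedTail α lam S 0 (largestPart lam - 1) = kzPoly α lam := by
    simpa [trunc_zero] using xMon_mul_jackNestedTail α lam hS (zero_add _)
  have hreps : IsReps lam (S 0) := by simpa only [trunc_zero] using hS 0 (Nat.zero_le _)
  simp only [jackNestedSum, htail, rename_kzPoly, hreps.sum_eq (kzPoly α), jackSum]

end NestedSum

section MultiSum

theorem sum_piFinset_succ {P M : Type*} [AddCommMonoid M] {s : ℕ}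
    (A : Fin (s + 1) → Finset P) (g : (Fin (s + 1) → P) → M) :
    ∑ p ∈ Fintype.piFinset A, g p =
      ∑ a ∈ A 0, ∑ q ∈ Fintype.piFinset fun k : Fin s => A k.succ,
        g (Fin.cons (α := fun _ => P) a q) := by
  rw [← Finset.sum_product']
  refine Finset.sum_nbij' (fun p => (p 0, Fin.tail p))
    (fun q => Fin.cons (α := fun _ => P) q.1 q.2) ?_ ?_ ?_ ?_ ?_
  all_goals simp +contextual [Fin.forall_fin_succ, Fin.tail]

theorem partialProd_cons_succ {G : Type*} [Monoid G] {s : ℕ} (a : G) (p : Fin s → G)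
    (j : Fin (s + 1)) :
    Fin.partialProd (Fin.cons (α := fun _ => G) a p : Fin (s + 1) → G) j.succ =
      a * Fin.partialProd p j :=
  Fin.partialProd_succ' _ j

theorem rename_perm_mul {σ R : Type*} [CommSemiring R] (a b : Equiv.Perm σ)
    (g : MvPolynomial σ R) :
    rename (a * b : Equiv.Perm σ) g = rename a (rename b g) :=
  (rename_rename b a g).symm

theorem jackNestedTail_eq_sum (α : ℝ) (lam : Fin n → ℕ) (S : ℕ → Finset (Equiv.Perm (Fin n)))
    (i s : ℕ) :
    jackNestedTail α lam S i s =
      ∑ p ∈ Fintype.piFinset fun k : Fin s => S (i + 1 + k),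
        (∏ k : Fin s, jackCoeff α (largestPart lam) (i + 1 + k) (trunc lam (i + k))
          (permComp (p k) (trunc lam (i + 1 + k)))) •
        ∏ k : Fin s, rename (Fin.partialProd p k.succ : Equiv.Perm (Fin n))
          (xMon (trunc lam (i + 1 + k))) := by
  induction s generalizing i with
  | zero => simp [jackNestedTail]
  | succ s ih =>
    have hi (k : Fin s) : i + ((k : ℕ) + 1) = i + 1 + k := by omega
    have hi' (k : Fin s) : i + 1 + ((k : ℕ) + 1) = i + 1 + 1 + k := by omega
    simp only [jackNestedTail, sum_piFinset_succ, Fin.val_zero, add_zero, Fin.val_succ, hi, hi',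
      Fin.prod_univ_succ, Fin.cons_zero, Fin.cons_succ, partialProd_cons_succ,
      Fin.partialProd_zero, mul_one]
    refine Finset.sum_congr rfl fun a _ => ?_
    rw [ih, map_mul, map_sum, Finset.mul_sum, Finset.smul_sum]
    refine Finset.sum_congr rfl fun p _ => ?_
    simp only [map_smul, map_prod, mul_smul, mul_smul_comm, rename_perm_mul]

theorem jackMultiSum_eq_jackNestedSum (α : ℝ) (lam : Fin n → ℕ)
    (S : ℕ → Finset (Equiv.Perm (Fin n))) : jackMultiSum α lam S = jackNestedSum α lam S := by
  rw [jackMultiSum, jackNestedSum, sum_piFinset_succ]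
  refine Finset.sum_congr rfl fun a _ => ?_
  rw [jackNestedTail_eq_sum, map_mul, map_sum, Finset.mul_sum]
  simp only [zero_add, Nat.add_comm 1, Fin.val_succ]
  refine Finset.sum_congr rfl fun p _ => ?_
  rw [map_smul, map_prod, mul_smul_comm, Fin.prod_univ_succ]
  simp only [partialProd_cons_succ, Fin.partialProd_zero, mul_one, Fin.val_zero, trunc_zero,
    Fin.val_succ, rename_perm_mul, Fin.cons_succ]

end MultiSum

end JackSum

end

open JackSum in
theorem mainTheorem2_general (n : ℕ) (lam : Fin n → ℕ) (α : ℝ) (hα : 0 < α) :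
    (∀ (r i : ℕ) (mu nu : Fin n → ℕ),
      Filter.Tendsto (fun t : ℝ => macdonaldCoeff (t ^ α) t r i mu nu)
        (nhdsWithin 1 {1}ᶜ) (nhds (jackCoeff α r i mu nu))) ∧
    ∀ S : ℕ → Finset (Equiv.Perm (Fin n)),
      (∀ i ≤ largestPart lam - 1, IsReps (trunc lam i) (S i)) →
        IsJackPoly α lam (jackNestedSum α lam S) ∧
        IsJackPoly α lam (jackMultiSum α lam S) := by
  refine ⟨tendsto_macdonaldCoeff hα, fun S hS => ?_⟩
  rw [jackMultiSum_eq_jackNestedSum, jackNestedSum_eq_jackSum α lam hS, and_self_iff]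
  exact isJackPoly_jackSum hα lam

open JackSum in
theorem mainTheorem2 (n : ℕ) (lam : Fin n → ℕ) (hlam : Antitone lam) (α : ℝ) (hα : 0 < α) :
    (∀ (r i : ℕ) (mu nu : Fin n → ℕ),
      Filter.Tendsto (fun t : ℝ => macdonaldCoeff (t ^ α) t r i mu nu)
        (nhdsWithin 1 {1}ᶜ) (nhds (jackCoeff α r i mu nu))) ∧
    ∀ S : ℕ → Finset (Equiv.Perm (Fin n)),
      (∀ i ≤ largestPart lam - 1, IsReps (trunc lam i) (S i)) →
        IsJackPoly α lam (jackNestedSum α lam S) ∧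
        IsJackPoly α lam (jackMultiSum α lam S) :=
  mainTheorem2_general n lam α hα
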